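/- **Conventions.** Let $(Z,d)$ be a metric space. The category $\mathcal{C}(Z,d;\mathbb{Z})$ has as objects the families $M=(M_z)_{z\in Z}$ with each $M_z$ of the form $\mathbb{Z}^{n}$, $n\ge 0$, whose support $\{z \mid M_z\neq 0\}$ is locally finite. A morphism $\psi\colon M\to M'$ is a family of homomorphisms $\psi_{z',z}\colon M_z\to M'_{z'}$ whose support $\operatorname{supp}\psi=\{(z',z)\mid \psi_{z',z}\neq 0\}$ is contained in $\{(z',z)\mid d(z',z)\le\alpha\}$ for some $\alpha>0$ and which is row and column finite; composition is matrix multiplication. $\psi$ is $\varepsilon$-controlled if $d(z',z)\le\varepsilon$ for all $(z',z)\in\operatorname{supp}\psi$. Objects of the idempotent completion $\operatorname{Idem}(\mathcal{C}(Z,d;\mathbb{Z}))$ are idempotents $p\colon M\to M$; morphisms $(M,p)\to(N,q)$ are the $f\colon M\to N$ with $qfp=f$. A chain complex over $\operatorname{Idem}(\mathcal{C}(Z,d;\mathbb{Z}))$ is $\varepsilon$-controlled if the idempotents defining its chain objects and all its differentials are $\varepsilon$-controlled. The support of a chain map or a chain homotopy is the union of the supports of its components. Let $S$ be a finite subset of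 a group $G$ with $e\in S$. A homotopy $S$-action $(\varphi,H)$ on a space $X$ consists of continuous maps $\varphi_g\colon X\to X$ for $g\in S$ and homotopies $H_{g,h}\colon X\times[0,1]\to X$ from $\varphi_g\circ\varphi_h$ to $\varphi_{gh}$ for all $g,h\in S$ with $gh\in S$, such that $H_{e,e}(-,t)=\varphi_e=\mathrm{id}_X$ for all $t$. A homotopy $S$-chain complex $\mathbf{P}=(P,\varphi^P,H^P)$ over $\operatorname{Idem}(\mathcal{C}(Z,d;\mathbb{Z}))$ consists of a chain complex $P$, chain maps $\varphi^P_g\colon P\to P$ for $g\in S$, and chain homotopies $H^P_{g,h}$ from $\varphi^P_g\circ\varphi^P_h$ to $\varphi^P_{gh}$ for all $g,h\in S$ with $gh\in S$, such that $\varphi^P_e=\mathrm{id}$ and $H^P_{e,e}=0$. A homotopy $S$-chain equivalence $\mathbf{P}\to\mathbf{Q}$ is a chain homotopy equivalence $f\colon P\to Q$ such that $f\circ\varphi^P_g$ and $\varphi^Q_g\circ f$ are chain homotopic for all $g\in S$. For $z_0\in Z$ the trivial homotopy $S$-chain complex $\mathbf{T}_{z_0}$ has $\mathbb{Z}$ at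 $z_0$ in degree $0$ and is zero otherwise, with all $\varphi^T_g=\mathrm{id}$ and all $H^T_{g,h}=0$. A metric space $X$ is controlled $N$-dominated if for every $\varepsilon>0$ there are a finite CW-complex $K$ of dimension at most $N$, continuous maps $i\colon X\to K$, $p\colon K\to X$, and a homotopy $H\colon X\times[0,1]\to X$ from $p\circ i$ to $\mathrm{id}_X$ such that for every $x\in X$ the set $\{H(x,t)\mid t\in[0,1]\}$ has diameter at most $\varepsilon$. **Proposition.** Let $G$ be a group, $N\in\mathbb{N}$, and let $(X,d)$ be a compact contractible controlled $N$-dominated metric space. Let $S$ be a finite subset of $G$ containing $e$ and let $(\varphi,H)$ be a homotopy $S$-action on $X$. For every $\varepsilon>0$ there exists a homotopy $S$-chain complex $\mathbf{P}=(P,\varphi^P,H^P)$ over $\operatorname{Idem}(\mathcal{C}(X,d;\mathbb{Z}))$ such that: 1. $P$ is concentrated in degrees $0,\dots,N$; 2. $P$ is $\varepsilon$-controlled; 3. for every $x_0\in X$ there is a homotopy $S$-chain equivalence $f\colon\mathbf{P}\to\mathbf{T}_{x_0}$; 4. if $g\in S$ and $(x,y)\in\operatorname{supp}\varphi^P_g$,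 then $d(x,\varphi_g(y))\le\varepsilon$; 5. if $g,h\in S$ with $gh\in S$ and $(x,y)\in\operatorname{supp}H^P_{g,h}$, then there is $t\in[0,1]$ with $d(x,H_{g,h}(y,t))\le\varepsilon$. -/

import Mathlib

open CategoryTheory

universe u v

namespace ControlledAlgebra

/-! ### The controlled category `C(Z, d; ℤ)` -/

/-- An object of `C(Z, d; ℤ)`: a family `(M_z)_{z ∈ Z}` of objects `M_z = ℤ ^ (rank z)` of the
standard small category of finitely generated free `ℤ`-modules (morphisms are matrices), whose
support `{z | M_z ≠ 0}` is locally finite. -/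
structure CtrlObj (Z : Type u) [MetricSpace Z] where
  /-- the rank of the free module placed at a point -/
  rank : Z → ℕ
  locallyFinite : ∀ z : Z, ∃ U : Set Z, IsOpen U ∧ z ∈ U ∧ (U ∩ {y | rank y ≠ 0}).Finite

variable {Z : Type u} [MetricSpace Z]

/-- A morphism `M → M'` of `C(Z, d; ℤ)`: a family of homomorphisms `ψ_{z',z} : M_z → M'_{z'}`, given
as integral matrices, whose support has bounded control and which is row and column finite. -/
@[ext]
structure CtrlHom (M M' : CtrlObj Z) where
  /-- the component `M_z → M'_{z'}` -/
  mat : ∀ z' z : Z, Matrix (Fin (M'.rank z')) (Fin (M.rank z)) ℤ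
  controlled : ∃ α : ℝ, 0 < α ∧ ∀ z' z, mat z' z ≠ 0 → dist z' z ≤ α
  rowFinite : ∀ z', {z | mat z' z ≠ 0}.Finite
  colFinite : ∀ z, {z' | mat z' z ≠ 0}.Finite

namespace CtrlHom

open scoped Classical in
/-- The identity morphism. -/
noncomputable def id (M : CtrlObj Z) : CtrlHom M M where
  mat z' z := Matrix.of fun i j => if z' = z ∧ (i : ℕ) = (j : ℕ) then 1 else 0
  controlled := by
    refine ⟨1, one_pos, fun z' z h => ?_⟩
    by_cases e : z' = z
    · simp [e]
    · exact absurd (by ext i j; simp [e]) h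
  rowFinite z' := by
    refine (Set.finite_singleton z').subset fun z h => ?_
    by_contra e
    exact h (by ext i j; simp [show z' ≠ z from fun q => e q.symm])
  colFinite z := by
    refine (Set.finite_singleton z).subset fun z' h => ?_
    by_contra e
    exact h (by ext i j; simp [show z' ≠ z from e])

variable {M M' M'' M''' : CtrlObj Z}

/-- The components of a composite: matrix multiplication (the sum is finite by column
finiteness). -/
noncomputable def compMat (ψ : CtrlHom M M') (ψ' : CtrlHom M' M'') (z'' z : Z) :
    Matrix (Fin (M''.rank z'')) (Fin (M.rank z)) ℤ :=
  ∑ᶠ z' : Z, ψ'.mat z'' z' * ψ.mat z' z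

lemma compMat_eq_sum_col (ψ : CtrlHom M M') (ψ' : CtrlHom M' M'') (z'' z : Z) (s : Finset Z)
    (hs : ∀ z', ψ.mat z' z ≠ 0 → z' ∈ s) :
    compMat ψ ψ' z'' z = ∑ z' ∈ s, ψ'.mat z'' z' * ψ.mat z' z := by
  refine finsum_eq_sum_of_support_subset _ fun z' h => hs z' fun h0 => h ?_
  simp [h0]

lemma compMat_eq_sum_row (ψ : CtrlHom M M') (ψ' : CtrlHom M' M'') (z'' z : Z) (s : Finset Z)
    (hs : ∀ z', ψ'.mat z'' z' ≠ 0 → z' ∈ s) :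
    compMat ψ ψ' z'' z = ∑ z' ∈ s, ψ'.mat z'' z' * ψ.mat z' z := by
  refine finsum_eq_sum_of_support_subset _ fun z' h => hs z' fun h0 => h ?_
  simp [h0]

lemma exists_of_compMat_ne_zero {ψ : CtrlHom M M'} {ψ' : CtrlHom M' M''} {z'' z : Z}
    (h : compMat ψ ψ' z'' z ≠ 0) : ∃ z', ψ'.mat z'' z' ≠ 0 ∧ ψ.mat z' z ≠ 0 := by
  obtain ⟨z', hz'⟩ : ∃ z', ψ'.mat z'' z' * ψ.mat z' z ≠ 0 := by
    by_contra! hc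
    exact h (by simp [compMat, hc])
  exact ⟨z', fun h0 => hz' (by simp [h0]), fun h0 => hz' (by simp [h0])⟩

/-- Composition `ψ' ∘ ψ`. -/
noncomputable def comp (ψ : CtrlHom M M') (ψ' : CtrlHom M' M'') : CtrlHom M M'' where
  mat := compMat ψ ψ'
  controlled := by
    obtain ⟨a, ha, h⟩ := ψ.controlled
    obtain ⟨b, hb, h'⟩ := ψ'.controlled
    refine ⟨b + a, add_pos hb ha, fun z'' z hne => ?_⟩
    obtain ⟨z', h1, h2⟩ := exists_of_compMat_ne_zero hne
    exact (dist_triangle _ z' _).trans (add_le_add (h' _ _ h1) (h _ _ h2))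
  rowFinite z'' := by
    refine ((ψ'.rowFinite z'').biUnion fun z' _ => ψ.rowFinite z').subset fun z hne => ?_
    obtain ⟨z', h1, h2⟩ := exists_of_compMat_ne_zero hne
    exact Set.mem_biUnion (show z' ∈ {z' | ψ'.mat z'' z' ≠ 0} from h1) h2
  colFinite z := by
    refine ((ψ.colFinite z).biUnion fun z' _ => ψ'.colFinite z').subset fun z'' hne => ?_
    obtain ⟨z', h1, h2⟩ := exists_of_compMat_ne_zero hne
    exact Set.mem_biUnion (show z' ∈ {z' | ψ.mat z' z ≠ 0} from h2) h1

lemma id_mul_self (M : CtrlObj Z) {n : ℕ} (z : Z) (A : Matrix (Fin (M.rank z)) (Fin n) ℤ) :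
    (CtrlHom.id M).mat z z * A = A := by
  have : (CtrlHom.id M).mat z z = 1 := by
    ext i j
    simp [CtrlHom.id, Matrix.one_apply, Fin.ext_iff]
  rw [this, Matrix.one_mul]

lemma mul_id_self (M : CtrlObj Z) {n : ℕ} (z : Z) (A : Matrix (Fin n) (Fin (M.rank z)) ℤ) :
    A * (CtrlHom.id M).mat z z = A := by
  have : (CtrlHom.id M).mat z z = 1 := by
    ext i j
    simp [CtrlHom.id, Matrix.one_apply, Fin.ext_iff]
  rw [this, Matrix.mul_one]

lemma id_mat_ne_zero {M : CtrlObj Z} {z' z : Z} (h : (CtrlHom.id M).mat z' z ≠ 0) : z' = z := by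
  by_contra e
  exact h (by ext i j; simp [CtrlHom.id, e])

lemma id_comp (ψ : CtrlHom M M') : comp (CtrlHom.id M) ψ = ψ := by
  ext1
  funext z' z
  refine (compMat_eq_sum_col _ _ z' z {z} fun y hy => ?_).trans ?_
  · simpa using id_mat_ne_zero hy
  · rw [Finset.sum_singleton, mul_id_self]

lemma comp_id (ψ : CtrlHom M M') : comp ψ (CtrlHom.id M') = ψ := by
  ext1
  funext z' z
  refine (compMat_eq_sum_row _ _ z' z {z'} fun y hy => ?_).trans ?_
  · simpa using (id_mat_ne_zero hy).symm
  · rw [Finset.sum_singleton, id_mul_self]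

lemma assoc (ψ : CtrlHom M M') (ψ' : CtrlHom M' M'') (ψ'' : CtrlHom M'' M''') :
    comp (comp ψ ψ') ψ'' = comp ψ (comp ψ' ψ'') := by
  ext1
  funext w z
  let s := (ψ.colFinite z).toFinset
  let t := (ψ''.rowFinite w).toFinset
  have hs : ∀ y, ψ.mat y z ≠ 0 → y ∈ s := fun y hy => by simpa [s] using hy
  have ht : ∀ y, ψ''.mat w y ≠ 0 → y ∈ t := fun y hy => by simpa [t] using hy
  have h1 : (comp (comp ψ ψ') ψ'').mat w z
      = ∑ y' ∈ t, ψ''.mat w y' * ∑ y ∈ s, ψ'.mat y' y * ψ.mat y z := by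
    refine (compMat_eq_sum_row _ _ w z t ht).trans (Finset.sum_congr rfl fun y' _ => ?_)
    congr 1
    exact compMat_eq_sum_col _ _ y' z s hs
  have h2 : (comp ψ (comp ψ' ψ'')).mat w z
      = ∑ y ∈ s, (∑ y' ∈ t, ψ''.mat w y' * ψ'.mat y' y) * ψ.mat y z := by
    refine (compMat_eq_sum_col _ _ w z s hs).trans (Finset.sum_congr rfl fun y _ => ?_)
    congr 1
    exact compMat_eq_sum_row _ _ w y t ht
  rw [h1, h2]
  simp only [Matrix.mul_sum, Matrix.sum_mul, Matrix.mul_assoc]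
  exact Finset.sum_comm

instance : Zero (CtrlHom M M') :=
  ⟨{ mat := fun _ _ => 0
     controlled := ⟨1, one_pos, fun _ _ h => absurd rfl h⟩
     rowFinite := fun _ => by simp
     colFinite := fun _ => by simp }⟩

instance : Neg (CtrlHom M M') :=
  ⟨fun ψ =>
   { mat := fun z' z => - ψ.mat z' z
     controlled := by simpa using ψ.controlled
     rowFinite := by simpa using ψ.rowFinite
     colFinite := by simpa using ψ.colFinite }⟩

lemma or_of_add_ne_zero {m n : ℕ} {A B : Matrix (Fin m) (Fin n) ℤ} (h : A + B ≠ 0) :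
    A ≠ 0 ∨ B ≠ 0 := by
  by_contra! hc
  exact h (by rw [hc.1, hc.2, add_zero])

instance : Add (CtrlHom M M') :=
  ⟨fun ψ χ =>
   { mat := fun z' z => ψ.mat z' z + χ.mat z' z
     controlled := by
       obtain ⟨a, ha, h⟩ := ψ.controlled
       obtain ⟨b, _, h'⟩ := χ.controlled
       refine ⟨max a b, lt_max_of_lt_left ha, fun z' z hne => ?_⟩
       rcases or_of_add_ne_zero hne with h1 | h1
       · exact (h _ _ h1).trans (le_max_left _ _)
       · exact (h' _ _ h1).trans (le_max_right _ _)
     rowFinite := fun z' =>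
       ((ψ.rowFinite z').union (χ.rowFinite z')).subset fun _ h => or_of_add_ne_zero h
     colFinite := fun z =>
       ((ψ.colFinite z).union (χ.colFinite z)).subset fun _ h => or_of_add_ne_zero h }⟩

@[simp] lemma zero_mat (z' z : Z) : (0 : CtrlHom M M').mat z' z = 0 := rfl

@[simp] lemma neg_mat (ψ : CtrlHom M M') (z' z : Z) : (-ψ).mat z' z = - ψ.mat z' z := rfl

@[simp] lemma add_mat (ψ χ : CtrlHom M M') (z' z : Z) :
    (ψ + χ).mat z' z = ψ.mat z' z + χ.mat z' z := rfl

instance : AddCommGroup (CtrlHom M M') where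
  add_assoc a b c := by ext1; funext z' z; simp [add_assoc]
  zero_add a := by ext1; funext z' z; simp
  add_zero a := by ext1; funext z' z; simp
  add_comm a b := by ext1; funext z' z; simp [add_comm]
  neg_add_cancel a := by ext1; funext z' z; simp
  nsmul := nsmulRec
  zsmul := zsmulRec

lemma add_comp (ψ χ : CtrlHom M M') (ω : CtrlHom M' M'') :
    comp (ψ + χ) ω = comp ψ ω + comp χ ω := by
  ext1
  funext w z
  let t := (ω.rowFinite w).toFinset
  have ht : ∀ y, ω.mat w y ≠ 0 → y ∈ t := fun y hy => by simpa [t] using hy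
  rw [add_mat]
  refine (compMat_eq_sum_row _ _ w z t ht).trans ?_
  refine Eq.trans ?_ (congrArg₂ (· + ·) (compMat_eq_sum_row ψ ω w z t ht)
    (compMat_eq_sum_row χ ω w z t ht)).symm
  simp [Matrix.mul_add, Finset.sum_add_distrib]

lemma comp_add (ω : CtrlHom M M') (ψ χ : CtrlHom M' M'') :
    comp ω (ψ + χ) = comp ω ψ + comp ω χ := by
  ext1
  funext w z
  let s := (ω.colFinite z).toFinset
  have hs : ∀ y, ω.mat y z ≠ 0 → y ∈ s := fun y hy => by simpa [s] using hy
  rw [add_mat]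
  refine (compMat_eq_sum_col _ _ w z s hs).trans ?_
  refine Eq.trans ?_ (congrArg₂ (· + ·) (compMat_eq_sum_col ω ψ w z s hs)
    (compMat_eq_sum_col ω χ w z s hs)).symm
  simp [Matrix.add_mul, Finset.sum_add_distrib]

end CtrlHom

noncomputable instance : Category (CtrlObj Z) where
  Hom := CtrlHom
  id := CtrlHom.id
  comp := CtrlHom.comp
  id_comp := CtrlHom.id_comp
  comp_id := CtrlHom.comp_id
  assoc := CtrlHom.assoc

noncomputable instance : Preadditive (CtrlObj Z) where
  homGroup M M' := inferInstanceAs (AddCommGroup (CtrlHom M M'))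
  add_comp _ _ _ := CtrlHom.add_comp
  comp_add _ _ _ := CtrlHom.comp_add

/-- The support `{(z', z) | ψ_{z',z} ≠ 0}` of a morphism of `C(Z, d; ℤ)`. -/
def supp {M M' : CtrlObj Z} (ψ : M ⟶ M') : Set (Z × Z) :=
  {q | CtrlHom.mat ψ q.1 q.2 ≠ 0}

/-- A morphism of `C(Z, d; ℤ)` is `ε`-controlled if `d(z', z) ≤ ε` on its support. -/
def IsControlled (ε : ℝ) {M M' : CtrlObj Z} (ψ : M ⟶ M') : Prop :=
  supp ψ ⊆ {q | dist q.1 q.2 ≤ ε}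

/-! ### Chain complexes over the idempotent completion -/

variable (Z) in
/-- `Idem(C(Z, d; ℤ))`: objects are idempotents `p : M → M`, and morphisms `(M, p) → (N, q)` are
the `f : M → N` with `q ∘ f ∘ p = f`. -/
abbrev IdemCtrl : Type u := Idempotents.Karoubi (CtrlObj Z)

/-- Non-negatively graded chain complexes over `Idem(C(Z, d; ℤ))`. -/
abbrev IdemCtrlComplex (Z : Type u) [MetricSpace Z] : Type u := ChainComplex (IdemCtrl Z) ℕ

/-- The chain complex is concentrated in degrees `0, …, N`. -/
def IsConcentrated (N : ℕ) (P : IdemCtrlComplex Z) : Prop :=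
  ∀ n, N < n → Limits.IsZero (P.X n)

/-- A chain complex is `ε`-controlled if its objects (that is, the idempotents defining them) and
its differentials are `ε`-controlled. -/
def IsControlledComplex (ε : ℝ) (P : IdemCtrlComplex Z) : Prop :=
  (∀ n, IsControlled ε (P.X n).p) ∧ ∀ n, IsControlled ε (P.d (n + 1) n).f

/-- The support of a chain map: the union of the supports in all degrees. -/
def chainMapSupp {P Q : IdemCtrlComplex Z} (f : P ⟶ Q) : Set (Z × Z) :=
  ⋃ n, supp (f.f n).f

/-- The support of a chain homotopy: the union of the supports of its components
`P_n → Q_{n+1}`. -/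
def homotopySupp {P Q : IdemCtrlComplex Z} {f g : P ⟶ Q} (h : Homotopy f g) : Set (Z × Z) :=
  ⋃ n, supp (h.hom n (n + 1)).f

/-! ### Homotopy actions of a finite subset of a group -/

variable {G : Type v} [Group G]

/-- A homotopy `S`-action on a space `X`, where `S` is a finite subset of `G` containing the
trivial element: continuous maps `φ_g` for `g ∈ S`, and homotopies `H_{g,h}` from `φ_g ∘ φ_h` to
`φ_{gh}` whenever `g, h, gh ∈ S`, such that `H_{e,e}(-, t) = φ_e = id` for all `t`. -/
structure HomotopyAction (S : Finset G) (hS : (1 : G) ∈ S) (X : Type u) [TopologicalSpace X] where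
  /-- the maps of the action -/
  φ : S → C(X, X)
  /-- the homotopies of the action -/
  H : ∀ (g h : S) (hgh : (g : G) * (h : G) ∈ S),
    ContinuousMap.Homotopy ((φ g).comp (φ h)) (φ ⟨g * h, hgh⟩)
  φ_one : φ ⟨1, hS⟩ = ContinuousMap.id X
  H_one : ∀ (h : (1 : G) * 1 ∈ S) (t : unitInterval) (x : X), H ⟨1, hS⟩ ⟨1, hS⟩ h (t, x) = x

/-- A homotopy `S`-chain complex over `Idem(C(Z, d; ℤ))`: a chain complex `P` with chain maps `φ_g`
for `g ∈ S` and chain homotopies `H_{g,h}` from `φ_g ∘ φ_h` to `φ_{gh}` whenever `g, h, gh ∈ S`,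
such that `φ_e = id` and `H_{e,e} = 0`. -/
structure HomotopyChainComplex (S : Finset G) (hS : (1 : G) ∈ S) (Z : Type u)
    [MetricSpace Z] where
  /-- the underlying chain complex -/
  P : IdemCtrlComplex Z
  /-- the chain maps of the action -/
  φ : S → (P ⟶ P)
  /-- the chain homotopies of the action -/
  H : ∀ (g h : S) (hgh : (g : G) * (h : G) ∈ S), Homotopy (φ h ≫ φ g) (φ ⟨g * h, hgh⟩)
  φ_one : φ ⟨1, hS⟩ = 𝟙 P
  H_one : ∀ (h : (1 : G) * 1 ∈ S) (m n : ℕ), (H ⟨1, hS⟩ ⟨1, hS⟩ h).hom m n = 0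

variable {S : Finset G} {hS : (1 : G) ∈ S}

/-- A chain map `f : P → Q` is a homotopy `S`-chain map if `f ∘ φ^P_g` and `φ^Q_g ∘ f` are chain
homotopic for all `g ∈ S`. -/
def IsHomotopyChainMap (P Q : HomotopyChainComplex S hS Z) (f : P.P ⟶ Q.P) : Prop :=
  ∀ g : S, Nonempty (Homotopy (P.φ g ≫ f) (f ≫ Q.φ g))

/-- A homotopy `S`-chain equivalence is a homotopy `S`-chain map which is a chain homotopy
equivalence. -/
def IsHomotopyChainEquiv (P Q : HomotopyChainComplex S hS Z) (f : P.P ⟶ Q.P) : Prop :=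
  IsHomotopyChainMap P Q f ∧ ∃ e : HomotopyEquiv P.P Q.P, e.hom = f

open scoped Classical in
/-- The object with `ℤ` at `z₀` if `n = 0`, and with `0` at all other points and for `n ≠ 0`. -/
noncomputable def trivialObj (z₀ : Z) (n : ℕ) : CtrlObj Z where
  rank z := if n = 0 ∧ z = z₀ then 1 else 0
  locallyFinite _ :=
    ⟨Set.univ, isOpen_univ, Set.mem_univ _,
      (Set.finite_singleton z₀).subset fun y hy => by
        by_contra e
        exact hy.2 (if_neg fun h => e h.2)⟩

/-- The trivial chain complex at `z₀`: `ℤ` at `z₀` in degree `0`, and zero otherwise. -/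
noncomputable def trivialComplex (z₀ : Z) : IdemCtrlComplex Z where
  X n := ⟨trivialObj z₀ n, 𝟙 _, Category.comp_id _⟩
  d _ _ := 0
  shape _ _ _ := rfl
  d_comp_d' _ _ _ _ _ := Limits.zero_comp

variable (S hS) in
/-- The trivial homotopy `S`-chain complex at `z₀`: all chain maps are identities and all chain
homotopies are zero. -/
noncomputable def trivialHomotopyChainComplex (z₀ : Z) : HomotopyChainComplex S hS Z where
  P := trivialComplex z₀
  φ _ := 𝟙 _
  H _ _ _ := Homotopy.ofEq (Category.comp_id _)
  φ_one := rfl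
  H_one _ _ _ := rfl

/-! ### Controlled domination -/

/-- A metric space `X` is controlled `N`-dominated if for every `ε > 0` there are a finite
CW-complex `K` of dimension at most `N`, maps `i : X → K` and `p : K → X`, and a homotopy `H` from
`p ∘ i` to `id_X` all of whose tracks `{H(x, t) | t ∈ [0, 1]}` have diameter at most `ε`. -/
def IsControlledDominated (N : ℕ) (X : Type u) [MetricSpace X] : Prop :=
  ∀ ε : ℝ, 0 < ε →
    ∃ (K : Type u) (_ : TopologicalSpace K) (_ : T2Space K)
      (_ : Topology.CWComplex (Set.univ : Set K)),
      Topology.RelCWComplex.Finite (Set.univ : Set K) ∧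
      (∀ n, N < n → IsEmpty (Topology.RelCWComplex.cell (Set.univ : Set K) n)) ∧
      ∃ (i : C(X, K)) (p : C(K, X)) (H : ContinuousMap.Homotopy (p.comp i) (ContinuousMap.id X)),
        ∀ x : X, Metric.diam (Set.range fun t : unitInterval => H (t, x)) ≤ ε

end ControlledAlgebra

/-! ### Inductive construction of controlled chain maps and chain homotopies -/

namespace ControlledAlgebra

open Finsupp Metric

/-! ### Based and located chain complexes -/

/-! The domination is used only to extract two intrinsic properties of `X`. By `hasFineCovers`,
there are arbitrarily fine finite open covers of order at most `N + 1`, because a finite CW complex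
of dimension at most `N` has covering dimension at most `N`. By `discretelyLocallyContractible`,
small balls contract inside slightly larger ones, uniformly over `X`, because finite CW complexes
are locally contractible. The complex `P` is then built from `X` by algebra, without using chains of
the dominating complexes.

Starting from the augmentation alone, `exists_isResolution` attaches, degree by degree, finitely
many located generators that bound all cycles in balls of a prescribed size. What matters is a
filling property whose modulus depends on `X` only and not on the resolution. This is
`fillsEventually`: a cycle in a small ball is pushed along a contraction of the ball into a tiny
ball, where it bounds by construction; the trace of the push is a controlled homotopy. It works once
the scales of the resolution are chosen small enough, higher degrees before lower ones.

To reduce the dimension, a resolution is compared with the nerve of a fine cover. Up to degree `N`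
the identity is homotopic to a chain map through the nerve, and that map vanishes one degree higher
because the cover has order at most `N + 1`. Hence the image of the boundary into degree `N` is a
direct summand (`exists_partial_contraction`), and a controlled idempotent removes it. This is where
the idempotent completion enters.

Finally, a continuous self-map of `X` is realized near itself by a chain map (`exists_isChainMap`),
and a homotopy, after subdivision of its parameter interval, by a chain homotopy supported near its
tracks (`exists_isChainHomotopy`). Both are acyclic carrier arguments with control. Applied to the
`φ_g`, to the `H_{g,h}` and to a contraction of `X`, they give all the data in
`exists_chain_action`. The estimates close up because the modulus of filling is known first: a
decreasing sequence of scales is fixed from it by `scaleSeq`, and only then a complex finer than all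
of them is chosen.

Throughout, degrees are shifted by one: the augmentation has degree `0`, and degree `i` of the final
complex is degree `i + 1` here. -/

theorem map_mem_of_support {B V : Type*} [AddCommGroup V] {f : (B →₀ ℤ) →ₗ[ℤ] V}
    {W : Submodule ℤ V} {c : B →₀ ℤ} (h : ∀ b ∈ c.support, f (single b 1) ∈ W) : f c ∈ W := by
  rw [← c.sum_single, map_finsuppSum]
  refine W.sum_mem fun b hb => ?_
  have : single b (c b) = c b • single b (1 : ℤ) := by simp
  simp only
  rw [this, map_smul]
  exact W.smul_mem _ (h b hb)

theorem map_eq_of_support {B V : Type*} [AddCommGroup V] {f g : (B →₀ ℤ) →ₗ[ℤ] V}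
    {c : B →₀ ℤ} (h : ∀ b ∈ c.support, f (single b 1) = g (single b 1)) : f c = g c := by
  have := map_mem_of_support (f := f - g) (W := ⊥) (c := c) fun b hb => by simp [h b hb]
  simpa [sub_eq_zero] using this

/-- A finitely generated based chain complex, with all degrees collected in one module. -/
structure BasedComplex where
  /-- the basis -/
  B : Type u
  [fin : Finite B]
  /-- the degree of a basis element -/
  deg : B → ℕ
  /-- the differential -/
  d : (B →₀ ℤ) →ₗ[ℤ] (B →₀ ℤ)
  d_deg : ∀ b, ∀ b' ∈ (d (single b 1)).support, deg b' + 1 = deg b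
  d_d : ∀ c, d (d c) = 0

attribute [instance] BasedComplex.fin

theorem BasedComplex.d_eq_zero (A : BasedComplex.{u}) {b : A.B} (h : A.deg b = 0) :
    A.d (single b 1) = 0 := by
  rw [← support_eq_empty, Finset.eq_empty_iff_forall_notMem]
  intro b' hb'
  have := A.d_deg b b' hb'
  omega

/-- Inductive construction of a solution of `d f + s f d = g` with values in prescribed sets. -/
theorem BasedComplex.exists_lift (A : BasedComplex.{u}) {V : Type*} [AddCommGroup V]
    (dV : V →ₗ[ℤ] V) (G : A.B → Prop)
    (hG : ∀ b, G b → ∀ b' ∈ (A.d (single b 1)).support, G b')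
    (s : ℤ) (g : (A.B →₀ ℤ) →ₗ[ℤ] V)
    (hg : ∀ b, G b → dV (g (single b 1)) = s • g (A.d (single b 1)))
    (F : A.B → Set V)
    (hfill : ∀ b, G b → ∀ f : (A.B →₀ ℤ) →ₗ[ℤ] V,
      (∀ b' ∈ (A.d (single b 1)).support, f (single b' 1) ∈ F b') →
      dV (g (single b 1) - s • f (A.d (single b 1))) = 0 →
      ∃ w ∈ F b, dV w = g (single b 1) - s • f (A.d (single b 1))) :
    ∃ f : (A.B →₀ ℤ) →ₗ[ℤ] V, ∀ b, G b → f (single b 1) ∈ F b ∧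
      dV (f (single b 1)) + s • f (A.d (single b 1)) = g (single b 1) := by
  classical
  -- Induction over the degree. With `s = -1`, `g = 0` the equation describes chain maps; with `s =
  -- 1`, `g = f₁ - f₀` it describes chain homotopies.
  have key : ∀ n : ℕ, ∃ f : (A.B →₀ ℤ) →ₗ[ℤ] V, ∀ b, G b → A.deg b < n → f (single b 1) ∈ F b ∧
      dV (f (single b 1)) + s • f (A.d (single b 1)) = g (single b 1) := by
    intro n
    induction n with
    | zero => exact ⟨0, fun b _ h => absurd h (Nat.not_lt_zero _)⟩
    | succ n ih =>
      obtain ⟨f, hf⟩ := ih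
      have hex : ∀ b, G b ∧ A.deg b = n →
          ∃ w ∈ F b, dV w = g (single b 1) - s • f (A.d (single b 1)) := by
        rintro b ⟨hb, hn⟩
        have hlt : ∀ b' ∈ (A.d (single b 1)).support, A.deg b' < n := fun b' hb' => by
          have := A.d_deg b b' hb'
          omega
        refine hfill b hb f (fun b' hb' => (hf b' (hG b hb b' hb') (hlt b' hb')).1) ?_
        -- On a boundary the term `s • f (A.d _)` vanishes, so the equation already solved on the
        -- faces identifies `dV ∘ f` with `g` there; with `hg` the obstruction becomes a cycle.
        have h1 : dV (f (A.d (single b 1))) = g (A.d (single b 1)) := by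
          have := map_eq_of_support (f := dV ∘ₗ f + s • f ∘ₗ A.d) (g := g)
            (c := A.d (single b 1)) fun b' hb' => by
              simpa using (hf b' (hG b hb b' hb') (hlt b' hb')).2
          simpa [A.d_d] using this
        rw [map_sub, map_smul, h1, hg b hb, sub_self]
      let val : A.B → V := fun b =>
        if h : G b ∧ A.deg b = n then (hex b h).choose else f (single b 1)
      have hval : ∀ b, linearCombination ℤ val (single b 1) = val b := fun b => by simp
      have hlow : ∀ b, A.deg b < n → val b = f (single b 1) := fun b hb =>
        dif_neg fun h => by omega
      have hd : ∀ b, A.deg b < n + 1 →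
          linearCombination ℤ val (A.d (single b 1)) = f (A.d (single b 1)) := by
        intro b hb
        refine map_eq_of_support fun b' hb' => ?_
        have := A.d_deg b b' hb'
        rw [hval, hlow b' (by omega)]
      refine ⟨linearCombination ℤ val, fun b hb hn => ?_⟩
      rw [hd b hn, hval]
      by_cases h : A.deg b < n
      · rw [hlow b h]
        exact hf b hb h
      · have h' : G b ∧ A.deg b = n := ⟨hb, by omega⟩
        have hv : val b = (hex b h').choose := dif_pos h'
        obtain ⟨h1, h2⟩ := (hex b h').choose_spec
        rw [hv]
        exact ⟨h1, by rw [h2, sub_add_cancel]⟩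
  cases nonempty_fintype A.B
  obtain ⟨f, hf⟩ := key (Finset.univ.sup A.deg + 1)
  exact ⟨f, fun b hb => hf b hb (Nat.lt_succ_of_le (Finset.le_sup (Finset.mem_univ b)))⟩

/-- An augmented based chain complex located over `X`, together with a chain projection `p`. The
degrees are shifted by one, so that the augmentation sits in degree `0`, generated by `pt`. -/
structure LocComplex (X : Type u) extends BasedComplex.{u} where
  /-- the location of a basis element -/
  loc : B → X
  /-- the generator of the augmentation -/
  pt : B
  /-- the projection -/
  p : (B →₀ ℤ) →ₗ[ℤ] (B →₀ ℤ)
  deg_eq_zero : ∀ b, deg b = 0 ↔ b = pt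
  p_deg : ∀ b, ∀ b' ∈ (p (single b 1)).support, deg b' = deg b
  p_p : ∀ c, p (p c) = p c
  d_p : ∀ c, d (p c) = d c
  p_d : ∀ c, p (d c) = d c
  p_pt : p (single pt 1) = single pt 1

namespace LocComplex

variable {X : Type u} (T : LocComplex X)

/-- The chains of degree `k` located in `S`. -/
def Sub (k : ℕ) (S : Set X) : Submodule ℤ (T.B →₀ ℤ) :=
  supported ℤ ℤ {b | T.deg b = k ∧ (k = 0 ∨ T.loc b ∈ S)}

variable {T}

theorem Sub_mono {k : ℕ} {S S' : Set X} (h : S ⊆ S') : T.Sub k S ≤ T.Sub k S' :=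
  supported_mono fun _ hb => ⟨hb.1, hb.2.imp_right fun h' => h h'⟩

theorem Sub_zero (S S' : Set X) : T.Sub 0 S ≤ T.Sub 0 S' :=
  supported_mono fun _ hb => ⟨hb.1, Or.inl rfl⟩

theorem single_mem_Sub {b : T.B} {k : ℕ} {S : Set X} (hk : T.deg b = k) (h : T.loc b ∈ S) :
    single b 1 ∈ T.Sub k S :=
  single_mem_supported ℤ _ ⟨hk, Or.inr h⟩

variable (T)

theorem deg_pt : T.deg T.pt = 0 := (T.deg_eq_zero _).2 rfl

theorem d_pt : T.d (single T.pt 1) = 0 := T.d_eq_zero T.deg_pt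

theorem pt_mem_Sub (S : Set X) : single T.pt 1 ∈ T.Sub 0 S :=
  single_mem_supported ℤ _ ⟨T.deg_pt, Or.inl rfl⟩

/-- The `p`-invariant chains. -/
noncomputable def fixed : Submodule ℤ (T.B →₀ ℤ) := LinearMap.eqLocus T.p LinearMap.id

variable {T}

variable (T) [PseudoMetricSpace X]

/-- Cycles of degree `k` in `δ`-balls bound in the concentric `ε`-balls. -/
def Fill (k : ℕ) (δ ε : ℝ) : Prop :=
  ∀ (x : X), ∀ c ∈ T.Sub k (ball x δ), T.p c = c → T.d c = 0 →
    ∃ w ∈ T.Sub (k + 1) (ball x ε), T.p w = w ∧ T.d w = c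

variable {T}

theorem Fill.mono {k : ℕ} {δ δ' ε ε' : ℝ} (h : T.Fill k δ ε) (hδ : δ' ≤ δ) (hε : ε ≤ ε') :
    T.Fill k δ' ε' := fun x c hc hp hd => by
  obtain ⟨w, hw, h'⟩ := h x c (Sub_mono (ball_subset_ball hδ) hc) hp hd
  exact ⟨w, Sub_mono (ball_subset_ball hε) hw, h'⟩

/-- Construction of a chain map which is controlled over a map of locations. -/
theorem exists_chainMap (A : BasedComplex.{u}) (G : A.B → Prop)
    (hG : ∀ b, G b → ∀ b' ∈ (A.d (single b 1)).support, G b')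
    {k : ℕ} (hGk : ∀ b, G b → A.deg b ≤ k) (ϑ : A.B → X) {α r : ℕ → ℝ} {ρ : ℝ}
    (hface : ∀ b, G b → ∀ b' ∈ (A.d (single b 1)).support, A.deg b' ≠ 0 → dist (ϑ b') (ϑ b) ≤ ρ)
    (hα : ∀ m < k, α m + ρ ≤ r m) (hfill : ∀ m < k, T.Fill m (r m) (α (m + 1))) :
    ∃ f : (A.B →₀ ℤ) →ₗ[ℤ] (T.B →₀ ℤ), ∀ b, G b →
      T.d (f (single b 1)) = f (A.d (single b 1)) ∧
      f (single b 1) ∈ T.Sub (A.deg b) (ball (ϑ b) (α (A.deg b))) ∧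
      f (single b 1) ∈ T.fixed ∧ (A.deg b = 0 → f (single b 1) = single T.pt 1) := by
  refine (A.exists_lift T.d G hG (-1) 0 (by simp)
    (fun b => {w | w ∈ T.Sub (A.deg b) (ball (ϑ b) (α (A.deg b))) ∧ w ∈ T.fixed ∧
      (A.deg b = 0 → w = single T.pt 1)}) ?_).imp fun f hf b hb => ⟨?_, (hf b hb).1⟩
  rotate_left
  · have := (hf b hb).2
    simpa [← sub_eq_add_neg, sub_eq_zero] using this
  · intro b hb f hf hd
    rcases Nat.eq_zero_or_pos (A.deg b) with h0 | h0
    · refine ⟨single T.pt 1, ⟨h0 ▸ T.pt_mem_Sub _, T.p_pt, fun _ => rfl⟩, ?_⟩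
      simp [A.d_eq_zero h0, T.d_pt]
    · obtain ⟨m, hm⟩ : ∃ m, A.deg b = m + 1 := ⟨A.deg b - 1, by omega⟩
      have hmk : m < k := by have := hGk b hb; omega
      -- Each face contributes a chain within `α m` of its own location, hence within `α m + ρ` of
      -- the location of `b`. Chains of degree `0` carry no location, so nothing is needed for the
      -- augmentation.
      have hsub : f (A.d (single b 1)) ∈ T.Sub m (ball (ϑ b) (r m)) := by
        refine map_mem_of_support fun b' hb' => ?_
        have hdb := A.d_deg b b' hb'
        have hm' : A.deg b' = m := by omega
        have h1 := (hf b' hb').1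
        rw [hm'] at h1
        rcases Nat.eq_zero_or_pos m with h | h
        · subst h
          exact Sub_zero _ _ h1
        · refine Sub_mono (ball_subset_ball' ?_) h1
          have := hface b hb b' hb' (by omega)
          have := hα m hmk
          linarith
      have hfix : f (A.d (single b 1)) ∈ T.fixed :=
        map_mem_of_support fun b' hb' => (hf b' hb').2.1
      obtain ⟨w, hw, hp, hdw⟩ := hfill m hmk (ϑ b) _ hsub hfix (by simpa using hd)
      exact ⟨w, ⟨by rwa [hm], hp, fun h => by omega⟩, by simp [hdw]⟩

/-- Construction of a chain homotopy between two chain maps which are controlled over the same map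
of locations. -/
theorem exists_homotopy (A : BasedComplex.{u}) (G : A.B → Prop)
    (hG : ∀ b, G b → ∀ b' ∈ (A.d (single b 1)).support, G b')
    {k : ℕ} (hGk : ∀ b, G b → A.deg b ≤ k) (ϑ : A.B → X) {α β r : ℕ → ℝ} {ρ : ℝ}
    (hface : ∀ b, G b → ∀ b' ∈ (A.d (single b 1)).support, A.deg b' ≠ 0 → dist (ϑ b') (ϑ b) ≤ ρ)
    (hα : ∀ m ≤ k, α m ≤ r m) (hβ : ∀ m < k, β m + ρ ≤ r (m + 1))
    (hfill : ∀ m ≤ k, T.Fill m (r m) (β m))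
    (f₀ f₁ : (A.B →₀ ℤ) →ₗ[ℤ] (T.B →₀ ℤ))
    (hd₀ : ∀ b, G b → T.d (f₀ (single b 1)) = f₀ (A.d (single b 1)))
    (hd₁ : ∀ b, G b → T.d (f₁ (single b 1)) = f₁ (A.d (single b 1)))
    (hs₀ : ∀ b, G b → f₀ (single b 1) ∈ T.Sub (A.deg b) (ball (ϑ b) (α (A.deg b))))
    (hs₁ : ∀ b, G b → f₁ (single b 1) ∈ T.Sub (A.deg b) (ball (ϑ b) (α (A.deg b))))
    (hp₀ : ∀ b, G b → f₀ (single b 1) ∈ T.fixed) (hp₁ : ∀ b, G b → f₁ (single b 1) ∈ T.fixed)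
    (h01 : ∀ b, G b → A.deg b = 0 → f₀ (single b 1) = f₁ (single b 1)) :
    ∃ h : (A.B →₀ ℤ) →ₗ[ℤ] (T.B →₀ ℤ), ∀ b, G b →
      T.d (h (single b 1)) + h (A.d (single b 1)) = f₁ (single b 1) - f₀ (single b 1) ∧
      h (single b 1) ∈ T.Sub (A.deg b + 1) (ball (ϑ b) (β (A.deg b))) ∧
      h (single b 1) ∈ T.fixed ∧ (A.deg b = 0 → h (single b 1) = 0) := by
  refine (A.exists_lift T.d G hG 1 (f₁ - f₀)
    (fun b hb => by simp [hd₀ b hb, hd₁ b hb])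
    (fun b => {w | w ∈ T.Sub (A.deg b + 1) (ball (ϑ b) (β (A.deg b))) ∧ w ∈ T.fixed ∧
      (A.deg b = 0 → w = 0)}) ?_).imp
    fun f hf b hb => ⟨by simpa using (hf b hb).2, (hf b hb).1⟩
  · intro b hb f hf hd
    rcases Nat.eq_zero_or_pos (A.deg b) with h0 | h0
    · refine ⟨0, ⟨Submodule.zero_mem _, Submodule.zero_mem _, fun _ => rfl⟩, ?_⟩
      simp [A.d_eq_zero h0, h01 b hb h0]
    · obtain ⟨m, hm⟩ : ∃ m, A.deg b = m + 1 := ⟨A.deg b - 1, by omega⟩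
      have hmk : m + 1 ≤ k := hm ▸ hGk b hb
      have hsub : f (A.d (single b 1)) ∈ T.Sub (m + 1) (ball (ϑ b) (r (m + 1))) := by
        refine map_mem_of_support fun b' hb' => ?_
        have hdb := A.d_deg b b' hb'
        have hm' : A.deg b' = m := by omega
        have h1 := (hf b' hb')
        rcases Nat.eq_zero_or_pos m with h | h
        · rw [h1.2.2 (by omega)]
          exact Submodule.zero_mem _
        · have h1 := h1.1
          rw [hm'] at h1
          refine Sub_mono (ball_subset_ball' ?_) h1
          have := hface b hb b' hb' (by omega)
          have := hβ m hmk
          linarith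
      have hfix : f (A.d (single b 1)) ∈ T.fixed :=
        map_mem_of_support fun b' hb' => (hf b' hb').2.1
      have hs : ∀ g : (A.B →₀ ℤ) →ₗ[ℤ] (T.B →₀ ℤ),
          g (single b 1) ∈ T.Sub (A.deg b) (ball (ϑ b) (α (A.deg b))) →
          g (single b 1) ∈ T.Sub (m + 1) (ball (ϑ b) (r (m + 1))) := fun g hg => by
        rw [hm] at hg
        exact Sub_mono (ball_subset_ball (hα _ hmk)) hg
      rw [one_smul] at hd ⊢
      -- The cycle to be filled is `f₁ b - f₀ b - h (d b)`.
      obtain ⟨w, hw, hp, hdw⟩ := hfill (m + 1) hmk (ϑ b) _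
        (Submodule.sub_mem _ (Submodule.sub_mem _ (hs _ (hs₁ b hb)) (hs _ (hs₀ b hb))) hsub)
        (Submodule.sub_mem _ (Submodule.sub_mem _ (hp₁ b hb) (hp₀ b hb)) hfix) hd
      exact ⟨w, ⟨by rwa [hm], hp, fun h => by omega⟩, hdw⟩

/-- Construction of a chain homotopy along a sequence of maps of locations. -/
theorem exists_homotopy_path (A : BasedComplex.{u}) (G : A.B → Prop)
    (hG : ∀ b, G b → ∀ b' ∈ (A.d (single b 1)).support, G b')
    {k : ℕ} (hGk : ∀ b, G b → A.deg b ≤ k) {α β r r' : ℕ → ℝ} {ρ : ℝ} (hρ : 0 ≤ ρ)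
    (hα' : ∀ m < k, α m + ρ ≤ r' m) (hfill' : ∀ m < k, T.Fill m (r' m) (α (m + 1)))
    (hα : ∀ m ≤ k, α m + ρ ≤ r m) (hβ : ∀ m < k, β m + ρ ≤ r (m + 1))
    (hfill : ∀ m ≤ k, T.Fill m (r m) (β m)) (c : ℕ → A.B → X) (M : ℕ)
    (hface : ∀ b, G b → ∀ b' ∈ (A.d (single b 1)).support, A.deg b' ≠ 0 →
      ∀ j ≤ M, dist (c j b') (c j b) ≤ ρ)
    (hstep : ∀ b, G b → ∀ j < M, dist (c j b) (c (j + 1) b) ≤ ρ)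
    (f₀ f₁ : (A.B →₀ ℤ) →ₗ[ℤ] (T.B →₀ ℤ))
    (hd₀ : ∀ b, G b → T.d (f₀ (single b 1)) = f₀ (A.d (single b 1)))
    (hd₁ : ∀ b, G b → T.d (f₁ (single b 1)) = f₁ (A.d (single b 1)))
    (hs₀ : ∀ b, G b → f₀ (single b 1) ∈ T.Sub (A.deg b) (ball (c 0 b) (α (A.deg b))))
    (hs₁ : ∀ b, G b → f₁ (single b 1) ∈ T.Sub (A.deg b) (ball (c M b) (α (A.deg b))))
    (hp₀ : ∀ b, G b → f₀ (single b 1) ∈ T.fixed) (hp₁ : ∀ b, G b → f₁ (single b 1) ∈ T.fixed)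
    (h₀ : ∀ b, G b → A.deg b = 0 → f₀ (single b 1) = single T.pt 1)
    (h₁ : ∀ b, G b → A.deg b = 0 → f₁ (single b 1) = single T.pt 1) :
    ∃ h : (A.B →₀ ℤ) →ₗ[ℤ] (T.B →₀ ℤ), ∀ b, G b →
      T.d (h (single b 1)) + h (A.d (single b 1)) = f₁ (single b 1) - f₀ (single b 1) ∧
      h (single b 1) ∈ T.Sub (A.deg b + 1) {x | ∃ j ≤ M, dist x (c j b) < β (A.deg b)} ∧
      h (single b 1) ∈ T.fixed ∧ (A.deg b = 0 → h (single b 1) = 0) := by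
  induction M generalizing f₁ with
  | zero =>
    obtain ⟨h, hh⟩ := exists_homotopy A G hG hGk (c 0) (α := α) (β := β) (r := r)
      (fun b hb b' hb' h' => hface b hb b' hb' h' 0 le_rfl)
      (fun m hm => by linarith [hα m hm]) hβ hfill f₀ f₁ hd₀ hd₁ hs₀ hs₁ hp₀ hp₁
      (fun b hb hb0 => (h₀ b hb hb0).trans (h₁ b hb hb0).symm)
    refine ⟨h, fun b hb => ⟨(hh b hb).1, Sub_mono (fun x hx => ?_) (hh b hb).2.1, (hh b hb).2.2⟩⟩
    exact ⟨0, le_rfl, hx⟩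
  | succ M ih =>
    -- An auxiliary chain map over `c M` cuts off the last step, where `f₁` is regarded as lying
    -- over `c M` at the cost of `ρ`. The homotopies of the steps are added, not nested, so `β` does
    -- not grow with the number of steps.
    obtain ⟨f, hf⟩ := exists_chainMap (T := T) A G hG hGk (c M)
      (fun b hb b' hb' h' => hface b hb b' hb' h' M M.le_succ) hα' hfill'
    obtain ⟨h, hh⟩ := ih (fun b hb b' hb' h' j hj => hface b hb b' hb' h' j (hj.trans M.le_succ))
      (fun b hb j hj => hstep b hb j (hj.trans M.lt_succ_self)) f (fun b hb => (hf b hb).1)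
      (fun b hb => (hf b hb).2.1) (fun b hb => (hf b hb).2.2.1) (fun b hb => (hf b hb).2.2.2)
    obtain ⟨h', hh'⟩ := exists_homotopy A G hG hGk (c M) (α := fun m => α m + ρ) (β := β) (r := r)
      (fun b hb b' hb' h' => hface b hb b' hb' h' M M.le_succ)
      hα hβ hfill f f₁ (fun b hb => (hf b hb).1) hd₁
      (fun b hb => Sub_mono (ball_subset_ball (by linarith)) (hf b hb).2.1)
      (fun b hb => Sub_mono (ball_subset_ball' (by
        have := hstep b hb M M.lt_succ_self
        rw [dist_comm] at this
        linarith)) (hs₁ b hb)) (fun b hb => (hf b hb).2.2.1) hp₁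
      (fun b hb hb0 => ((hf b hb).2.2.2 hb0).trans (h₁ b hb hb0).symm)
    refine ⟨h + h', fun b hb => ⟨?_, ?_, ?_, fun hb0 => ?_⟩⟩
    · have e1 := (hh b hb).1
      have e2 := (hh' b hb).1
      simp only [LinearMap.add_apply, map_add]
      rw [add_add_add_comm, e1, e2]
      abel
    · refine Submodule.add_mem _ (Sub_mono (fun x hx => ?_) (hh b hb).2.1)
        (Sub_mono (fun x hx => ?_) (hh' b hb).2.1)
      · obtain ⟨j, hj, hx⟩ := hx
        exact ⟨j, hj.trans M.le_succ, hx⟩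
      · exact ⟨M, M.le_succ, hx⟩
    · exact Submodule.add_mem _ (hh b hb).2.2.1 (hh' b hb).2.2.1
    · simp [(hh b hb).2.2.2 hb0, (hh' b hb).2.2.2 hb0]

end LocComplex

end ControlledAlgebra

/-! ### Resolutions of a compact space at prescribed scales -/

namespace ControlledAlgebra

open Finsupp Metric

/-! ### Resolutions obtained by killing small cycles -/

namespace LocComplex

/-- The complex consisting of the augmentation only. -/
noncomputable abbrev point {X : Type u} (x : X) : LocComplex X where
  B := PUnit
  deg _ := 0
  loc _ := x
  pt := PUnit.unit
  d := 0
  p := LinearMap.id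
  d_deg := by simp
  d_d := by simp
  deg_eq_zero := by simp
  p_deg := by simp
  p_p := by simp
  d_p := by simp
  p_d := by simp
  p_pt := by simp

variable {X : Type u}

/-- The inclusion of chains into the chains on a larger basis. -/
noncomputable def inlChain {B Y : Type u} : (B →₀ ℤ) →ₗ[ℤ] (B ⊕ Y →₀ ℤ) :=
  lmapDomain ℤ ℤ Sum.inl

@[simp] theorem inlChain_single {B Y : Type u} (b : B) :
    inlChain (Y := Y) (single b 1) = single (Sum.inl b) 1 := by
  simp [inlChain]

theorem inlChain_injective {B Y : Type u} : Function.Injective (inlChain (B := B) (Y := Y)) :=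
  mapDomain_injective Sum.inl_injective

theorem mem_support_inlChain {B Y : Type u} {c : B →₀ ℤ} {x : B ⊕ Y}
    (h : x ∈ (inlChain c).support) : ∃ b ∈ c.support, x = Sum.inl b := by
  classical
  have := mapDomain_support h
  obtain ⟨b, hb, rfl⟩ := Finset.mem_image.1 this
  exact ⟨b, hb, rfl⟩

/-- The complex obtained by adding generators which bound the cycles `z y`. -/
noncomputable abbrev attach (A : LocComplex X) (Y : Type u) [Finite Y] (l : Y → X) (k : ℕ)
    (z : Y → (A.B →₀ ℤ)) (hz : ∀ y, ∀ b ∈ (z y).support, A.deg b = k)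
    (hd : ∀ y, A.d (z y) = 0) : LocComplex X where
  B := A.B ⊕ Y
  deg := Sum.elim A.deg fun _ => k + 1
  loc := Sum.elim A.loc l
  pt := Sum.inl A.pt
  d := linearCombination ℤ
    (Sum.elim (fun b => inlChain (A.d (single b 1))) fun y => inlChain (z y))
  p := LinearMap.id
  d_deg := by
    rintro (b | y) x hx
    · simp only [linearCombination_single, Sum.elim_inl, one_smul] at hx
      obtain ⟨b', hb', rfl⟩ := mem_support_inlChain hx
      exact A.d_deg b b' hb'
    · simp only [linearCombination_single, Sum.elim_inr, one_smul] at hx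
      obtain ⟨b', hb', rfl⟩ := mem_support_inlChain hx
      simp [hz y b' hb']
  d_d c := by
    set D : (A.B ⊕ Y →₀ ℤ) →ₗ[ℤ] (A.B ⊕ Y →₀ ℤ) := linearCombination ℤ
      (Sum.elim (fun b => inlChain (A.d (single b 1))) fun y => inlChain (z y)) with hD
    have key : ∀ c, D (inlChain c) = inlChain (A.d c) := fun c =>
      map_eq_of_support (c := c) (f := D ∘ₗ inlChain) (g := inlChain ∘ₗ A.d) (by simp [hD])
    have := map_mem_of_support (W := ⊥) (c := c) (f := D ∘ₗ D) (by
      rintro (b | y) -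
      · have : D (single (Sum.inl b) 1) = inlChain (A.d (single b 1)) := by simp [hD]
        simp [this, key, A.d_d]
      · have : D (single (Sum.inr y) 1) = inlChain (z y) := by simp [hD]
        simp [this, key, hd])
    simpa using this
  deg_eq_zero := by
    rintro (b | y)
    · simp [A.deg_eq_zero]
    · simp
  p_deg := by simp
  p_p := by simp
  d_p := by simp
  p_d := by simp
  p_pt := by simp

section attach

variable (A : LocComplex X) (Y : Type u) [Finite Y] (l : Y → X) (k : ℕ)
    (z : Y → (A.B →₀ ℤ)) (hz : ∀ y, ∀ b ∈ (z y).support, A.deg b = k)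
    (hd : ∀ y, A.d (z y) = 0)

theorem attach_d_inr (y : Y) :
    (A.attach Y l k z hz hd).d (single (Sum.inr y) 1) = inlChain (z y) := by
  simp [attach]

theorem attach_d_inl (b : A.B) :
    (A.attach Y l k z hz hd).d (single (Sum.inl b) 1) = inlChain (A.d (single b 1)) := by
  simp [attach]

theorem attach_d (c : A.B →₀ ℤ) :
    (A.attach Y l k z hz hd).d (inlChain c) = inlChain (A.d c) :=
  map_eq_of_support (f := (A.attach Y l k z hz hd).d ∘ₗ inlChain) (g := inlChain ∘ₗ A.d)
    fun b _ => by
      simp only [LinearMap.comp_apply]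
      rw [inlChain_single]
      exact attach_d_inl ..

theorem inlChain_mem_Sub {j : ℕ} {S : Set X} {c : A.B →₀ ℤ} (hc : c ∈ A.Sub j S) :
    inlChain c ∈ (A.attach Y l k z hz hd).Sub j S := by
  intro x hx
  obtain ⟨b, hb, rfl⟩ := mem_support_inlChain hx
  exact hc hb

/-- The new generators have degree `k + 1`, so chains of degree at most `k` do not change. -/
theorem exists_inlChain {j : ℕ} (hj : j ≤ k) {S : Set X}
    {c : (A.attach Y l k z hz hd).B →₀ ℤ} (hc : c ∈ (A.attach Y l k z hz hd).Sub j S) :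
    ∃ c' ∈ A.Sub j S, inlChain c' = c := by
  have hr : ∀ x ∈ c.support, ∃ b, Sum.inl b = x ∧ A.deg b = j ∧ (j = 0 ∨ A.loc b ∈ S) := by
    rintro (b | y) hx
    · exact ⟨b, rfl, hc hx⟩
    · have : k + 1 = j := (hc hx).1
      omega
  refine ⟨c.comapDomain Sum.inl Sum.inl_injective.injOn, fun b hb => ?_, ?_⟩
  · have : Sum.inl b ∈ c.support := by simpa using hb
    exact hc this
  · refine mapDomain_comapDomain _ Sum.inl_injective _ fun x hx => ?_
    obtain ⟨b, rfl, -⟩ := hr x hx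
    exact ⟨b, rfl⟩

end attach

variable [MetricSpace X]

/-- A complex with trivial projection whose differential has small control and in which cycles of
degree `j < k` in `s j`-balls bound. -/
structure IsResolution (A : LocComplex X) (s : ℕ → ℝ) (k : ℕ) : Prop where
  p_eq : ∀ c, A.p c = c
  deg_le : ∀ b, A.deg b ≤ k
  fill : ∀ j < k, A.Fill j (s j) (s j)
  face : ∀ b, ∀ b' ∈ (A.d (single b 1)).support, A.deg b' ≠ 0 →
    dist (A.loc b') (A.loc b) < 2 * s (A.deg b')

/-- To pass from `k` to `k + 1`, take a finite `s k`-net. For each net point `y`, the cycles of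
degree `k` in the ball of radius `2 * s k` form a finitely generated group, and its generators are
bounded by new elements located at `y`. The doubled radius absorbs the distance from an arbitrary
centre to the net. -/
theorem exists_isResolution [CompactSpace X] [Nonempty X] (s : ℕ → ℝ) (hs : ∀ j, 0 < s j) (k : ℕ) :
    ∃ A : LocComplex X, A.IsResolution s k := by
  classical
  induction k with
  | zero =>
    refine ⟨point (Classical.arbitrary X), fun c => rfl, fun b => le_rfl, by simp, ?_⟩
    intro b b' hb'
    simp at hb'
  | succ k ih =>
    obtain ⟨A, hA⟩ := ih
    obtain ⟨t, -, ht, hcov⟩ := (isCompact_univ (X := X)).finite_cover_balls (hs k)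
    let Z : X → Submodule ℤ (A.B →₀ ℤ) := fun y =>
      A.Sub k (ball y (2 * s k)) ⊓ LinearMap.ker A.d
    have hfg : ∀ y, ∃ S : Finset (A.B →₀ ℤ), Submodule.span ℤ (S : Set (A.B →₀ ℤ)) = Z y :=
      fun y => IsNoetherian.noetherian (Z y)
    choose S hS using hfg
    have hmem : ∀ y, ∀ c ∈ S y, c ∈ Z y := fun y c hc => hS y ▸ Submodule.subset_span hc
    have : Finite t := ht
    let Y : Type u := Σ y : t, S y.1
    let z : Y → (A.B →₀ ℤ) := fun y => y.2.1
    have hz : ∀ y : Y, z y ∈ Z y.1.1 := fun y => hmem _ _ y.2.2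
    let A' := A.attach Y (fun y => y.1.1) k z (fun y b hb => ((hz y).1 hb).1) fun y => (hz y).2
    have hA' : ∀ c, A'.d (inlChain c) = inlChain (A.d c) := A.attach_d _ _ _ _ _ _
    refine ⟨A', fun c => rfl, ?_, ?_, ?_⟩
    · rintro (b | y)
      · exact (hA.deg_le b).trans k.le_succ
      · exact le_rfl
    · intro j hj x c hc _ hdc
      obtain ⟨c', hc', rfl⟩ := A.exists_inlChain _ _ _ _ _ _ (Nat.le_of_lt_succ hj) hc
      have hd' : A.d c' = 0 := by
        refine inlChain_injective ((hA' _).symm.trans ?_)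
        rw [map_zero]
        exact hdc
      rcases Nat.lt_succ_iff_lt_or_eq.1 hj with h | rfl
      · obtain ⟨w, hw, -, hdw⟩ := hA.fill j h x c' hc' (hA.p_eq _) hd'
        exact ⟨inlChain w, A.inlChain_mem_Sub _ _ _ _ _ _ hw, rfl,
          (hA' _).trans (congrArg _ hdw)⟩
      · obtain ⟨y, hy, hxy⟩ := Set.mem_iUnion₂.1 (hcov (Set.mem_univ x))
        have hcy : c' ∈ Z y := by
          refine ⟨Sub_mono (ball_subset_ball' ?_) hc', hd'⟩
          have : dist x y < s j := hxy
          linarith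
        have hspan : ∀ c ∈ Submodule.span ℤ (S y : Set (A.B →₀ ℤ)),
            ∃ w ∈ A'.Sub (j + 1) {y}, A'.d w = inlChain c := by
          intro c hc
          induction hc using Submodule.span_induction with
          | mem c hc =>
            exact ⟨single (Sum.inr ⟨⟨y, hy⟩, ⟨c, hc⟩⟩) 1, single_mem_Sub rfl rfl,
              A.attach_d_inr _ _ _ _ _ _ _⟩
          | zero => exact ⟨0, Submodule.zero_mem _, by simp⟩
          | add a b _ _ ha hb =>
            obtain ⟨w, hw, e⟩ := ha
            obtain ⟨w', hw', e'⟩ := hb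
            exact ⟨w + w', Submodule.add_mem _ hw hw', by rw [map_add, map_add, e, e']⟩
          | smul r a _ ha =>
            obtain ⟨w, hw, e⟩ := ha
            exact ⟨r • w, Submodule.smul_mem _ _ hw, by rw [map_smul, map_smul, e]⟩
        obtain ⟨w, hw, hdw⟩ := hspan c' (by rw [hS]; exact hcy)
        refine ⟨w, Sub_mono ?_ hw, rfl, hdw⟩
        rintro _ rfl
        rw [mem_ball, dist_comm]
        exact hxy
    · rintro (b | y) b' hb' h0
      · have hb' : b' ∈ (inlChain (A.d (single b 1))).support := by
          rw [← A.attach_d_inl Y (fun y => y.1.1) k z (fun y b hb => ((hz y).1 hb).1)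
            fun y => (hz y).2]
          exact hb'
        obtain ⟨b₁, hb₁, rfl⟩ := mem_support_inlChain hb'
        exact hA.face b b₁ hb₁ h0
      · have hb' : b' ∈ (inlChain (z y)).support := by
          rw [← A.attach_d_inr Y (fun y => y.1.1) k z (fun y b hb => ((hz y).1 hb).1)
            fun y => (hz y).2]
          exact hb'
        obtain ⟨b₁, hb₁, rfl⟩ := mem_support_inlChain hb'
        have h := (hz y).1 hb₁
        have h1 : A.deg b₁ = k := h.1
        have h2 : A.deg b₁ ≠ 0 := h0
        have h3 : A.loc b₁ ∈ ball y.1.1 (2 * s k) := h.2.resolve_left (h1 ▸ h2)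
        change dist (A.loc b₁) y.1.1 < 2 * s (A.deg b₁)
        rw [h1]
        exact h3

end LocComplex

end ControlledAlgebra

/-! ### Scales, and filling with a modulus that depends only on the space -/

namespace ControlledAlgebra

open Finsupp Metric

/-! ### Local contractibility at a discrete level -/

open Filter Topology in
/-- The filter of sequences `s` where `s n`, …, `s 0` are chosen small one after another and the
other values are fixed. -/
def scaleFilter : ℕ → (ℕ → ℝ) → Filter (ℕ → ℝ)
  | 0, s => map (fun a => Function.update s 0 a) (𝓝[>] 0)
  | n + 1, s => Filter.bind (𝓝[>] 0) fun a => scaleFilter n (Function.update s (n + 1) a)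

section scaleFilter

open Filter Topology

theorem eventually_scaleFilter_zero {s : ℕ → ℝ} {P : (ℕ → ℝ) → Prop} :
    (∀ᶠ s' in scaleFilter 0 s, P s') ↔ ∀ᶠ a in 𝓝[>] (0 : ℝ), P (Function.update s 0 a) :=
  Iff.rfl

theorem eventually_scaleFilter_succ {n : ℕ} {s : ℕ → ℝ} {P : (ℕ → ℝ) → Prop} :
    (∀ᶠ s' in scaleFilter (n + 1) s, P s') ↔
      ∀ᶠ a in 𝓝[>] (0 : ℝ), ∀ᶠ s' in scaleFilter n (Function.update s (n + 1) a), P s' :=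
  Iff.rfl

theorem exists_of_eventually_scaleFilter {n : ℕ} {s : ℕ → ℝ} {P : (ℕ → ℝ) → Prop}
    (h : ∀ᶠ s' in scaleFilter n s, P s') : ∃ s', P s' := by
  induction n generalizing s with
  | zero => exact ⟨_, (eventually_scaleFilter_zero.1 h).exists.choose_spec⟩
  | succ n ih => exact ih (eventually_scaleFilter_succ.1 h).exists.choose_spec

theorem eventually_scaleFilter_eq {n j : ℕ} (hj : n < j) (s : ℕ → ℝ) :
    ∀ᶠ s' in scaleFilter n s, s' j = s j := by
  induction n generalizing s with
  | zero =>
    exact eventually_scaleFilter_zero.2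
      (Eventually.of_forall fun a => Function.update_of_ne hj.ne' _ _)
  | succ n ih =>
    refine eventually_scaleFilter_succ.2 (Eventually.of_forall fun a => ?_)
    filter_upwards [ih (by omega) (Function.update s (n + 1) a)] with s' hs'
    rw [hs', Function.update_of_ne hj.ne']

/-- The hypothesis holds for every choice of the fixed upper values, so choosing further ones
beforehand does no harm. -/
theorem eventually_scaleFilter_mono {m n : ℕ} (h : m ≤ n) {P : (ℕ → ℝ) → Prop}
    (hP : ∀ s, ∀ᶠ s' in scaleFilter m s, P s') (s : ℕ → ℝ) : ∀ᶠ s' in scaleFilter n s, P s' := by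
  induction n, h using Nat.le_induction generalizing s with
  | base => exact hP s
  | succ n _ ih => exact eventually_scaleFilter_succ.2 (Eventually.of_forall fun a => ih _)

theorem eventually_scaleFilter_lt {n j : ℕ} (hj : j ≤ n) {c : ℝ} (hc : 0 < c) (s : ℕ → ℝ) :
    ∀ᶠ s' in scaleFilter n s, 0 < s' j ∧ s' j < c := by
  refine eventually_scaleFilter_mono hj (fun s => ?_) s
  have h0 : ∀ᶠ a in 𝓝[>] (0 : ℝ), 0 < a ∧ a < c := Ioo_mem_nhdsGT hc
  cases j with
  | zero =>
    refine eventually_scaleFilter_zero.2 (h0.mono fun a ha => ?_)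
    rwa [Function.update_self]
  | succ j =>
    refine eventually_scaleFilter_succ.2 (h0.mono fun a ha => ?_)
    filter_upwards [eventually_scaleFilter_eq j.lt_succ_self
      (Function.update s (j + 1) a)] with s' hs'
    rwa [hs', Function.update_self]

theorem eventually_scaleFilter_le (n : ℕ) (s : ℕ → ℝ) :
    ∀ᶠ s' in scaleFilter n s, ∀ j ≤ n, 0 < s' j ∧ s' j ≤ s' n := by
  cases n with
  | zero =>
    filter_upwards [eventually_scaleFilter_lt le_rfl one_pos s] with s' hs' j hj
    obtain rfl : j = 0 := by omega
    exact ⟨hs'.1, le_rfl⟩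
  | succ n =>
    refine eventually_scaleFilter_succ.2 ?_
    filter_upwards [self_mem_nhdsWithin] with a ha
    have h1 : ∀ᶠ s' in scaleFilter n (Function.update s (n + 1) a),
        ∀ j ∈ Finset.range (n + 1), 0 < s' j ∧ s' j < a :=
      (Finset.eventually_all _).2 fun j hj =>
        eventually_scaleFilter_lt (Nat.lt_succ_iff.1 (Finset.mem_range.1 hj)) ha _
    filter_upwards [h1, eventually_scaleFilter_eq n.lt_succ_self
      (Function.update s (n + 1) a)] with s' h1 h2 j hj
    rw [Function.update_self] at h2
    rw [h2]
    rcases Nat.lt_or_eq_of_le hj with h | rfl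
    · exact ⟨(h1 j (Finset.mem_range.2 h)).1, (h1 j (Finset.mem_range.2 h)).2.le⟩
    · exact ⟨h2 ▸ ha, h2.le⟩

end scaleFilter

variable {X : Type u} [MetricSpace X]

variable (X) in
/-- Small balls can be contracted inside slightly larger balls through sequences of maps which have
small steps and are uniformly continuous up to a small error. -/
def DiscretelyLocallyContractible : Prop :=
  ∀ ε > (0 : ℝ), ∃ δ > (0 : ℝ), ∀ η > (0 : ℝ), ∃ η' > (0 : ℝ), ∀ x : X,
    ∃ (M : ℕ) (c : ℕ → X → X),
      (∀ y ∈ ball x δ, c 0 y = y) ∧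
      (∀ y ∈ ball x δ, ∀ j ≤ M, dist (c j y) x < ε) ∧
      (∀ y ∈ ball x δ, ∀ j < M, dist (c j y) (c (j + 1) y) < η) ∧
      (∀ y ∈ ball x δ, c M y = c M x) ∧
      ∀ y ∈ ball x δ, ∀ y' ∈ ball x δ, dist y y' < η' → ∀ j ≤ M, dist (c j y) (c j y') < η

/-- A sequence of scales adapted to a modulus of fillability. -/
noncomputable def scaleSeq (Δ : ℝ → ℝ) (a : ℝ) : ℕ → ℝ
  | 0 => a
  | n + 1 => min (Δ (scaleSeq Δ a n) / 4) (scaleSeq Δ a n / 4)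

section scaleSeq

variable {Δ : ℝ → ℝ} {a : ℝ}

theorem scaleSeq_pos (hΔ : ∀ e > 0, 0 < Δ e) (ha : 0 < a) (n : ℕ) : 0 < scaleSeq Δ a n := by
  induction n with
  | zero => exact ha
  | succ n ih => exact lt_min (div_pos (hΔ _ ih) four_pos) (div_pos ih four_pos)

theorem scaleSeq_antitone (hΔ : ∀ e > 0, 0 < Δ e) (ha : 0 < a) : Antitone (scaleSeq Δ a) :=
  antitone_nat_of_succ_le fun n => (min_le_right _ _).trans
    (div_le_self (scaleSeq_pos hΔ ha n).le (by norm_num))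

/-- The factor `4` leaves room for a radius of the sequence together with the small errors of
position, so that each filling moves just one step up the sequence. -/
theorem four_mul_scaleSeq_le (n : ℕ) : 4 * scaleSeq Δ a (n + 1) ≤ Δ (scaleSeq Δ a n) := by
  have := min_le_left (Δ (scaleSeq Δ a n) / 4) (scaleSeq Δ a n / 4)
  change 4 * min _ _ ≤ _
  linarith

theorem four_mul_scaleSeq_le' (n : ℕ) : 4 * scaleSeq Δ a (n + 1) ≤ scaleSeq Δ a n := by
  have := min_le_right (Δ (scaleSeq Δ a n) / 4) (scaleSeq Δ a n / 4)
  change 4 * min _ _ ≤ _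
  linarith

end scaleSeq

namespace LocComplex

variable (X) in
/-- Eventually, all resolutions have the filling property in degree `k`, with a modulus which only
depends on `X`. -/
def FillsEventually (k : ℕ) : Prop :=
  ∀ ε > (0 : ℝ), ∃ δ > (0 : ℝ), ∀ s, ∀ᶠ s' in scaleFilter k s, ∀ (A : LocComplex X) (K : ℕ),
    A.IsResolution s' K → k < K → A.Fill k δ ε

theorem FillsEventually.exists_forall {n : ℕ} (h : ∀ m ≤ n, FillsEventually X m) {ε : ℝ}
    (hε : 0 < ε) : ∃ δ > (0 : ℝ), ∀ s, ∀ᶠ s' in scaleFilter n s, ∀ (A : LocComplex X) (K : ℕ),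
      A.IsResolution s' K → n < K → ∀ m ≤ n, A.Fill m δ ε := by
  induction n with
  | zero =>
    obtain ⟨δ, hδ, H⟩ := h 0 le_rfl ε hε
    refine ⟨δ, hδ, fun s => (H s).mono fun s' hs' A K hA hK m hm => ?_⟩
    obtain rfl : m = 0 := by omega
    exact hs' A K hA hK
  | succ n ih =>
    obtain ⟨δ, hδ, H⟩ := ih fun m hm => h m (hm.trans n.le_succ)
    obtain ⟨δ', hδ', H'⟩ := h (n + 1) le_rfl ε hε
    refine ⟨min δ δ', lt_min hδ hδ', fun s => ?_⟩
    filter_upwards [eventually_scaleFilter_mono n.le_succ H s, H' s] with s' h1 h2 A K hA hK m hm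
    rcases Nat.lt_or_eq_of_le hm with hm | rfl
    · exact (h1 A K hA (by omega) m (by omega)).mono (min_le_left _ _) le_rfl
    · exact (h2 A K hA hK).mono (min_le_right _ _) le_rfl

theorem IsResolution.mem_fixed {A : LocComplex X} {s : ℕ → ℝ} {K : ℕ} (hA : A.IsResolution s K)
    (c : A.B →₀ ℤ) : c ∈ A.fixed := hA.p_eq c

/-- Let `f` be a chain map over the final, constant stage `c M` of the contraction, and `h` a
homotopy from the identity to `f` along the stages. Then `f z` lies in a ball of radius `s (n + 1)`,
so it bounds some `w` by construction of the resolution, and `w - h z` bounds `z`. In degrees at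
most `n` the fillings come from `hfill`; degree `n + 1` needs only the resolution itself. -/
theorem fill_of_discretelyLocallyContractible {A : LocComplex X} {s : ℕ → ℝ} {K n : ℕ}
    (hA : A.IsResolution s K) (hK : n + 1 < K) {R : ℕ → ℝ} (hR : ∀ j, 0 < R j) (hanti : Antitone R)
    (h0 : R 0 = s (n + 1)) (hR1 : 4 * R 1 ≤ R 0)
    (hfill : ∀ m ≤ n, ∀ j, j ≤ 2 * n + 3 → A.Fill m (4 * R (j + 1)) (R j))
    {σ ρ δ ε : ℝ} (hσ : ∀ j ≤ n, s j ≤ σ) (hρ : 0 < ρ) (hρR : ρ ≤ R (2 * n + 5))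
    (hsε : s (n + 1) ≤ ε / 2) (hσ0 : 0 < σ) (hσδ : 2 * ((n : ℝ) + 1) * σ ≤ δ / 2)
    (x : X) (M : ℕ) (c : ℕ → X → X)
    (c0 : ∀ y ∈ ball x δ, c 0 y = y)
    (cε : ∀ y ∈ ball x δ, ∀ j ≤ M, dist (c j y) x < ε / 2)
    (cρ : ∀ y ∈ ball x δ, ∀ j < M, dist (c j y) (c (j + 1) y) < ρ)
    (cM : ∀ y ∈ ball x δ, c M y = c M x)
    (cc : ∀ y ∈ ball x δ, ∀ y' ∈ ball x δ, dist y y' < 2 * σ → ∀ j ≤ M, dist (c j y) (c j y') < ρ)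
    (z : A.B →₀ ℤ) (hz : z ∈ A.Sub (n + 1) (ball x (δ / 2))) (hdz : A.d z = 0) :
    ∃ w ∈ A.Sub (n + 1 + 1) (ball x ε), A.p w = w ∧ A.d w = z := by
  classical
  have hδ : 0 < δ := by
    have : 0 < 2 * ((n : ℝ) + 1) * σ := by positivity
    linarith
  -- The contraction is defined only on the `δ`-ball. Passing to a face moves by less than `2 * σ`
  -- and lowers the degree by one, so this condition is inherited by faces.
  let G : A.B → Prop := fun b => A.deg b ≤ n + 1 ∧
    (A.deg b = 0 ∨ dist (A.loc b) x < δ - 2 * A.deg b * σ)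
  let ϑ : ℕ → A.B → X := fun j b => if A.deg b = 0 then x else c j (A.loc b)
  have hϑ : ∀ j b, A.deg b ≠ 0 → ϑ j b = c j (A.loc b) := fun j b hb => if_neg hb
  have hϑ0 : ∀ j b, A.deg b = 0 → ϑ j b = x := fun j b hb => if_pos hb
  have hGball : ∀ b, G b → A.deg b ≠ 0 → A.loc b ∈ ball x δ := fun b hb h => by
    have h1 := hb.2.resolve_left h
    have : 0 ≤ 2 * (A.deg b : ℝ) * σ := by positivity
    rw [mem_ball]
    linarith
  have hface2 : ∀ b, G b → ∀ b' ∈ (A.d (single b 1)).support, A.deg b' ≠ 0 →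
      dist (A.loc b') (A.loc b) < 2 * σ := fun b hb b' hb' h => by
    have h1 := hA.face b b' hb' h
    have h2 := A.d_deg b b' hb'
    have h3 := hσ (A.deg b') (by have := hb.1; omega)
    linarith
  have hG : ∀ b, G b → ∀ b' ∈ (A.d (single b 1)).support, G b' := by
    intro b hb b' hb'
    have h2 := A.d_deg b b' hb'
    refine ⟨by have := hb.1; omega, or_iff_not_imp_left.2 fun h => ?_⟩
    have h3 := hface2 b hb b' hb' h
    have h4 := hb.2.resolve_left (by omega)
    have h5 : dist (A.loc b') x ≤ dist (A.loc b') (A.loc b) + dist (A.loc b) x :=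
      dist_triangle _ _ _
    have h6 : (A.deg b : ℝ) = A.deg b' + 1 := by exact_mod_cast h2.symm
    rw [h6] at h4
    linarith
  have hface : ∀ b, G b → ∀ b' ∈ (A.d (single b 1)).support, A.deg b' ≠ 0 →
      ∀ j ≤ M, dist (ϑ j b') (ϑ j b) ≤ ρ := by
    intro b hb b' hb' h j hj
    have h2 := A.d_deg b b' hb'
    rw [hϑ _ _ h, hϑ _ _ (by omega)]
    exact (cc _ (hGball b' (hG b hb b' hb') h) _ (hGball b hb (by omega))
      (hface2 b hb b' hb' h) j hj).le
  -- Radii grow with the degree. Chain maps use the indices `n + 2, …, 2 * n + 3` and the homotopy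
  -- uses `0, …, n + 1`, so the homotopy has radius `R 0 = s (n + 1)` in the top degree.
  let α : ℕ → ℝ := fun m => R (2 * n + 3 - m)
  let β : ℕ → ℝ := fun m => R (n + 1 - m)
  let r' : ℕ → ℝ := fun m => 4 * R (2 * n + 3 - m)
  let r : ℕ → ℝ := fun m => 4 * R (n + 2 - m)
  have hρ' : ∀ j ≤ 2 * n + 5, ρ ≤ R j := fun j hj => hρR.trans (hanti hj)
  have hα' : ∀ m < n + 1, α m + ρ ≤ r' m := fun m _ => by
    have := hρ' (2 * n + 3 - m) (by omega)
    have := hR (2 * n + 3 - m)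
    simp only [α, r']
    linarith
  have hfill' : ∀ m < n + 1, A.Fill m (r' m) (α (m + 1)) := fun m hm => by
    have := hfill m (by omega) (2 * n + 3 - (m + 1)) (by omega)
    rwa [show 2 * n + 3 - (m + 1) + 1 = 2 * n + 3 - m by omega] at this
  have hα : ∀ m ≤ n + 1, α m + ρ ≤ r m := fun m _ => by
    have := hρ' (n + 2 - m) (by omega)
    have := hR (n + 2 - m)
    have : R (2 * n + 3 - m) ≤ R (n + 2 - m) := hanti (by omega)
    simp only [α, r]
    linarith
  have hβ : ∀ m < n + 1, β m + ρ ≤ r (m + 1) := fun m _ => by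
    have := hρ' (n + 1 - m) (by omega)
    have := hR (n + 1 - m)
    simp only [β, r, show n + 2 - (m + 1) = n + 1 - m by omega]
    linarith
  have hfillr : ∀ m ≤ n + 1, A.Fill m (r m) (β m) := fun m hm => by
    rcases Nat.lt_or_eq_of_le hm with h | rfl
    · have := hfill m (by omega) (n + 1 - m) (by omega)
      rwa [show n + 1 - m + 1 = n + 2 - m by omega] at this
    -- The top degree is filled at the scale built into the resolution.
    · refine (hA.fill (n + 1) hK).mono ?_ ?_
      · simp only [r, show n + 2 - (n + 1) = 1 by omega]
        linarith
      · simp only [β, Nat.sub_self]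
        exact h0.ge
  have hGk : ∀ b, G b → A.deg b ≤ n + 1 := fun b hb => hb.1
  have hα0 : ∀ m, 0 < α m := fun m => hR _
  obtain ⟨f, hf⟩ := exists_chainMap (T := A) A.toBasedComplex G hG hGk (ϑ M) (α := α)
    (fun b hb b' hb' h => hface b hb b' hb' h M le_rfl) hα' hfill'
  obtain ⟨h, hh⟩ := exists_homotopy_path (T := A) A.toBasedComplex G hG hGk hρ.le hα' hfill' hα hβ
    hfillr ϑ M hface (fun b hb j hj => by
      by_cases h : A.deg b = 0
      · rw [hϑ0 _ _ h, hϑ0 _ _ h, dist_self]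
        exact hρ.le
      · rw [hϑ _ _ h, hϑ _ _ h]
        exact (cρ _ (hGball b hb h) j hj).le) LinearMap.id f (fun _ _ => rfl)
    (fun b hb => (hf b hb).1) (fun b hb => by
      by_cases h : A.deg b = 0
      · rw [h, (A.deg_eq_zero b).1 h]
        exact A.pt_mem_Sub _
      · refine single_mem_Sub rfl ?_
        rw [hϑ _ _ h, c0 _ (hGball b hb h)]
        exact mem_ball_self (hα0 _)) (fun b hb => (hf b hb).2.1)
    (fun b hb => hA.mem_fixed _) (fun b hb => (hf b hb).2.2.1)
    (fun b hb h => by rw [(A.deg_eq_zero b).1 h]; rfl) (fun b hb => (hf b hb).2.2.2)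
  have hzG : ∀ b ∈ z.support, G b := fun b hb => by
    have h1 : A.deg b = n + 1 := (hz hb).1
    have h2 : dist (A.loc b) x < δ / 2 := (hz hb).2.resolve_left (by omega)
    refine ⟨h1.le, Or.inr ?_⟩
    rw [h1]
    push_cast
    linarith
  have hzdeg : ∀ b ∈ z.support, A.deg b = n + 1 := fun b hb => (hz hb).1
  have hdh : A.d (h z) = f z - z := by
    have := map_eq_of_support (c := z) (f := A.d ∘ₗ h + h ∘ₗ A.d) (g := f - LinearMap.id)
      fun b hb => by simpa using (hh b (hzG b hb)).1
    simpa [hdz] using this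
  have hdf : A.d (f z) = 0 := by
    have := map_eq_of_support (c := z) (f := A.d ∘ₗ f) (g := f ∘ₗ A.d)
      fun b hb => by simpa using (hf b (hzG b hb)).1
    simpa [hdz] using this
  have hfz : f z ∈ A.Sub (n + 1) (ball (c M x) (s (n + 1))) := by
    refine map_mem_of_support fun b hb => ?_
    have h1 := (hf b (hzG b hb)).2.1
    have h2 := hzdeg b hb
    rw [hϑ _ _ (by omega), cM _ (hGball b (hzG b hb) (by omega)), h2] at h1
    exact Sub_mono (ball_subset_ball (h0 ▸ hanti (Nat.zero_le _))) h1
  obtain ⟨w, hw, -, hdw⟩ := hA.fill (n + 1) hK _ _ hfz (hA.p_eq _) hdf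
  refine ⟨w - h z, Submodule.sub_mem _ (Sub_mono ?_ hw) (map_mem_of_support fun b hb => ?_),
    hA.p_eq _, by rw [map_sub, hdw, hdh, sub_sub_cancel]⟩
  · refine ball_subset_ball' ?_
    have := cε x (mem_ball_self hδ) M le_rfl
    linarith
  · have h1 := (hh b (hzG b hb)).2.1
    have h2 := hzdeg b hb
    rw [h2] at h1
    refine Sub_mono ?_ h1
    rintro y ⟨j, hj, hy⟩
    rw [hϑ _ _ (by omega)] at hy
    have h3 := cε _ (hGball b (hzG b hb) (by omega)) j hj
    have h4 : β (n + 1) = s (n + 1) := by simp [β, h0]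
    rw [mem_ball]
    calc dist y x ≤ dist y (c j (A.loc b)) + dist (c j (A.loc b)) x := dist_triangle _ _ _
      _ < ε := by linarith

/-- The radius `δ` comes from the contractions alone. Then `a = s (n + 1)` is chosen, which
determines the radii `R`, hence the step size of the contraction and its modulus `η'`; last come the
lower scales, small compared with all of these. This dictates the order of choice in `scaleFilter`.
-/
theorem fillsEventually (hX : DiscretelyLocallyContractible X) (k : ℕ) : FillsEventually X k := by
  induction k using Nat.strong_induction_on with
  | _ k ih =>
  intro ε hε
  cases k with
  | zero =>
    -- Chains of degree `0` have no location, so any `δ` serves.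
    refine ⟨1, one_pos, fun s => ?_⟩
    filter_upwards [eventually_scaleFilter_lt le_rfl hε s] with s' hs' A K hA hK x c hc hp hd
    obtain ⟨w, hw, h⟩ := hA.fill 0 hK x c (Sub_zero _ _ hc) hp hd
    exact ⟨w, Sub_mono (ball_subset_ball hs'.2.le) hw, h⟩
  | succ n =>
    have hΔ : ∀ e : ℝ, ∃ δ : ℝ, 0 < e → (0 < δ ∧ ∀ s, ∀ᶠ s' in scaleFilter n s,
        ∀ (A : LocComplex X) (K : ℕ), A.IsResolution s' K → n < K → ∀ m ≤ n, A.Fill m δ e) := by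
      intro e
      by_cases he : 0 < e
      · obtain ⟨δ, h1, h2⟩ := FillsEventually.exists_forall
          (fun m hm => ih m (Nat.lt_succ_of_le hm)) he
        exact ⟨δ, fun _ => ⟨h1, h2⟩⟩
      · exact ⟨0, fun h => absurd h he⟩
    choose Δ hΔ using hΔ
    have hΔ0 : ∀ e > 0, 0 < Δ e := fun e he => (hΔ e he).1
    obtain ⟨δ, hδ, hc⟩ := hX (ε / 2) (half_pos hε)
    refine ⟨δ / 2, half_pos hδ, fun s => eventually_scaleFilter_succ.2 ?_⟩
    have h0 : ∀ᶠ a in nhdsWithin (0 : ℝ) (Set.Ioi 0), 0 < a ∧ a < ε / 2 :=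
      Ioo_mem_nhdsGT (half_pos hε)
    filter_upwards [h0] with a ha
    let R := scaleSeq Δ a
    have hR : ∀ j, 0 < R j := scaleSeq_pos hΔ0 ha.1
    obtain ⟨η', hη', hc⟩ := hc (R (2 * n + 5)) (hR _)
    have hfill : ∀ᶠ s' in scaleFilter n (Function.update s (n + 1) a),
        ∀ j ∈ Finset.range (2 * n + 4), ∀ (A : LocComplex X) (K : ℕ),
          A.IsResolution s' K → n < K → ∀ m ≤ n, A.Fill m (Δ (R j)) (R j) :=
      (Finset.eventually_all _).2 fun j _ => (hΔ (R j) (hR j)).2 _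
    -- The first bound places faces within the modulus `η'`; the second keeps all iterated faces of
    -- the cycle inside the `δ`-ball.
    have hσ : 0 < min (η' / 2) (δ / (4 * ((n : ℝ) + 1))) := lt_min (by positivity) (by positivity)
    filter_upwards [hfill, eventually_scaleFilter_eq n.lt_succ_self _,
      eventually_scaleFilter_le n _, eventually_scaleFilter_lt le_rfl hσ _]
      with s' h1 h2 h3 h4 A K hA hK x z hz _ hdz
    rw [Function.update_self] at h2
    obtain ⟨M, c, c0, cε, cρ, cM, cc⟩ := hc x
    have h5 := h4.2.trans_le (min_le_left _ _)
    have h6 := h4.2.trans_le (min_le_right _ _)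
    refine fill_of_discretelyLocallyContractible hA hK hR (scaleSeq_antitone hΔ0 ha.1) h2.symm
      (four_mul_scaleSeq_le' 0) (fun m hm j hj => ?_) (σ := s' n) (fun j hj => (h3 j hj).2)
      (hR (2 * n + 5)) le_rfl (h2 ▸ ha.2.le) h4.1 ?_ x M c c0 cε cρ cM
      (fun y hy y' hy' hd => cc y hy y' hy' (by linarith)) z hz hdz
    · exact (h1 j (Finset.mem_range.2 (by omega)) A K hA (by omega) m hm).mono
        (four_mul_scaleSeq_le j) le_rfl
    · rw [lt_div_iff₀ (by positivity)] at h6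
      linarith

end LocComplex

end ControlledAlgebra

/-! ### The full simplex, which contains the nerve of a cover -/

namespace ControlledAlgebra

open Finsupp Metric

/-! ### The augmented chain complex of a simplex -/

section Simplex

variable {ι : Type u} [LinearOrder ι]

/-- The sign of the transposition of two vertices. -/
def vertexSign (w v : ι) : ℤ := if w < v then -1 else 1

theorem vertexSign_self (v : ι) : vertexSign v v = 1 := by simp [vertexSign]

theorem vertexSign_swap {v w : ι} (h : v ≠ w) : vertexSign v w = - vertexSign w v := by
  rcases lt_or_gt_of_ne h with h | h <;> simp [vertexSign, h, not_lt_of_gt h]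

theorem vertexSign_mul_self (v w : ι) : vertexSign v w * vertexSign v w = 1 := by
  unfold vertexSign
  split_ifs <;> norm_num

/-- The sign with which a vertex enters a simplex. -/
def simplexSign (v : ι) (σ : Finset ι) : ℤ := ∏ w ∈ σ, vertexSign w v

theorem simplexSign_mul_self (v : ι) (σ : Finset ι) : simplexSign v σ * simplexSign v σ = 1 := by
  simp [simplexSign, ← Finset.prod_mul_distrib, vertexSign_mul_self]

theorem simplexSign_erase (v : ι) {w : ι} {σ : Finset ι} (h : w ∈ σ) :
    simplexSign v (σ.erase w) = vertexSign w v * simplexSign v σ := by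
  have := Finset.mul_prod_erase σ (fun w => vertexSign w v) h
  rw [simplexSign, simplexSign, ← this, ← mul_assoc, vertexSign_mul_self, one_mul]

theorem simplexSign_insert (v : ι) {w : ι} {σ : Finset ι} (h : w ∉ σ) :
    simplexSign v (insert w σ) = vertexSign w v * simplexSign v σ :=
  Finset.prod_insert h

/-- Removing a vertex. -/
noncomputable def removeVertex (v : ι) : (Finset ι →₀ ℤ) →ₗ[ℤ] (Finset ι →₀ ℤ) :=
  linearCombination ℤ fun σ => if v ∈ σ then simplexSign v σ • single (σ.erase v) 1 else 0

/-- Adding a vertex. -/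
noncomputable def addVertex (v : ι) : (Finset ι →₀ ℤ) →ₗ[ℤ] (Finset ι →₀ ℤ) :=
  linearCombination ℤ fun σ => if v ∈ σ then 0 else simplexSign v σ • single (insert v σ) 1

theorem removeVertex_single (v : ι) (σ : Finset ι) : removeVertex v (single σ 1) =
    if v ∈ σ then simplexSign v σ • single (σ.erase v) 1 else 0 := by
  simp [removeVertex]

theorem addVertex_single (v : ι) (σ : Finset ι) : addVertex v (single σ 1) =
    if v ∈ σ then 0 else simplexSign v σ • single (insert v σ) 1 := by
  simp [addVertex]

/-- Removing `w` changes the sign of `v` by `vertexSign w v`, and `vertexSign` is antisymmetric for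
distinct vertices. Removal and insertion of vertices thus behave as annihilation and creation
operators. -/
theorem removeVertex_removeVertex (v w : ι) (c : Finset ι →₀ ℤ) :
    removeVertex v (removeVertex w c) = - removeVertex w (removeVertex v c) := by
  refine map_eq_of_support (f := removeVertex v ∘ₗ removeVertex w)
    (g := - removeVertex w ∘ₗ removeVertex v) fun σ _ => ?_
  simp only [LinearMap.comp_apply, LinearMap.neg_apply, removeVertex_single]
  by_cases hvw : v = w
  · subst hvw
    by_cases hv : v ∈ σ <;> simp [-smul_single, hv, removeVertex_single]
  · by_cases hv : v ∈ σ <;> by_cases hw : w ∈ σ <;>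
      simp [-smul_single, hv, hw, removeVertex_single, hvw, Ne.symm hvw]
    rw [simplexSign_erase _ hw, simplexSign_erase _ hv, Finset.erase_right_comm, smul_smul,
      smul_smul, vertexSign_swap hvw, ← neg_smul]
    congr 1
    ring

/-- The canonical anticommutation relation; summed over `w` it says that adding `v` is a
contraction. -/
theorem addVertex_removeVertex (v w : ι) (c : Finset ι →₀ ℤ) :
    addVertex v (removeVertex w c) + removeVertex w (addVertex v c) = if v = w then c else 0 := by
  have : (if v = w then c else 0) = ((if v = w then LinearMap.id else 0 :
      (Finset ι →₀ ℤ) →ₗ[ℤ] (Finset ι →₀ ℤ))) c := by split_ifs <;> rfl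
  rw [this]
  refine map_eq_of_support (f := addVertex v ∘ₗ removeVertex w + removeVertex w ∘ₗ addVertex v)
    fun σ _ => ?_
  simp only [LinearMap.comp_apply, LinearMap.add_apply, removeVertex_single, addVertex_single]
  by_cases hvw : v = w
  · subst hvw
    by_cases hv : v ∈ σ
    · simp [-smul_single, hv, addVertex_single, simplexSign_erase, vertexSign_self, smul_smul,
        simplexSign_mul_self]
    · simp [-smul_single, hv, removeVertex_single, simplexSign_insert, vertexSign_self, smul_smul,
        simplexSign_mul_self]
  · by_cases hv : v ∈ σ <;> by_cases hw : w ∈ σ <;>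
      simp [-smul_single, hv, hw, removeVertex_single, addVertex_single, hvw, Ne.symm hvw]
    rw [simplexSign_erase _ hw, simplexSign_insert _ hv, smul_smul, smul_smul,
      Finset.erase_insert_of_ne hvw, vertexSign_swap hvw, ← add_smul]
    convert zero_smul ℤ _
    ring

/-- The chains of degree `k` in the face spanned by `S`. -/
def faceChains (k : ℕ) (S : Set ι) : Submodule ℤ (Finset ι →₀ ℤ) :=
  supported ℤ ℤ {σ | σ.card = k ∧ ↑σ ⊆ S}

theorem addVertex_mem_faceChains {k : ℕ} {S : Set ι} {v : ι} (hv : v ∈ S) {c : Finset ι →₀ ℤ}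
    (hc : c ∈ faceChains k S) : addVertex v c ∈ faceChains (k + 1) S := by
  refine map_mem_of_support fun σ hσ => ?_
  obtain ⟨h1, h2⟩ := hc hσ
  rw [addVertex_single]
  split_ifs with h
  · exact Submodule.zero_mem _
  · refine Submodule.smul_mem _ _ (single_mem_supported ℤ _ ⟨?_, ?_⟩)
    · rw [Finset.card_insert_of_notMem h, h1]
    · rw [Finset.coe_insert]
      exact Set.insert_subset hv h2

variable [Fintype ι]

variable (ι) in
/-- The augmented chain complex of the simplex with vertex set `ι`. -/
noncomputable abbrev simplexComplex : BasedComplex.{u} where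
  B := Finset ι
  deg := Finset.card
  d := ∑ v, removeVertex v
  d_deg σ τ hτ := by
    rw [LinearMap.sum_apply] at hτ
    obtain ⟨v, -, hv⟩ := Finset.mem_biUnion.1 (support_finsetSum hτ)
    rw [removeVertex_single] at hv
    split_ifs at hv with h
    · have := support_single_subset (support_smul hv)
      rw [Finset.mem_singleton.1 this]
      exact Finset.card_erase_add_one h
    · simp at hv
  d_d c := by
    simp only [LinearMap.sum_apply, map_sum]
    set S := ∑ x, ∑ y, removeVertex y (removeVertex x c) with hS
    -- Interchange the sums and anticommute; integral chains have no 2-torsion.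
    have h : S = - S := by
      conv_lhs => rw [hS, Finset.sum_comm]
      rw [hS, ← Finset.sum_neg_distrib]
      refine Finset.sum_congr rfl fun v _ => ?_
      rw [← Finset.sum_neg_distrib]
      exact Finset.sum_congr rfl fun w _ => removeVertex_removeVertex _ _ _
    exact self_eq_neg.1 h

theorem simplexComplex_d (c : Finset ι →₀ ℤ) :
    (simplexComplex ι).d c = ∑ v, removeVertex v c := by
  rw [← LinearMap.sum_apply]

theorem simplexComplex_face {σ τ : Finset ι}
    (h : τ ∈ ((simplexComplex ι).d (single σ 1)).support) : τ ⊆ σ := by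
  rw [simplexComplex_d] at h
  obtain ⟨v, -, hv⟩ := Finset.mem_biUnion.1 (support_finsetSum h)
  rw [removeVertex_single] at hv
  split_ifs at hv with h
  · have := support_single_subset (support_smul hv)
    rw [Finset.mem_singleton.1 this]
    exact Finset.erase_subset _ _
  · simp at hv

theorem simplexComplex_cone (v : ι) (c : Finset ι →₀ ℤ) :
    (simplexComplex ι).d (addVertex v c) + addVertex v ((simplexComplex ι).d c) = c := by
  rw [simplexComplex_d, simplexComplex_d, map_sum, ← Finset.sum_add_distrib]
  simp only [add_comm (removeVertex _ (addVertex v c)), addVertex_removeVertex]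
  simp

/-- A chain map to the complex of a simplex carried by faces. -/
theorem exists_map_simplexComplex (A : BasedComplex.{u}) (S : A.B → Set ι)
    (hne : ∀ b, A.deg b ≠ 0 → (S b).Nonempty)
    (hface : ∀ b, ∀ b' ∈ (A.d (single b 1)).support, S b' ⊆ S b) :
    ∃ f : (A.B →₀ ℤ) →ₗ[ℤ] (Finset ι →₀ ℤ), ∀ b,
      (simplexComplex ι).d (f (single b 1)) = f (A.d (single b 1)) ∧
      f (single b 1) ∈ faceChains (A.deg b) (S b) ∧
      (A.deg b = 0 → f (single b 1) = single ∅ 1) := by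
  have hemp : (simplexComplex ι).d (single ∅ 1) = 0 := (simplexComplex ι).d_eq_zero rfl
  refine (A.exists_lift (simplexComplex ι).d (fun _ => True) (fun _ _ _ _ => trivial) (-1) 0
    (by simp) (fun b => {w | w ∈ faceChains (A.deg b) (S b) ∧ (A.deg b = 0 → w = single ∅ 1)})
    ?_).imp fun f hf b => ⟨?_, (hf b trivial).1⟩
  rotate_left
  · have := (hf b trivial).2
    rw [LinearMap.zero_apply, neg_one_smul, ← sub_eq_add_neg, sub_eq_zero] at this
    exact this
  · intro b _ f hf hd
    rcases Nat.eq_zero_or_pos (A.deg b) with h0 | h0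
    · refine ⟨single ∅ 1, ⟨single_mem_supported ℤ _ ⟨h0.symm, by simp⟩, fun _ => rfl⟩, ?_⟩
      simp [A.d_eq_zero h0, hemp]
    · obtain ⟨m, hm⟩ : ∃ m, A.deg b = m + 1 := ⟨A.deg b - 1, by omega⟩
      obtain ⟨v, hv⟩ := hne b (by omega)
      have hsub : f (A.d (single b 1)) ∈ faceChains m (S b) := by
        refine map_mem_of_support fun b' hb' => ?_
        have hdb := A.d_deg b b' hb'
        have hm' : A.deg b' = m := by omega
        have h1 := (hf b' hb').1
        rw [hm'] at h1
        intro σ hσ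
        exact ⟨(h1 hσ).1, (h1 hσ).2.trans (hface b b' hb')⟩
      have hd' : (simplexComplex ι).d (f (A.d (single b 1))) = 0 := by
        rw [LinearMap.zero_apply, neg_one_smul, zero_sub, neg_neg] at hd
        exact hd
      -- Fill the cycle `f (d b)` by coning from a vertex `v` of the carrier of `b`.
      refine ⟨addVertex v (f (A.d (single b 1))), ⟨?_, fun h => by omega⟩, ?_⟩
      · rw [hm]
        exact addVertex_mem_faceChains hv hsub
      · have := simplexComplex_cone v (f (A.d (single b 1)))
        rw [hd', map_zero, add_zero] at this
        rw [this, LinearMap.zero_apply, neg_one_smul, zero_sub, neg_neg]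

end Simplex

end ControlledAlgebra

/-! ### Cutting resolutions down to dimension `N` -/

namespace ControlledAlgebra

open Finsupp Metric

/-! ### Truncation to a finite dimensional complex -/

variable {X : Type u} [MetricSpace X]

variable (X) in
/-- There are finite open covers of order at most `N + 1` with arbitrarily small members. -/
def HasFineCovers (N : ℕ) : Prop :=
  ∀ μ > (0 : ℝ), ∃ (m : ℕ) (V : Fin m → Set X), (∀ i, IsOpen (V i)) ∧ (∀ x, ∃ i, x ∈ V i) ∧
    (∀ i, ∀ x ∈ V i, ∀ y ∈ V i, dist x y < μ) ∧ ∀ x, {i | x ∈ V i}.ncard ≤ N + 1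

namespace LocComplex

/-- Compose a chain map `i` to the nerve with a chain map `j` back, and let `h` be a homotopy from
`j ∘ i` to the identity in degrees at most `n`. Since `i` vanishes in degree `n + 1`, it kills the
boundaries of generators of that degree, and the homotopy relation on these boundaries reduces to `d
h d = d`. -/
theorem exists_partial_contraction [CompactSpace X] {A : LocComplex X} {s : ℕ → ℝ} {n : ℕ}
    (hA : A.IsResolution s (n + 1)) {R : ℕ → ℝ} (hR : ∀ j, 0 < R j) (hanti : Antitone R)
    (hfill : ∀ m ≤ n, ∀ j ≤ 2 * n + 1, A.Fill m (4 * R (j + 1)) (R j))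
    {σ l : ℝ} (hσ0 : 0 < σ) (hσ : ∀ j ≤ n, s j ≤ σ) (hσR : 2 * σ ≤ R (2 * n + 2))
    (hσl : 2 * ((n : ℝ) + 1) * σ < l)
    {ι : Type u} [LinearOrder ι] [Fintype ι] (V : ι → Set X)
    (hl : ∀ x, ∃ i, ball x l ⊆ V i)
    (hV : ∀ i, ∀ x ∈ V i, ∀ y ∈ V i, dist x y < R (2 * n + 2))
    (hord : ∀ x, {i | x ∈ V i}.ncard ≤ n) :
    ∃ h : (A.B →₀ ℤ) →ₗ[ℤ] (A.B →₀ ℤ),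
      (∀ b, A.deg b = n → h (single b 1) ∈ A.Sub (n + 1) (ball (A.loc b) (R 0))) ∧
      ∀ b, A.deg b = n + 1 → A.d (h (A.d (single b 1))) = A.d (single b 1) := by
  classical
  have hρ : ∀ j ≤ 2 * n + 2, R (2 * n + 2) ≤ R j := fun j hj => hanti hj
  -- the map to the nerve
  let S : A.B → Set ι := fun b =>
    {v | A.deg b ≠ 0 ∧ ball (A.loc b) (l - 2 * A.deg b * σ) ⊆ V v}
  have hface2 : ∀ b, ∀ b' ∈ (A.d (single b 1)).support, A.deg b' ≠ 0 →
      dist (A.loc b') (A.loc b) < 2 * σ := fun b b' hb' h => by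
    have h1 := hA.face b b' hb' h
    have h2 := A.d_deg b b' hb'
    have h3 := hσ (A.deg b') (by have := hA.deg_le b; omega)
    linarith
  -- The ball in the definition of `S` grows by `2 * σ` when the degree drops by one, so the carrier
  -- of a face lies in that of the generator. By `hσl` the radius is still positive in degree `n +
  -- 1`.
  have hSV : ∀ b, ∀ v ∈ S b, A.loc b ∈ V v := fun b v hv => hv.2 (mem_ball_self (by
    have h1 : (A.deg b : ℝ) ≤ n + 1 := by exact_mod_cast hA.deg_le b
    have : 2 * (A.deg b : ℝ) * σ ≤ 2 * ((n : ℝ) + 1) * σ := by gcongr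
    linarith))
  obtain ⟨i, hi⟩ := exists_map_simplexComplex A.toBasedComplex S (fun b hb => by
      obtain ⟨v, hv⟩ := hl (A.loc b)
      refine ⟨v, hb, (ball_subset_ball ?_).trans hv⟩
      have : 0 ≤ 2 * (A.deg b : ℝ) * σ := by positivity
      linarith) (by
      rintro b b' hb' v ⟨hv0, hv⟩
      have h2 := A.d_deg b b' hb'
      refine ⟨by omega, (ball_subset_ball' ?_).trans hv⟩
      have h3 := hface2 b b' hb' hv0
      rw [dist_comm] at h3
      have h6 : (A.deg b : ℝ) = A.deg b' + 1 := by exact_mod_cast h2.symm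
      rw [h6]
      linarith)
  -- A simplex in `i b` would have `n + 1` vertices, all of whose cover members contain the location
  -- of `b`; the order of the cover is at most `n`.
  have hi0 : ∀ b, A.deg b = n + 1 → i (single b 1) = 0 := by
    intro b hb
    rw [← support_eq_empty, Finset.eq_empty_iff_forall_notMem]
    intro τ hτ
    obtain ⟨h1, h2⟩ := (hi b).2.1 hτ
    have h3 : (τ : Set ι).ncard ≤ {i | A.loc b ∈ V i}.ncard :=
      Set.ncard_le_ncard (fun v hv => hSV b v (h2 hv)) (Set.toFinite _)
    rw [Set.ncard_coe_finset, h1] at h3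
    have := hord (A.loc b)
    have hb' : A.deg b = n + 1 := hb
    omega
  -- the map from the nerve
  let C := simplexComplex ι
  let G' : Finset ι → Prop := fun τ => τ.card ≤ n ∧ ∃ x, ∀ v ∈ τ, x ∈ V v
  have hne : ∃ y : Finset ι → X, ∀ τ, G' τ → ∀ v ∈ τ, y τ ∈ V v := by
    refine ⟨fun τ => if h : G' τ then h.2.choose else A.loc A.pt, fun τ h => ?_⟩
    simp only [dif_pos h]
    exact h.2.choose_spec
  obtain ⟨y, hy⟩ := hne
  have hG' : ∀ τ, G' τ → ∀ τ' ∈ (C.d (single τ 1)).support, G' τ' := by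
    rintro τ ⟨h1, x, hx⟩ τ' hτ'
    have := simplexComplex_face hτ'
    exact ⟨(Finset.card_le_card this).trans h1, x, fun v hv => hx v (this hv)⟩
  let α : ℕ → ℝ := fun m => R (2 * n + 1 - m)
  obtain ⟨j, hj⟩ := exists_chainMap (T := A) C G' hG' (k := n) (fun τ h => h.1) y (α := α)
    (r := fun m => 4 * R (2 * n + 1 - m)) (ρ := R (2 * n + 2)) (by
      intro τ hτ τ' hτ' h
      obtain ⟨v, hv⟩ := Finset.card_ne_zero.1 h
      exact (hV v _ (hy τ' (hG' τ hτ τ' hτ') v hv) _ (hy τ hτ v (simplexComplex_face hτ' hv))).le)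
    (fun m hm => by
      have := hρ (2 * n + 1 - m) (by omega)
      have := hR (2 * n + 1 - m)
      simp only [α]
      linarith) (fun m hm => by
      have := hfill m hm.le (2 * n + 1 - (m + 1)) (by omega)
      rwa [show 2 * n + 1 - (m + 1) + 1 = 2 * n + 1 - m by omega] at this)
  -- the homotopy
  let G : A.B → Prop := fun b => A.deg b ≤ n
  have hiG : ∀ b, G b → ∀ τ ∈ (i (single b 1)).support, G' τ := fun b hb τ hτ => by
    obtain ⟨h1, h2⟩ := (hi b).2.1 hτ
    exact ⟨h1.trans_le hb, A.loc b, fun v hv => hSV b v (h2 hv)⟩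
  have hji : ∀ b, G b → A.d (j (i (single b 1))) = j (i (A.d (single b 1))) := fun b hb => by
    have h1 := map_eq_of_support (c := i (single b 1)) (f := A.d ∘ₗ j) (g := j ∘ₗ C.d)
      fun τ hτ => (hj τ (hiG b hb τ hτ)).1
    exact h1.trans (congrArg j (hi b).1)
  obtain ⟨h, hh⟩ := exists_homotopy (T := A) A.toBasedComplex G (fun b hb b' hb' => by
      have h2 := A.d_deg b b' hb'
      change A.deg b' ≤ n
      change A.deg b ≤ n at hb
      omega) (k := n) (fun b hb => hb) A.loc (α := fun _ => R (n + 1) + R (2 * n + 2))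
    (β := fun m => R (n - m)) (r := fun m => 4 * R (n + 1 - m)) (ρ := 2 * σ)
    (fun b _ b' hb' h => (hface2 b b' hb' h).le) (fun m hm => by
      have := hρ (n + 1) (by omega)
      have := hR (n + 1)
      have : R (n + 1) ≤ R (n + 1 - m) := hanti (by omega)
      linarith) (fun m hm => by
      have := hρ (n - m) (by omega)
      have := hR (n - m)
      simp only [show n + 1 - (m + 1) = n - m by omega]
      linarith) (fun m hm => by
      have := hfill m hm (n - m) (by omega)
      rwa [show n - m + 1 = n + 1 - m by omega] at this) (j ∘ₗ i) LinearMap.id hji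
    (fun _ _ => rfl) (fun b hb => by
      refine map_mem_of_support (f := j) (c := i (single b 1)) fun τ hτ => ?_
      obtain ⟨h1, h2⟩ := (hi b).2.1 hτ
      have h3 := (hj τ (hiG b hb τ hτ)).2.1
      have h4 : C.deg τ = A.deg b := h1
      rw [h4] at h3
      by_cases h0 : A.deg b = 0
      · rw [h0] at h3 ⊢
        exact Sub_zero _ _ h3
      · refine Sub_mono (ball_subset_ball' ?_) h3
        obtain ⟨v, hv⟩ := Finset.card_ne_zero.1 (h1.trans_ne h0)
        have h5 := hV v _ (hy τ (hiG b hb τ hτ) v hv) _ (hSV b v (h2 hv))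
        have hb' : A.deg b ≤ n := hb
        have h6 : α (A.deg b) ≤ R (n + 1) := hanti (by omega)
        linarith) (fun b hb => by
      by_cases h0 : A.deg b = 0
      · rw [h0, (A.deg_eq_zero b).1 h0]
        exact A.pt_mem_Sub _
      · exact single_mem_Sub rfl (mem_ball_self (add_pos (hR _) (hR _))))
    (fun b hb => hA.mem_fixed _) (fun b hb => hA.mem_fixed _) (fun b hb h0 => by
      change j (i (single b 1)) = single b 1
      rw [(hi b).2.2 h0, (hj ∅ ⟨Nat.zero_le _, A.loc b,
        fun v hv => absurd hv (Finset.notMem_empty v)⟩).2.2.2 rfl, (A.deg_eq_zero b).1 h0])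
  refine ⟨h, fun b hb => ?_, fun b hb => ?_⟩
  · have := (hh b hb.le).2.1
    rwa [hb, Nat.sub_self] at this
  · have h1 := map_eq_of_support (c := A.d (single b 1)) (f := A.d ∘ₗ h + h ∘ₗ A.d)
      (g := LinearMap.id - j ∘ₗ i) fun b' hb' => (hh b' (by
        have h2 := A.d_deg b b' hb'
        change A.deg b' ≤ n
        omega)).1
    have h2 : i (A.d (single b 1)) = 0 := by
      rw [← (hi b).1, hi0 b hb, map_zero]
    simpa [A.d_d, h2] using h1

/-- The projection cutting off a complex above degree `n` by means of a partial contraction `h`. -/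
noncomputable def cutoff (A : LocComplex X) (n : ℕ) (h : (A.B →₀ ℤ) →ₗ[ℤ] (A.B →₀ ℤ)) :
    (A.B →₀ ℤ) →ₗ[ℤ] (A.B →₀ ℤ) :=
  linearCombination ℤ fun b => if A.deg b < n then single b 1 else
    if A.deg b = n then single b 1 - A.d (h (single b 1)) else 0

section cutoff

variable {A : LocComplex X} {n : ℕ} {h : (A.B →₀ ℤ) →ₗ[ℤ] (A.B →₀ ℤ)}

theorem cutoff_single (b : A.B) : A.cutoff n h (single b 1) =
    if A.deg b < n then single b 1 else
    if A.deg b = n then single b 1 - A.d (h (single b 1)) else 0 := by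
  rw [cutoff, linearCombination_single, one_smul]

theorem cutoff_of_lt {c : A.B →₀ ℤ} (hc : ∀ b ∈ c.support, A.deg b < n) : A.cutoff n h c = c :=
  map_eq_of_support (g := LinearMap.id) fun b hb => by
    rw [cutoff_single, if_pos (hc b hb)]
    rfl

theorem cutoff_of_eq {c : A.B →₀ ℤ} (hc : ∀ b ∈ c.support, A.deg b = n) :
    A.cutoff n h c = c - A.d (h c) :=
  map_eq_of_support (g := LinearMap.id - A.d ∘ₗ h) fun b hb => by
    rw [cutoff_single, if_neg (hc b hb).not_lt, if_pos (hc b hb)]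
    rfl

theorem cutoff_of_gt {c : A.B →₀ ℤ} (hc : ∀ b ∈ c.support, n < A.deg b) : A.cutoff n h c = 0 :=
  map_eq_of_support (g := 0) fun b hb => by
    rw [cutoff_single, if_neg (hc b hb).not_gt, if_neg (hc b hb).ne']
    rfl

theorem d_cutoff {c : A.B →₀ ℤ} (hc : ∀ b ∈ c.support, A.deg b ≤ n) :
    A.d (A.cutoff n h c) = A.d c :=
  map_eq_of_support (f := A.d ∘ₗ A.cutoff n h) fun b hb => by
    rw [LinearMap.comp_apply, cutoff_single]
    split_ifs with h1 h2
    · rfl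
    · rw [map_sub, A.d_d, sub_zero]
    · exact absurd (hc b hb) (by omega)

theorem deg_of_mem_support_d {c : A.B →₀ ℤ} {k : ℕ} (hc : ∀ b ∈ c.support, A.deg b = k + 1) :
    ∀ b ∈ (A.d c).support, A.deg b = k := by
  have : A.d c ∈ supported ℤ ℤ {b | A.deg b = k} := map_mem_of_support fun b hb b' hb' => by
    have h1 := A.d_deg b b' hb'
    have h2 := hc b hb
    change A.deg b' = k
    omega
  exact fun b hb => this hb

/-- By `d h d = d` on degree `n + 1`, the map `d h` is idempotent in degree `n`, and hence so is `1
- d h`. -/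
theorem cutoff_cutoff
    (hdeg : ∀ b, A.deg b = n → ∀ b' ∈ (h (single b 1)).support, A.deg b' = n + 1)
    (hdhd : ∀ b, A.deg b = n + 1 → A.d (h (A.d (single b 1))) = A.d (single b 1))
    (c : A.B →₀ ℤ) : A.cutoff n h (A.cutoff n h c) = A.cutoff n h c :=
  map_eq_of_support (f := A.cutoff n h ∘ₗ A.cutoff n h) fun b _ => by
    rw [LinearMap.comp_apply, cutoff_single]
    split_ifs with h1 h2
    · rw [cutoff_single, if_pos h1]
    · have h3 := deg_of_mem_support_d (hdeg b h2)
      have h4 : A.d (h (A.d (h (single b 1)))) = A.d (h (single b 1)) :=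
        map_eq_of_support (f := A.d ∘ₗ h ∘ₗ A.d) fun b' hb' => hdhd b' (hdeg b h2 b' hb')
      rw [map_sub, cutoff_of_eq h3, h4, sub_self, sub_zero, cutoff_single, if_neg h1, if_pos h2]
    · exact map_zero _

theorem deg_of_mem_support_d_cutoff {b b' : A.B}
    (hb' : b' ∈ (A.d (A.cutoff n h (single b 1))).support) :
    b' ∈ (A.d (single b 1)).support ∧ A.deg b ≤ n := by
  by_cases hb : A.deg b ≤ n
  · rw [d_cutoff fun x hx => by rwa [Finset.mem_singleton.1 (support_single_subset hx)]] at hb'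
    exact ⟨hb', hb⟩
  · rw [cutoff_single, if_neg (by omega), if_neg (by omega), map_zero] at hb'
    simp at hb'

theorem cutoff_d_cutoff (c : A.B →₀ ℤ) :
    A.cutoff n h (A.d (A.cutoff n h c)) = A.d (A.cutoff n h c) :=
  map_eq_of_support (f := A.cutoff n h ∘ₗ A.d ∘ₗ A.cutoff n h) (g := A.d ∘ₗ A.cutoff n h)
    fun b _ => cutoff_of_lt fun b' hb' => by
      obtain ⟨h1, h2⟩ := deg_of_mem_support_d_cutoff hb'
      have h3 := A.d_deg b b' h1
      omega

theorem cutoff_deg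
    (hdeg : ∀ b, A.deg b = n → ∀ b' ∈ (h (single b 1)).support, A.deg b' = n + 1) (b : A.B) :
    ∀ b' ∈ (A.cutoff n h (single b 1)).support, A.deg b' = A.deg b := by
  classical
  intro b' hb'
  rw [cutoff_single] at hb'
  split_ifs at hb' with h1 h2
  · rw [Finset.mem_singleton.1 (support_single_subset hb')]
  · rcases Finset.mem_union.1 (support_sub hb') with h3 | h3
    · rw [Finset.mem_singleton.1 (support_single_subset h3)]
    · rw [h2, deg_of_mem_support_d (hdeg b h2) b' h3]
  · simp at hb'

/-- The truncation of a complex by means of a partial contraction `h`. -/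
noncomputable abbrev truncate (A : LocComplex X) (n : ℕ) (h : (A.B →₀ ℤ) →ₗ[ℤ] (A.B →₀ ℤ))
    (hn : 0 < n)
    (hdeg : ∀ b, A.deg b = n → ∀ b' ∈ (h (single b 1)).support, A.deg b' = n + 1)
    (hdhd : ∀ b, A.deg b = n + 1 → A.d (h (A.d (single b 1))) = A.d (single b 1)) :
    LocComplex X where
  B := A.B
  deg := A.deg
  loc := A.loc
  pt := A.pt
  d := A.d ∘ₗ A.cutoff n h
  p := A.cutoff n h
  d_deg b b' hb' := A.d_deg b b' (deg_of_mem_support_d_cutoff hb').1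
  d_d c := by
    change A.d (A.cutoff n h (A.d (A.cutoff n h c))) = 0
    rw [cutoff_d_cutoff, A.d_d]
  deg_eq_zero := A.deg_eq_zero
  p_deg := cutoff_deg hdeg
  p_p := cutoff_cutoff hdeg hdhd
  d_p c := congrArg A.d (cutoff_cutoff hdeg hdhd c)
  p_d c := cutoff_d_cutoff c
  p_pt := by rw [cutoff_single, if_pos (by rwa [A.deg_pt])]

/-- Below degree `n` a filling in `A` is projected, which moves it by less than `κ`. In degree `n`
an invariant cycle `c` bounds in `A`, so `d h c = c`; invariance then gives `c = c - d h c = 0`.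
Above `n` invariant chains vanish. Thus the filling property holds in every degree. -/
theorem cutoff_fill
    (hdeg : ∀ b, A.deg b = n → ∀ b' ∈ (h (single b 1)).support, A.deg b' = n + 1)
    (hdhd : ∀ b, A.deg b = n + 1 → A.d (h (A.d (single b 1))) = A.d (single b 1))
    (hpA : ∀ c, A.p c = c) {k : ℕ} {δ ε κ : ℝ} (hfill : k ≤ n → A.Fill k δ ε)
    (hκ : ∀ b, ∀ b' ∈ (A.cutoff n h (single b 1)).support, A.deg b ≠ 0 →
      dist (A.loc b') (A.loc b) < κ)
    (x : X) (c : A.B →₀ ℤ) (hc : c ∈ A.Sub k (ball x δ)) (hp : A.cutoff n h c = c)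
    (hd : A.d c = 0) : ∃ w ∈ A.Sub (k + 1) (ball x (ε + κ)), A.cutoff n h w = w ∧
      A.d (A.cutoff n h w) = c := by
  have hdegc : ∀ b ∈ c.support, A.deg b = k := fun b hb => (hc hb).1
  rcases lt_or_ge n k with hk | hk
  · refine ⟨0, Submodule.zero_mem _, map_zero _, ?_⟩
    rw [map_zero, map_zero, ← hp, cutoff_of_gt fun b hb => by rw [hdegc b hb]; exact hk]
  obtain ⟨w, hw, -, hdw⟩ := hfill hk x c hc (hpA c) hd
  have hdegw : ∀ b ∈ w.support, A.deg b = k + 1 := fun b hb => (hw hb).1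
  rcases Nat.lt_or_eq_of_le hk with hk | rfl
  · refine ⟨A.cutoff n h w, ?_, cutoff_cutoff hdeg hdhd w, ?_⟩
    · refine map_mem_of_support fun b hb b' hb' => ?_
      have h1 := cutoff_deg hdeg b b' hb'
      have h2 := hdegw b hb
      refine ⟨h1.trans h2, Or.inr ?_⟩
      have h3 := hκ b b' hb' (by omega)
      have h4 : dist (A.loc b) x < ε := (hw hb).2.resolve_left (by omega)
      change dist (A.loc b') x < ε + κ
      linarith [dist_triangle (A.loc b') (A.loc b) x]
    · rw [cutoff_cutoff hdeg hdhd, d_cutoff fun b hb => by rw [hdegw b hb]; exact hk, hdw]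
  · have h1 : A.d (h (A.d w)) = A.d w :=
      map_eq_of_support (f := A.d ∘ₗ h ∘ₗ A.d) fun b hb => hdhd b (hdegw b hb)
    have h2 : c = 0 := by
      rw [← hp, cutoff_of_eq hdegc, ← hdw, h1, sub_self]
    exact ⟨0, Submodule.zero_mem _, map_zero _, by rw [map_zero, map_zero, h2]⟩

theorem truncate_fill (hn : 0 < n)
    (hdeg : ∀ b, A.deg b = n → ∀ b' ∈ (h (single b 1)).support, A.deg b' = n + 1)
    (hdhd : ∀ b, A.deg b = n + 1 → A.d (h (A.d (single b 1))) = A.d (single b 1))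
    (hpA : ∀ c, A.p c = c) {k : ℕ} {δ ε κ : ℝ} (hfill : k ≤ n → A.Fill k δ ε)
    (hκ : ∀ b, ∀ b' ∈ (A.cutoff n h (single b 1)).support, A.deg b ≠ 0 →
      dist (A.loc b') (A.loc b) < κ) :
    (A.truncate n h hn hdeg hdhd).Fill k δ (ε + κ) := fun x c hc hp hd =>
  cutoff_fill hdeg hdhd hpA hfill hκ x c hc hp
    ((congrArg A.d (show c = A.cutoff n h c from hp.symm)).trans hd)

end cutoff

/-- Existence of `N`-dimensional complexes with arbitrarily small control and a filling property
whose modulus depends only on the space. -/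
theorem exists_locComplex [CompactSpace X] [Nonempty X] (hX : DiscretelyLocallyContractible X)
    {N : ℕ} (hN : HasFineCovers X N) :
    ∃ Δ : ℝ → ℝ, (∀ e > 0, 0 < Δ e) ∧ ∀ E : Finset ℝ, (∀ e ∈ E, 0 < e) → ∀ κ > 0,
      ∃ T : LocComplex X, (∀ k, ∀ e ∈ E, T.Fill k (Δ e) e) ∧ (∀ b, T.deg b ≤ N + 2) ∧
        (∀ b, N + 1 < T.deg b → T.p (single b 1) = 0) ∧
        (∀ b, ∀ b' ∈ (T.d (single b 1)).support, T.deg b' ≠ 0 → dist (T.loc b') (T.loc b) < κ) ∧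
        ∀ b, ∀ b' ∈ (T.p (single b 1)).support, T.deg b ≠ 0 → dist (T.loc b') (T.loc b) < κ := by
  have hΔ : ∀ e : ℝ, ∃ δ : ℝ, 0 < e → (0 < δ ∧ ∀ s, ∀ᶠ s' in scaleFilter (N + 1) s,
      ∀ (A : LocComplex X) (K : ℕ), A.IsResolution s' K → N + 1 < K →
        ∀ m ≤ N + 1, A.Fill m δ e) := by
    intro e
    by_cases he : 0 < e
    · obtain ⟨δ, h1, h2⟩ := FillsEventually.exists_forall
        (fun m (_ : m ≤ N + 1) => fillsEventually hX m) he
      exact ⟨δ, fun _ => ⟨h1, h2⟩⟩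
    · exact ⟨0, fun h => absurd h he⟩
  choose Δ hΔ using hΔ
  have hΔ0 : ∀ e > 0, 0 < Δ e := fun e he => (hΔ e he).1
  refine ⟨fun e => Δ (e / 2), fun e he => hΔ0 _ (half_pos he), fun E hE κ hκ => ?_⟩
  -- The projection moves by less than `2 * κ₀`. This must stay below `κ`, and added to the filling
  -- radius `e / 2` it must not exceed `e`.
  obtain ⟨κ₀, hκ₀, hκ₀κ, hκ₀E⟩ : ∃ κ₀ > 0, κ₀ < κ / 2 ∧ ∀ e ∈ E, κ₀ < e / 4 := by
    have h1 : ∀ᶠ a in nhdsWithin (0 : ℝ) (Set.Ioi 0), ∀ e ∈ E, a < e / 4 :=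
      (Finset.eventually_all _).2 fun e he =>
        Filter.mem_of_superset (Ioo_mem_nhdsGT (show (0 : ℝ) < e / 4 by linarith [hE e he]))
          fun a ha => ha.2
    have h2 : ∀ᶠ a in nhdsWithin (0 : ℝ) (Set.Ioi 0), 0 < a ∧ a < κ / 2 :=
      Ioo_mem_nhdsGT (half_pos hκ)
    obtain ⟨a, ha1, ha2⟩ := (h1.and h2).exists
    exact ⟨a, ha2.1, ha2.2, ha1⟩
  -- Because of the augmentation, `n` is the shifted form of degree `N`; it also equals the
  -- permitted order of the cover.
  let n := N + 1
  let R := scaleSeq Δ κ₀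
  have hR : ∀ j, 0 < R j := scaleSeq_pos hΔ0 hκ₀
  have hanti : Antitone R := scaleSeq_antitone hΔ0 hκ₀
  obtain ⟨m, V, hVo, hVc, hVd, hVN⟩ := hN (R (2 * n + 2)) (hR _)
  obtain ⟨l, hl, hlV⟩ := lebesgue_number_lemma_of_metric isCompact_univ hVo
    (fun x _ => Set.mem_iUnion.2 (hVc x))
  have hfill : ∀ᶠ s' in scaleFilter n 0, ∀ j ∈ Finset.range (2 * n + 2), ∀ (A : LocComplex X)
      (K : ℕ), A.IsResolution s' K → n < K → ∀ m ≤ n, A.Fill m (Δ (R j)) (R j) :=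
    (Finset.eventually_all _).2 fun j _ => (hΔ (R j) (hR j)).2 _
  have hfillE : ∀ᶠ s' in scaleFilter n 0, ∀ e ∈ E, ∀ (A : LocComplex X)
      (K : ℕ), A.IsResolution s' K → n < K → ∀ m ≤ n, A.Fill m (Δ (e / 2)) (e / 2) :=
    (Finset.eventually_all _).2 fun e he => (hΔ (e / 2) (half_pos (hE e he))).2 _
  have hσ : 0 < min (R (2 * n + 2) / 2) (l / (4 * ((n : ℝ) + 1))) :=
    lt_min (half_pos (hR _)) (by positivity)
  obtain ⟨s', ⟨h1, h2⟩, h3, h4⟩ := exists_of_eventually_scaleFilter ((hfill.and hfillE).and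
    ((eventually_scaleFilter_le n _).and (eventually_scaleFilter_lt le_rfl hσ _)))
  have h5 := h4.2.trans_le (min_le_left _ _)
  have h6 := h4.2.trans_le (min_le_right _ _)
  rw [lt_div_iff₀ (by positivity)] at h6
  have hκR : R (2 * n + 2) ≤ κ₀ := hanti (Nat.zero_le _)
  -- Only the scales up to `n` are controlled by the filter and used in the resolution; the value
  -- `1` beyond them merely ensures positivity.
  let s : ℕ → ℝ := fun j => if j ≤ n then s' j else 1
  have hs : ∀ j, 0 < s j := fun j => by
    by_cases h : j ≤ n
    · simp only [s, if_pos h]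
      exact (h3 j h).1
    · simp only [s, if_neg h]
      exact one_pos
  have hss' : ∀ j ≤ n, s j = s' j := fun j hj => if_pos hj
  obtain ⟨A, hA⟩ := exists_isResolution (X := X) s hs (n + 1)
  have hA' : A.IsResolution s' (n + 1) :=
    { p_eq := hA.p_eq
      deg_le := hA.deg_le
      fill := fun j hj => by
        rw [← hss' j (Nat.le_of_lt_succ hj)]
        exact hA.fill j hj
      face := fun b b' hb' h => by
        have := A.d_deg b b' hb'
        have := hA.deg_le b
        rw [← hss' _ (show A.deg b' ≤ n by omega)]
        exact hA.face b b' hb' h }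
  obtain ⟨h, hh, hdhd⟩ := exists_partial_contraction hA' hR hanti (fun m hm j hj =>
      (h1 j (Finset.mem_range.2 (by omega)) A _ hA' n.lt_succ_self m hm).mono
        (four_mul_scaleSeq_le j) le_rfl) h4.1 (fun j hj => (h3 j hj).2) (by linarith)
    (l := l) (by nlinarith) (ι := ULift.{u} (Fin m)) (fun i => V i.down)
    (fun x => (hlV x (Set.mem_univ x)).imp' ULift.up fun i hi => hi) (fun i => hVd i.down)
    (fun x => by
      have : {i : ULift.{u} (Fin m) | x ∈ V i.down}.ncard = {i | x ∈ V i}.ncard :=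
        Set.ncard_congr (fun i _ => i.down) (fun i hi => hi)
          (fun i j _ _ hij => ULift.down_injective hij) fun i hi => ⟨ULift.up i, hi, rfl⟩
      rw [this]
      exact hVN x)
  have hdeg : ∀ b, A.deg b = n → ∀ b' ∈ (h (single b 1)).support, A.deg b' = n + 1 :=
    fun b hb b' hb' => (hh b hb hb').1
  have hface2 : ∀ b, ∀ b' ∈ (A.d (single b 1)).support, A.deg b' ≠ 0 →
      dist (A.loc b') (A.loc b) < 2 * s' n := fun b b' hb' h => by
    have h1 := hA'.face b b' hb' h
    have h2 := A.d_deg b b' hb'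
    have h3 := (h3 (A.deg b') (by have := hA.deg_le b; omega)).2
    linarith
  have hcut : ∀ b, ∀ b' ∈ (A.cutoff n h (single b 1)).support, A.deg b ≠ 0 →
      dist (A.loc b') (A.loc b) < 2 * κ₀ := by
    classical
    intro b b' hb' h0
    have h7 : ∀ b' ∈ (single b (1 : ℤ)).support, dist (A.loc b') (A.loc b) < 2 * κ₀ :=
      fun b' hb' => by
        rw [Finset.mem_singleton.1 (support_single_subset hb'), dist_self]
        linarith
    rw [cutoff_single] at hb'
    split_ifs at hb' with h8 h9
    · exact h7 b' hb'
    · rcases Finset.mem_union.1 (support_sub hb') with hb' | hb'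
      · exact h7 b' hb'
      · have hsub : A.d (h (single b 1)) ∈
            supported ℤ ℤ {b' | dist (A.loc b') (A.loc b) < 2 * κ₀} := by
          refine map_mem_of_support fun b₁ hb₁ b₂ hb₂ => ?_
          have h10 : A.deg b₁ = n + 1 := (hh b h9 hb₁).1
          have h11 : dist (A.loc b₁) (A.loc b) < κ₀ := (hh b h9 hb₁).2.resolve_left (by omega)
          have h12 := A.d_deg b₁ b₂ hb₂
          have h13 := hface2 b₁ b₂ hb₂ (by omega)
          change dist (A.loc b₂) (A.loc b) < 2 * κ₀
          linarith [dist_triangle (A.loc b₂) (A.loc b₁) (A.loc b)]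
        exact hsub hb'
    · simp at hb'
  have hn : 0 < n := N.succ_pos
  have hfill' : ∀ k, ∀ e ∈ E, (A.truncate n h hn hdeg hdhd).Fill k (Δ (e / 2)) e :=
    fun k e he => (truncate_fill hn hdeg hdhd hA.p_eq
      (fun hk => h2 e he A _ hA' n.lt_succ_self k hk) hcut).mono le_rfl (by linarith [hκ₀E e he])
  have hzero : ∀ b, N + 1 < A.deg b → A.cutoff n h (single b 1) = 0 := fun b hb => by
    rw [cutoff_single, if_neg (show ¬ A.deg b < N + 1 by omega),
      if_neg (show ¬ A.deg b = N + 1 by omega)]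
  have hd : ∀ b, ∀ b' ∈ (A.d (A.cutoff n h (single b 1))).support, A.deg b' ≠ 0 →
      dist (A.loc b') (A.loc b) < κ := fun b b' hb' h0 => by
    have := hface2 b b' (deg_of_mem_support_d_cutoff hb').1 h0
    linarith
  have hp : ∀ b, ∀ b' ∈ (A.cutoff n h (single b 1)).support, A.deg b ≠ 0 →
      dist (A.loc b') (A.loc b) < κ := fun b b' hb' h0 => by
    have := hcut b b' hb' h0
    linarith
  exact ⟨A.truncate n h hn hdeg hdhd, hfill', hA.deg_le, hzero, hd, hp⟩

end LocComplex

end ControlledAlgebra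

/-! ### Local contractibility and covering dimension of finite CW complexes -/

namespace ControlledAlgebra

open Metric Set Topology

/-! ### Induction over the cells of a finite CW complex -/

/-- A finite complex arises by adjoining closed cells one at a time, each with frontier in the
preceding closed set and open cell disjoint from it. -/
theorem cell_induction {K : Type u} [TopologicalSpace K] [T2Space K]
    [CWComplex (univ : Set K)] (hfin : RelCWComplex.Finite (univ : Set K)) {P : Set K → Prop}
    (h0 : P ∅)
    (hstep : ∀ (n : ℕ) (i : RelCWComplex.cell (univ : Set K) n) (E : Set K), IsClosed E →
      RelCWComplex.cellFrontier n i ⊆ E → Disjoint (RelCWComplex.openCell n i) E → P E →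
      P (E ∪ RelCWComplex.closedCell n i)) : P univ := by
  classical
  have key : ∀ n : ℕ, P (RelCWComplex.skeletonLT (univ : Set K) n) := by
    intro n
    induction n with
    | zero =>
      have : (RelCWComplex.skeletonLT (univ : Set K) ((0 : ℕ) : ℕ∞) : Set K) = ∅ :=
        CWComplex.skeletonLT_zero_eq_empty
      rwa [this]
    | succ n ih =>
      have hf := hfin.finite_cell n
      cases nonempty_fintype (RelCWComplex.cell (univ : Set K) n)
      have h : ∀ s : Finset (RelCWComplex.cell (univ : Set K) n),
          P (RelCWComplex.skeletonLT (univ : Set K) n ∪ ⋃ i ∈ s, RelCWComplex.closedCell n i) ∧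
          IsClosed ((RelCWComplex.skeletonLT (univ : Set K) n : Set K) ∪
            ⋃ i ∈ s, RelCWComplex.closedCell n i) := by
        intro s
        induction s using Finset.induction_on with
        | empty =>
          simp only [Finset.notMem_empty, iUnion_of_empty, iUnion_empty, union_empty]
          exact ⟨ih, (RelCWComplex.skeletonLT (univ : Set K) n).closed⟩
        | insert i s hi ihs =>
          have heq : (RelCWComplex.skeletonLT (univ : Set K) n : Set K) ∪
              ⋃ j ∈ insert i s, RelCWComplex.closedCell n j =
              ((RelCWComplex.skeletonLT (univ : Set K) n : Set K) ∪
              ⋃ j ∈ s, RelCWComplex.closedCell n j) ∪ RelCWComplex.closedCell n i := by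
            rw [Finset.set_biUnion_insert, union_comm (RelCWComplex.closedCell n i), union_assoc]
          rw [heq]
          refine ⟨hstep n i _ ihs.2 ?_ ?_ ihs.1, ihs.2.union RelCWComplex.isClosed_closedCell⟩
          · exact (RelCWComplex.cellFrontier_subset_skeletonLT n i).trans subset_union_left
          · have hd : Disjoint (RelCWComplex.openCell n i)
                (RelCWComplex.skeletonLT (univ : Set K) n : Set K) :=
              (RelCWComplex.disjoint_skeletonLT_openCell le_rfl).symm
            refine disjoint_union_right.2 ⟨hd, disjoint_iUnion₂_right.2 fun j hj => ?_⟩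
            rw [← RelCWComplex.cellFrontier_union_openCell_eq_closedCell]
            refine disjoint_union_right.2
              ⟨hd.mono_right (RelCWComplex.cellFrontier_subset_skeletonLT n j), ?_⟩
            refine RelCWComplex.disjoint_openCell_of_ne fun e => hi ?_
            obtain rfl : i = j := by simpa using e
            exact hj
      have := (h Finset.univ).1
      simp only [Finset.mem_univ, iUnion_true] at this
      rwa [RelCWComplex.skeletonLT_union_iUnion_closedCell_eq_skeletonLT_succ] at this
  obtain ⟨n, hn⟩ := Filter.eventually_atTop.1 hfin.eventually_isEmpty_cell
  have : (RelCWComplex.skeletonLT (univ : Set K) n : Set K) = univ := by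
    refine eq_univ_of_forall fun x => ?_
    have hx : x ∈ (univ : Set K) := mem_univ x
    rw [← CWComplex.union (C := (univ : Set K))] at hx
    obtain ⟨m, i, hx⟩ := mem_iUnion₂.1 hx
    have hmn : m < n := by
      by_contra hmn
      exact (hn m (not_lt.1 hmn)).false i
    exact RelCWComplex.skeletonLT_mono (by exact_mod_cast hmn)
      (RelCWComplex.closedCell_subset_skeletonLT m i hx)
  rw [← this]
  exact key n

theorem compactSpace_of_finite {K : Type u} [TopologicalSpace K] [T2Space K]
    [CWComplex (univ : Set K)] (hfin : RelCWComplex.Finite (univ : Set K)) : CompactSpace K :=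
  ⟨cell_induction hfin (P := IsCompact) isCompact_empty fun _ _ _ _ _ _ h =>
    h.union RelCWComplex.isCompact_closedCell⟩

/-! ### Continuity on compact images -/

/-- A continuous map from a compact set to a Hausdorff space is closed, so continuity on its image
can be tested after pulling back. This transfers formulas in the coordinates of a cell to the
complex. -/
theorem continuousOn_of_comp {F Y Z : Type*} [TopologicalSpace F] [TopologicalSpace Y] [T2Space Y]
    [TopologicalSpace Z] {D : Set F} (hD : IsCompact D) {Ψ : F → Y} (hΨ : ContinuousOn Ψ D)
    {A : Set Y} {g : Y → Z} (hg : ContinuousOn (g ∘ Ψ) (D ∩ Ψ ⁻¹' A)) :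
    ContinuousOn g (A ∩ Ψ '' D) := by
  rw [continuousOn_iff_isClosed] at hg ⊢
  intro t ht
  obtain ⟨u, hu, he⟩ := hg t ht
  refine ⟨Ψ '' (D ∩ u), ((hD.inter_right hu).image_of_continuousOn
    (hΨ.mono inter_subset_left)).isClosed, ?_⟩
  ext y
  constructor
  · rintro ⟨hy, hyA, v, hv, rfl⟩
    have : v ∈ (g ∘ Ψ) ⁻¹' t ∩ (D ∩ Ψ ⁻¹' A) := ⟨hy, hv, hyA⟩
    rw [he] at this
    exact ⟨⟨v, ⟨hv, this.1⟩, rfl⟩, hyA, v, hv, rfl⟩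
  · rintro ⟨⟨v, ⟨hv, hvu⟩, rfl⟩, hyA, -⟩
    have : v ∈ u ∩ (D ∩ Ψ ⁻¹' A) := ⟨hvu, hv, hyA⟩
    rw [← he] at this
    exact ⟨this.1, hyA, v, hv, rfl⟩

theorem continuousOn_inter_union_of_isClosed {Y Z : Type*} [TopologicalSpace Y]
    [TopologicalSpace Z] {A E E' : Set Y} (hE : IsClosed E) (hE' : IsClosed E') {g : Y → Z}
    (hg : ContinuousOn g (A ∩ E)) (hg' : ContinuousOn g (A ∩ E')) :
    ContinuousOn g (A ∩ (E ∪ E')) := by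
  classical
  have key : ∀ (B : Set Y), IsClosed B → ContinuousOn g (A ∩ B) → ∀ x ∈ A,
      ContinuousWithinAt g (A ∩ B) x := fun B hB hg x hxA =>
    if hx : x ∈ B then hg x ⟨hxA, hx⟩ else
      continuousWithinAt_of_notMem_closure fun h => hx
        (hB.closure_eq ▸ closure_mono inter_subset_right h)
  intro x hx
  rw [inter_union_distrib_left]
  exact (key E hE hg x hx.1).union (key E' hE' hg' x hx.1)

theorem homotopic_of_continuousOn {K L : Type*} [TopologicalSpace K] [TopologicalSpace L]
    {S : Set K} {T : Set L}
    (G : unitInterval × K → L) (hG : ContinuousOn G (univ ×ˢ S)) (hT : ∀ t, ∀ y ∈ S, G (t, y) ∈ T)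
    (f g : C(S, T)) (h0 : ∀ y : S, G (0, y) = f y) (h1 : ∀ y : S, G (1, y) = g y) :
    f.Homotopic g := by
  refine ⟨⟨⟨fun q => ⟨G (q.1, q.2), hT _ _ q.2.2⟩, ?_⟩, fun y => Subtype.ext (h0 y),
    fun y => Subtype.ext (h1 y)⟩⟩
  refine Continuous.subtype_mk ?_ _
  exact hG.comp_continuous (f := fun q : unitInterval × S => (q.1, (q.2 : K))) (by fun_prop)
    fun q => ⟨mem_univ _, q.2.2⟩

/-! ### Local contractibility of finite CW complexes -/

/-- Every point of `E` has arbitrarily small neighbourhoods `V ⊆ W` in `E` whose inclusion is null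
homotopic. -/
def LocallyContractibleOn {K : Type u} [TopologicalSpace K] (E : Set K) : Prop :=
  ∀ x ∈ E, ∀ W, IsOpen W → x ∈ W → ∃ V, IsOpen V ∧ x ∈ V ∧
    ∃ h : V ∩ E ⊆ W ∩ E, (⟨inclusion h, continuous_inclusion h⟩ :
      C((V ∩ E : Set K), (W ∩ E : Set K))).Nullhomotopic

section attach

variable {K : Type u} [TopologicalSpace K] [T2Space K] {F : Type*} [NormedAddCommGroup F]
  [NormedSpace ℝ F] [ProperSpace F] {E : Set K} {Φ : F → K}

/-- The neighbourhood is the image of a small ball around `v₀` in the open cell, contracted along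
segments in the coordinates of the cell. -/
theorem nullhomotopic_of_mem_cell (hE : IsClosed E) (hΦ : ContinuousOn Φ (closedBall 0 1))
    (hinj : InjOn Φ (ball 0 1)) (hdisj : ∀ v ∈ ball (0 : F) 1, Φ v ∉ E)
    (hsph : ∀ v ∈ sphere (0 : F) 1, Φ v ∈ E) {v₀ : F} (hv₀ : v₀ ∈ ball (0 : F) 1) {W : Set K}
    (hW : IsOpen W) (hx : Φ v₀ ∈ W) :
    ∃ V, IsOpen V ∧ Φ v₀ ∈ V ∧ ∃ h : V ∩ (E ∪ Φ '' closedBall 0 1) ⊆ W ∩ (E ∪ Φ '' closedBall 0 1),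
      (⟨inclusion h, continuous_inclusion h⟩ : C((V ∩ (E ∪ Φ '' closedBall 0 1) : Set K),
        (W ∩ (E ∪ Φ '' closedBall 0 1) : Set K))).Nullhomotopic := by
  classical
  have hball : ball (0 : F) 1 ⊆ closedBall 0 1 := ball_subset_closedBall
  have hopen : IsOpen (ball (0 : F) 1 ∩ Φ ⁻¹' W) :=
    (hΦ.mono hball).isOpen_inter_preimage isOpen_ball hW
  obtain ⟨δ, hδ, hδW⟩ := Metric.isOpen_iff.1 hopen v₀ ⟨hv₀, hx⟩
  let D : Set F := closedBall 0 1
  have hD : IsCompact D := isCompact_closedBall 0 1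
  let Z : Set K := E ∪ Φ '' (D \ ball v₀ δ)
  have hZ : IsClosed Z := hE.union ((hD.diff isOpen_ball).image_of_continuousOn
    (hΦ.mono sdiff_subset)).isClosed
  -- membership in the complement of `Z`
  have hZmem : ∀ v ∈ D, Φ v ∉ Z ↔ v ∈ ball v₀ δ := by
    intro v hv
    constructor
    · intro h
      by_contra h'
      exact h (Or.inr ⟨v, ⟨hv, h'⟩, rfl⟩)
    · rintro h (h' | ⟨w, ⟨hwD, hw⟩, hwv⟩)
      · exact hdisj v (hδW h).1 h'
      · have hw1 : w ∈ ball (0 : F) 1 := by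
          by_contra hw1
          have : w ∈ sphere (0 : F) 1 := by
            rw [mem_sphere]
            exact le_antisymm hwD (not_lt.1 hw1)
          exact hdisj v (hδW h).1 (hwv ▸ hsph w this)
        exact hw (hinj hw1 (hδW h).1 hwv ▸ h)
  have hcell : ∀ y ∈ Zᶜ ∩ (E ∪ Φ '' D), ∃ v ∈ ball v₀ δ, Φ v = y := by
    rintro y ⟨hyZ, hyE | ⟨v, hv, rfl⟩⟩
    · exact absurd (Or.inl hyE) hyZ
    · exact ⟨v, (hZmem v hv).1 hyZ, rfl⟩
  have hsubW : ∀ v ∈ ball v₀ δ, Φ v ∈ W ∩ (E ∪ Φ '' D) := fun v hv =>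
    ⟨(hδW hv).2, Or.inr ⟨v, hball (hδW hv).1, rfl⟩⟩
  have hv₀Z : Φ v₀ ∈ Zᶜ := (hZmem v₀ (hball hv₀)).2 (mem_ball_self hδ)
  let ψ : K → F := Function.invFunOn Φ (ball 0 1)
  have hψ : ∀ v ∈ ball v₀ δ, ψ (Φ v) = v := fun v hv => hinj.leftInvOn_invFunOn (hδW hv).1
  have hconv : ∀ (t : unitInterval), ∀ v ∈ ball v₀ δ,
      (1 - (t : ℝ)) • v + (t : ℝ) • v₀ ∈ ball v₀ δ := fun t v hv =>
    (convex_ball v₀ δ) hv (mem_ball_self hδ) (by linarith [t.2.2]) t.2.1 (by ring)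
  have hsub : Zᶜ ∩ (E ∪ Φ '' D) ⊆ W ∩ (E ∪ Φ '' D) := fun y hy => by
    obtain ⟨v, hv, rfl⟩ := hcell y hy
    exact hsubW v hv
  refine ⟨Zᶜ, hZ.isOpen_compl, hv₀Z, hsub, ⟨Φ v₀, hx, Or.inr ⟨v₀, hball hv₀, rfl⟩⟩, ?_⟩
  refine homotopic_of_continuousOn
    (fun q => Φ ((1 - (q.1 : ℝ)) • ψ q.2 + (q.1 : ℝ) • v₀)) ?_ ?_ _ _ ?_ ?_
  · have hc : ContinuousOn (fun q : unitInterval × F => (q.1, Φ q.2)) (univ ×ˢ D) :=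
      continuousOn_fst.prodMk (hΦ.comp continuousOn_snd fun q hq => hq.2)
    refine (continuousOn_of_comp (isCompact_univ.prod hD) hc (A := univ ×ˢ Zᶜ) ?_).mono ?_
    · have : ContinuousOn (fun q : unitInterval × F => Φ ((1 - (q.1 : ℝ)) • q.2 + (q.1 : ℝ) • v₀))
          (univ ×ˢ ball v₀ δ) :=
        hΦ.comp (by fun_prop) fun q hq => hball (hδW (hconv q.1 q.2 hq.2)).1
      refine (this.mono ?_).congr ?_
      · rintro ⟨t, v⟩ ⟨⟨-, hv⟩, -, hvZ⟩
        exact ⟨mem_univ _, (hZmem v hv).1 hvZ⟩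
      · rintro ⟨t, v⟩ ⟨⟨-, hv⟩, -, hvZ⟩
        simp only [Function.comp_apply, hψ v ((hZmem v hv).1 hvZ)]
    · rintro ⟨t, y⟩ ⟨-, hy⟩
      obtain ⟨v, hv, rfl⟩ := hcell y hy
      exact ⟨⟨mem_univ _, hy.1⟩, (t, v), ⟨mem_univ _, hball (hδW hv).1⟩, rfl⟩
  · intro t y hy
    obtain ⟨v, hv, rfl⟩ := hcell y hy
    simp only [hψ v hv]
    exact hsubW _ (hconv t v hv)
  · rintro ⟨y, hy⟩
    obtain ⟨v, hv, rfl⟩ := hcell y hy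
    simp [hψ v hv]
  · rintro ⟨y, hy⟩
    simp

/-- A neighbourhood in `E` is thickened into the cell by points that project radially into it.
Radial projection retracts the thickening to `V ∩ E`, and the given null homotopy inside `W ∩ E`
does the rest. -/
theorem nullhomotopic_of_mem_base (hE : IsClosed E) (hΦ : ContinuousOn Φ (closedBall 0 1))
    (hinj : InjOn Φ (ball 0 1)) (hdisj : ∀ v ∈ ball (0 : F) 1, Φ v ∉ E)
    (hsph : ∀ v ∈ sphere (0 : F) 1, Φ v ∈ E) (hLC : LocallyContractibleOn E) {x : K} (hxE : x ∈ E)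
    {W : Set K} (hW : IsOpen W) (hx : x ∈ W) :
    ∃ V, IsOpen V ∧ x ∈ V ∧ ∃ h : V ∩ (E ∪ Φ '' closedBall 0 1) ⊆ W ∩ (E ∪ Φ '' closedBall 0 1),
      (⟨inclusion h, continuous_inclusion h⟩ : C((V ∩ (E ∪ Φ '' closedBall 0 1) : Set K),
        (W ∩ (E ∪ Φ '' closedBall 0 1) : Set K))).Nullhomotopic := by
  classical
  obtain ⟨V, hV, hxV, hVW, hnull⟩ := hLC x hxE W hW hx
  have hball : ball (0 : F) 1 ⊆ closedBall 0 1 := ball_subset_closedBall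
  set D : Set F := closedBall 0 1 with hDdef
  have hD : IsCompact D := isCompact_closedBall 0 1
  have hDΦ : IsClosed (Φ '' D) := (hD.image_of_continuousOn hΦ).isClosed
  have hcases : ∀ v ∈ D, v ∈ ball (0 : F) 1 ∨ v ∈ sphere (0 : F) 1 := fun v hv => by
    rcases lt_or_eq_of_le (show dist v 0 ≤ 1 from hv) with h | h
    · exact Or.inl h
    · exact Or.inr h
  -- radial projection
  let γ : ℝ × F → F := fun q => (1 - q.1) • q.2 + q.1 • (‖q.2‖⁻¹ • q.2)
  have hγnorm : ∀ q : ℝ × F, q.2 ≠ 0 → ‖γ q‖ = |(1 - q.1) * ‖q.2‖ + q.1| := fun q hq => by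
    have h0 : ‖q.2‖ ≠ 0 := norm_ne_zero_iff.2 hq
    have : γ q = ((1 - q.1) + q.1 * ‖q.2‖⁻¹) • q.2 := by
      simp only [γ]
      rw [smul_smul, ← add_smul]
    rw [this, norm_smul, Real.norm_eq_abs, ← abs_of_nonneg (norm_nonneg q.2), ← abs_mul,
      abs_of_nonneg (norm_nonneg q.2)]
    congr 1
    field_simp
  have hγD : ∀ t ∈ Icc (0 : ℝ) 1, ∀ v ∈ D, v ≠ 0 → γ (t, v) ∈ D := fun t ht v hv h0 => by
    have hv1 : ‖v‖ ≤ 1 := by simpa [hDdef] using hv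
    rw [hDdef, mem_closedBall_zero_iff, hγnorm (t, v) h0, abs_of_nonneg]
    · nlinarith [ht.1, ht.2]
    · have := norm_nonneg v
      nlinarith [ht.1, ht.2]
  have hγ1 : ∀ v : F, v ≠ 0 → γ (1, v) ∈ sphere (0 : F) 1 := fun v h0 => by
    rw [mem_sphere_zero_iff_norm, hγnorm (1, v) h0]
    simp
  have hγ0 : ∀ v : F, γ (0, v) = v := fun v => by simp [γ]
  have hγs : ∀ t : ℝ, ∀ v ∈ sphere (0 : F) 1, γ (t, v) = v := fun t v hv => by
    have : ‖v‖ = 1 := by simpa using hv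
    simp [γ, this, ← add_smul]
  have hγc : ContinuousOn γ {q | q.2 ≠ 0} := by
    have : ContinuousOn (fun q : ℝ × F => ‖q.2‖⁻¹) {q | q.2 ≠ 0} :=
      ContinuousOn.inv₀ (by fun_prop) fun q hq => norm_ne_zero_iff.2 hq
    exact ContinuousOn.add (by fun_prop) (continuousOn_fst.smul (this.smul continuousOn_snd))
  let D' : Set F := {v ∈ D | 1 / 2 ≤ ‖v‖}
  have hD' : IsCompact D' :=
    hD.inter_right (isClosed_le continuous_const continuous_norm)
  have hD'0 : ∀ v ∈ D', v ≠ 0 := fun v hv h0 => by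
    have := hv.2
    rw [h0, norm_zero] at this
    norm_num at this
  have hΦγ : ContinuousOn (fun q => Φ (γ q)) (Icc (0 : ℝ) 1 ×ˢ D') :=
    hΦ.comp (hγc.mono fun q hq => hD'0 _ hq.2)
      fun q hq => hγD q.1 hq.1 q.2 hq.2.1 (hD'0 _ hq.2)
  -- Points whose radial track to the sphere ends in `V` and stays in `W`. The bound on the norm
  -- avoids the origin, where normalization is discontinuous.
  let good : Set F := {v ∈ D | 1 / 2 < ‖v‖ ∧ Φ (γ (1, v)) ∈ V ∧
    ∀ t ∈ Icc (0 : ℝ) 1, Φ (γ (t, v)) ∈ W}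
  have hgood0 : ∀ v ∈ good, v ≠ 0 := fun v hv => hD'0 v ⟨hv.1, hv.2.1.le⟩
  have hbad : IsCompact (D \ good) := by
    have h1 : IsCompact (D ∩ {v | ‖v‖ ≤ 1 / 2}) :=
      hD.inter_right (isClosed_le continuous_norm continuous_const)
    have h2 : IsCompact (D' ∩ (fun v => Φ (γ (1, v))) ⁻¹' Vᶜ) := by
      have : ContinuousOn (fun v => Φ (γ (1, v))) D' :=
        hΦγ.comp (f := fun v => ((1 : ℝ), v)) (by fun_prop) fun v hv => ⟨by simp, hv⟩
      exact hD'.of_isClosed_subset (this.preimage_isClosed_of_isClosed hD'.isClosed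
        hV.isClosed_compl) inter_subset_left
    -- Leaving `W` at some time is a closed condition on `v`, because the time interval is compact.
    have h3 : IsCompact (Prod.snd '' ((Icc (0 : ℝ) 1 ×ˢ D') ∩ (fun q => Φ (γ q)) ⁻¹' Wᶜ)) := by
      have hc : IsCompact (Icc (0 : ℝ) 1 ×ˢ D') := isCompact_Icc.prod hD'
      exact (hc.of_isClosed_subset (hΦγ.preimage_isClosed_of_isClosed hc.isClosed
        hW.isClosed_compl) inter_subset_left).image continuous_snd
    have heq : D \ good = (D ∩ {v | ‖v‖ ≤ 1 / 2}) ∪ (D' ∩ (fun v => Φ (γ (1, v))) ⁻¹' Vᶜ) ∪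
        Prod.snd '' ((Icc (0 : ℝ) 1 ×ˢ D') ∩ (fun q => Φ (γ q)) ⁻¹' Wᶜ) := by
      ext v
      constructor
      · rintro ⟨hv, hvg⟩
        by_cases hn : ‖v‖ ≤ 1 / 2
        · exact Or.inl (Or.inl ⟨hv, hn⟩)
        by_cases hv1 : Φ (γ (1, v)) ∈ V
        · by_contra hc
          refine hvg ⟨hv, not_le.1 hn, hv1, fun t ht => ?_⟩
          by_contra htW
          exact hc (Or.inr ⟨(t, v), ⟨⟨ht, hv, (not_le.1 hn).le⟩, htW⟩, rfl⟩)
        · exact Or.inl (Or.inr ⟨⟨hv, (not_le.1 hn).le⟩, hv1⟩)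
      · rintro ((⟨hv, hn⟩ | ⟨hv, hv1⟩) | ⟨⟨t, w⟩, ⟨⟨ht, hv⟩, htW⟩, rfl⟩)
        · exact ⟨hv, fun h => absurd h.2.1 (not_lt.2 hn)⟩
        · exact ⟨hv.1, fun h => hv1 h.2.2.1⟩
        · exact ⟨hv.1, fun h => htW (h.2.2.2 t ht)⟩
    rw [heq]
    exact (h1.union h2).union h3
  let Z : Set K := (E ∩ Vᶜ) ∪ Φ '' (D \ good)
  have hZ : IsClosed Z := (hE.inter hV.isClosed_compl).union
    (hbad.image_of_continuousOn (hΦ.mono sdiff_subset)).isClosed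
  have hsphgood : ∀ v ∈ sphere (0 : F) 1, Φ v ∈ V → v ∈ good := fun v hv hvV => by
    refine ⟨sphere_subset_closedBall hv, ?_, ?_, fun t _ => ?_⟩
    · rw [mem_sphere_zero_iff_norm.1 hv]; norm_num
    · rwa [hγs 1 v hv]
    · rw [hγs t v hv]
      exact (hVW ⟨hvV, hsph v hv⟩).1
  have hxZ : x ∉ Z := by
    rintro (h | ⟨v, ⟨hv, hvg⟩, rfl⟩)
    · exact h.2 hxV
    · rcases hcases v hv with h | h
      · exact hdisj v h hxE
      · exact hvg (hsphgood v h hxV)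
  have hZE : ∀ y ∈ Zᶜ, y ∈ E → y ∈ V := fun y hy hyE => by
    by_contra h
    exact hy (Or.inl ⟨hyE, h⟩)
  have hZD : ∀ v ∈ D, Φ v ∈ Zᶜ → v ∈ good := fun v hv hvZ => by
    by_contra h
    exact hvZ (Or.inr ⟨v, ⟨hv, h⟩, rfl⟩)
  let ψ : K → F := Function.invFunOn Φ (ball 0 1)
  have hψ : ∀ v ∈ ball (0 : F) 1, ψ (Φ v) = v := fun v hv => hinj.leftInvOn_invFunOn hv
  let G : unitInterval × K → K := fun q => if q.2 ∈ E then q.2 else Φ (γ (q.1, ψ q.2))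
  have hGE : ∀ t, ∀ y ∈ E, G (t, y) = y := fun t y hy => if_pos hy
  have hGD : ∀ t : unitInterval, ∀ v ∈ D, G (t, Φ v) = Φ (γ (t, v)) := fun t v hv => by
    rcases hcases v hv with h | h
    · simp only [G]
      rw [if_neg (hdisj v h), hψ v h]
    · rw [hGE t _ (hsph v h), hγs _ v h]
  have hG0 : ∀ y ∈ Zᶜ ∩ (E ∪ Φ '' D), G (0, y) = y := by
    rintro y ⟨-, hy | ⟨v, hv, rfl⟩⟩
    · exact hGE 0 y hy
    · rw [hGD 0 v hv, Set.Icc.coe_zero, hγ0]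
  have hG1 : ∀ y ∈ Zᶜ ∩ (E ∪ Φ '' D), G (1, y) ∈ V ∩ E := by
    rintro y ⟨hyZ, hy | ⟨v, hv, rfl⟩⟩
    · rw [hGE 1 y hy]
      exact ⟨hZE y hyZ hy, hy⟩
    · have hg := hZD v hv hyZ
      rw [hGD 1 v hv, Set.Icc.coe_one]
      exact ⟨hg.2.2.1, hsph _ (hγ1 v (hgood0 v hg))⟩
  have hGW : ∀ t, ∀ y ∈ Zᶜ ∩ (E ∪ Φ '' D), G (t, y) ∈ W ∩ (E ∪ Φ '' D) := by
    rintro t y ⟨hyZ, hy | ⟨v, hv, rfl⟩⟩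
    · rw [hGE t y hy]
      exact ⟨(hVW ⟨hZE y hyZ hy, hy⟩).1, Or.inl hy⟩
    · have hg := hZD v hv hyZ
      rw [hGD t v hv]
      exact ⟨hg.2.2.2 t t.2, Or.inr ⟨_, hγD t t.2 v hv (hgood0 v hg), rfl⟩⟩
  have hGc : ContinuousOn G (univ ×ˢ (Zᶜ ∩ (E ∪ Φ '' D))) := by
    have hA : ContinuousOn G ((univ ×ˢ Zᶜ) ∩ (univ ×ˢ E)) :=
      continuousOn_snd.congr fun q hq => hGE q.1 q.2 hq.2.2
    have hB : ContinuousOn G ((univ ×ˢ Zᶜ) ∩ (univ ×ˢ (Φ '' D))) := by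
      have hc : ContinuousOn (fun q : unitInterval × F => (q.1, Φ q.2)) (univ ×ˢ D) :=
        continuousOn_fst.prodMk (hΦ.comp continuousOn_snd fun q hq => hq.2)
      refine (continuousOn_of_comp (isCompact_univ.prod hD) hc (A := univ ×ˢ Zᶜ) ?_).mono ?_
      · have : ContinuousOn (fun q : unitInterval × F => Φ (γ (q.1, q.2))) (univ ×ˢ D') :=
          hΦγ.comp (f := fun q : unitInterval × F => ((q.1 : ℝ), q.2)) (by fun_prop)
            fun q hq => ⟨q.1.2, hq.2⟩
        refine (this.mono ?_).congr ?_
        · rintro ⟨t, v⟩ ⟨⟨-, hv⟩, -, hvZ⟩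
          exact ⟨mem_univ _, hv, (hZD v hv hvZ).2.1.le⟩
        · rintro ⟨t, v⟩ ⟨⟨-, hv⟩, -, hvZ⟩
          exact hGD t v hv
      · rintro ⟨t, y⟩ ⟨⟨-, hy⟩, -, v, hv, rfl⟩
        exact ⟨⟨mem_univ _, hy⟩, (t, v), ⟨mem_univ _, hv⟩, rfl⟩
    refine (continuousOn_inter_union_of_isClosed (isClosed_univ.prod hE)
      (isClosed_univ.prod hDΦ) hA hB).mono ?_
    rintro ⟨t, y⟩ ⟨-, hyZ, hy | hy⟩
    · exact ⟨⟨mem_univ _, hyZ⟩, Or.inl ⟨mem_univ _, hy⟩⟩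
    · exact ⟨⟨mem_univ _, hyZ⟩, Or.inr ⟨mem_univ _, hy⟩⟩
  have hsub : Zᶜ ∩ (E ∪ Φ '' D) ⊆ W ∩ (E ∪ Φ '' D) := fun y hy => hG0 y hy ▸ hGW 0 y hy
  have hWE : W ∩ E ⊆ W ∩ (E ∪ Φ '' D) := inter_subset_inter_right _ subset_union_left
  let ρ : C((Zᶜ ∩ (E ∪ Φ '' D) : Set K), (V ∩ E : Set K)) :=
    ⟨fun y => ⟨G (1, y), hG1 y y.2⟩, Continuous.subtype_mk
      (hGc.comp_continuous (f := fun y : (Zᶜ ∩ (E ∪ Φ '' D) : Set K) => (1, (y : K)))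
        (by fun_prop) fun y => ⟨mem_univ _, y.2⟩) _⟩
  refine ⟨Zᶜ, hZ.isOpen_compl, hxZ, hsub, ?_⟩
  obtain ⟨y, hy⟩ := (hnull.comp_left ρ).comp_right
    (⟨inclusion hWE, continuous_inclusion hWE⟩ : C((W ∩ E : Set K), (W ∩ (E ∪ Φ '' D) : Set K)))
  refine ⟨y, ContinuousMap.Homotopic.trans ?_ hy⟩
  exact homotopic_of_continuousOn G hGc hGW _ _ (fun y => hG0 y y.2) fun y => rfl

theorem LocallyContractibleOn.union_image (hE : IsClosed E)
    (hΦ : ContinuousOn Φ (closedBall 0 1)) (hinj : InjOn Φ (ball 0 1))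
    (hdisj : ∀ v ∈ ball (0 : F) 1, Φ v ∉ E) (hsph : ∀ v ∈ sphere (0 : F) 1, Φ v ∈ E)
    (hLC : LocallyContractibleOn E) : LocallyContractibleOn (E ∪ Φ '' closedBall 0 1) := by
  intro x hx W hW hxW
  by_cases hxE : x ∈ E
  · exact nullhomotopic_of_mem_base hE hΦ hinj hdisj hsph hLC hxE hW hxW
  · obtain ⟨v, hv, rfl⟩ := hx.resolve_left hxE
    refine nullhomotopic_of_mem_cell hE hΦ hinj hdisj hsph ?_ hW hxW
    rcases lt_or_eq_of_le (show dist v 0 ≤ 1 from hv) with h | h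
    · exact h
    · exact absurd (hsph v h) hxE

end attach

section cells

variable {K : Type u} [TopologicalSpace K] [CWComplex (univ : Set K)] {E : Set K} {n : ℕ}
  {i : RelCWComplex.cell (univ : Set K) n}

theorem injOn_map_ball : InjOn (RelCWComplex.map n i) (ball 0 1) := by
  have := (RelCWComplex.map n i).injOn
  rwa [RelCWComplex.source_eq] at this

theorem map_notMem_of_disjoint_openCell (h : Disjoint (RelCWComplex.openCell n i) E) :
    ∀ v ∈ ball (0 : Fin n → ℝ) 1, RelCWComplex.map n i v ∉ E :=
  fun v hv => disjoint_left.1 h (show _ ∈ RelCWComplex.map n i '' ball 0 1 from ⟨v, hv, rfl⟩)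

theorem map_mem_of_cellFrontier_subset (h : RelCWComplex.cellFrontier n i ⊆ E) :
    ∀ v ∈ sphere (0 : Fin n → ℝ) 1, RelCWComplex.map n i v ∈ E :=
  fun v hv => h (show _ ∈ RelCWComplex.map n i '' sphere 0 1 from ⟨v, hv, rfl⟩)

end cells

theorem locallyContractibleOn_univ {K : Type u} [TopologicalSpace K] [T2Space K]
    [CWComplex (univ : Set K)] (hfin : RelCWComplex.Finite (univ : Set K)) :
    LocallyContractibleOn (univ : Set K) :=
  cell_induction hfin (fun _ h => absurd h (notMem_empty _)) fun n i _ hE hf hd h =>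
    h.union_image hE (RelCWComplex.continuousOn n i) injOn_map_ball
      (map_notMem_of_disjoint_openCell hd) (map_mem_of_cellFrontier_subset hf)

/-! ### Covering dimension of finite CW complexes -/

/-- The colours are `n + 1` translates, by multiples of the diagonal vector with entries `1 / (n +
1)`, of the grid of open unit cubes, in coordinates scaled by `δ`. -/
theorem exists_coloured_cubes (n : ℕ) {δ : ℝ} (hδ : 0 < δ) :
    ∃ Q : Fin (n + 1) → (Fin n → ℤ) → Set (Fin n → ℝ), (∀ c k, IsOpen (Q c k)) ∧
      (∀ v, ∃ c k, v ∈ Q c k) ∧ (∀ c k k' v, v ∈ Q c k → v ∈ Q c k' → k = k') ∧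
      ∀ c k, ∀ v ∈ Q c k, ∀ w ∈ Q c k, dist v w < δ := by
  let s : Fin (n + 1) → (Fin n → ℝ) → Fin n → ℝ := fun c v j => v j / δ + (c : ℝ) / (n + 1)
  refine ⟨fun c k => {v | ∀ j, (k j : ℝ) < s c v j ∧ s c v j < k j + 1}, fun c k => ?_,
    fun v => ?_, fun c k k' v hv hv' => ?_, fun c k v hv w hw => ?_⟩
  · simp only [ofPred_forall]
    refine isOpen_iInter_of_finite fun j => ?_
    have hc : Continuous fun v => s c v j := by fun_prop
    exact (isOpen_lt continuous_const hc).inter (isOpen_lt hc continuous_const)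
  · suffices h : ∃ c, ∀ j, ∀ z : ℤ, s c v j ≠ z by
      obtain ⟨c, hc⟩ := h
      exact ⟨c, fun j => ⌊s c v j⌋, fun j =>
        ⟨lt_of_le_of_ne (Int.floor_le _) (hc j _).symm, Int.lt_floor_add_one _⟩⟩
    by_contra! hcon
    choose j z hz using hcon
    -- A point missed by every colour has, for each of the `n + 1` colours, one of `n` coordinates
    -- on a grid wall. Two colours share a coordinate, and then two integers differ by a number
    -- strictly between `0` and `1`.
    obtain ⟨c, c', hne, hj⟩ := Fintype.exists_ne_map_eq_of_card_lt j (by simp)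
    wlog hlt : c < c' generalizing c c'
    · exact this c' c hne.symm hj.symm (lt_of_le_of_ne (not_lt.1 hlt) hne.symm)
    have h1 := hz c
    have h2 := hz c'
    rw [← hj] at h2
    simp only [s] at h1 h2
    have hn : (0 : ℝ) < n + 1 := by positivity
    have hc : ((c : ℕ) : ℝ) < (c' : ℕ) := by exact_mod_cast hlt
    have hc' : ((c' : ℕ) : ℝ) < n + 1 := by exact_mod_cast c'.2
    have hc0 : (0 : ℝ) ≤ ((c : ℕ) : ℝ) := Nat.cast_nonneg _
    have e : ((z c' - z c : ℤ) : ℝ) = ((c' : ℕ) - (c : ℕ) : ℝ) / (n + 1) := by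
      push_cast
      rw [← h1, ← h2]
      ring
    have p1 : (0 : ℝ) < ((z c' - z c : ℤ) : ℝ) := by
      rw [e]
      exact div_pos (sub_pos.2 hc) hn
    have p2 : ((z c' - z c : ℤ) : ℝ) < 1 := by
      rw [e, div_lt_one hn]
      linarith
    have q1 : 0 < z c' - z c := by exact_mod_cast p1
    have q2 : z c' - z c < 1 := by exact_mod_cast p2
    omega
  · funext j
    have h := hv j
    have h' := hv' j
    have a1 : (k j : ℝ) < k' j + 1 := h.1.trans h'.2
    have a2 : (k' j : ℝ) < k j + 1 := h'.1.trans h.2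
    have b1 : k j < k' j + 1 := by exact_mod_cast a1
    have b2 : k' j < k j + 1 := by exact_mod_cast a2
    omega
  · rw [dist_pi_lt_iff hδ]
    intro j
    have h := hv j
    have h' := hw j
    simp only [s] at h h'
    have : |v j / δ - w j / δ| < 1 := by
      rw [abs_lt]
      constructor <;> linarith [h.1, h.2, h'.1, h'.2]
    rwa [← sub_div, abs_div, abs_of_pos hδ, div_lt_one hδ] at this

/-- Cubes smaller than a Lebesgue number are each assigned to one member of the cover, and `O i` is
the union of those assigned to `i`. A point lies in at most one cube of each colour, which bounds
the order by `n + 1`. -/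
theorem exists_refinement_of_isCompact {n m : ℕ} {C : Set (Fin n → ℝ)} (hC : IsCompact C)
    {W : Fin m → Set (Fin n → ℝ)} (hW : ∀ i, IsOpen (W i)) (hCW : C ⊆ ⋃ i, W i) :
    ∃ O : Fin m → Set (Fin n → ℝ), (∀ i, IsOpen (O i)) ∧ (∀ i, O i ⊆ W i) ∧ C ⊆ ⋃ i, O i ∧
      ∀ v, {i | v ∈ O i}.ncard ≤ n + 1 := by
  rcases isEmpty_or_nonempty (Fin m) with hm | hm
  · exact ⟨fun _ => ∅, fun _ => isOpen_empty, fun _ => empty_subset _, by simpa using hCW,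
      fun v => by simp⟩
  obtain ⟨δ, hδ, hδW⟩ := lebesgue_number_lemma_of_metric hC hW hCW
  obtain ⟨Q, hQ, hcov, huniq, hdist⟩ := exists_coloured_cubes n hδ
  have : ∀ c k, ∃ i, (Q c k ∩ C).Nonempty → Q c k ⊆ W i := by
    intro c k
    by_cases h : (Q c k ∩ C).Nonempty
    · obtain ⟨v, hv, hvC⟩ := h
      obtain ⟨i, hi⟩ := hδW v hvC
      exact ⟨i, fun _ w hw => hi (hdist c k w hw v hv)⟩
    · exact ⟨hm.some, fun h' => absurd h' h⟩
  choose a ha using this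
  refine ⟨fun i => ⋃ (c) (k) (_ : (Q c k ∩ C).Nonempty ∧ a c k = i), Q c k, fun i =>
    isOpen_iUnion fun c => isOpen_iUnion fun k => isOpen_iUnion fun _ => hQ c k, fun i => ?_,
    fun v hv => ?_, fun v => ?_⟩
  · refine iUnion_subset fun c => iUnion_subset fun k => iUnion_subset fun h => ?_
    rw [← h.2]
    exact ha c k h.1
  · obtain ⟨c, k, h⟩ := hcov v
    simp only [mem_iUnion]
    exact ⟨a c k, c, k, ⟨⟨v, h, hv⟩, rfl⟩, h⟩
  · have h : ∀ i : {i | v ∈ ⋃ (c) (k) (_ : (Q c k ∩ C).Nonempty ∧ a c k = i), Q c k},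
        ∃ c k, v ∈ Q c k ∧ a c k = i := by
      rintro ⟨i, hi⟩
      simp only [mem_ofPred_eq, mem_iUnion] at hi
      obtain ⟨c, k, h, hv⟩ := hi
      exact ⟨c, k, hv, h.2⟩
    choose col k hk hak using h
    have hinj : Function.Injective col := fun i i' h => by
      have h2 := hk i'
      rw [← h] at h2
      have := huniq _ _ _ _ (hk i) h2
      refine Subtype.ext ?_
      rw [← hak i, ← hak i', this, h]
    have := Nat.card_le_card_of_injective col hinj
    simpa using this

/-- `E` has covering dimension at most `N`: finite open covers have refinements of order at most
`N + 1`. -/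
def CoverDimLE {K : Type u} [TopologicalSpace K] (N : ℕ) (E : Set K) : Prop :=
  ∀ (m : ℕ) (U : Fin m → Set K), (∀ i, IsOpen (U i)) → E ⊆ ⋃ i, U i →
    ∃ V : Fin m → Set K, (∀ i, IsOpen (V i)) ∧ (∀ i, V i ⊆ U i) ∧ E ⊆ ⋃ i, V i ∧
      ∀ x ∈ E, {i | x ∈ V i}.ncard ≤ N + 1

theorem isClosed_setOf_lt_ncard {K : Type*} [TopologicalSpace K] {m : ℕ} {A : Fin m → Set K}
    (hA : ∀ i, IsClosed (A i)) (N : ℕ) : IsClosed {x | N < {i | x ∈ A i}.ncard} := by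
  have : {x | N < {i | x ∈ A i}.ncard} =
      ⋃ s ∈ Finset.univ.filter (fun s : Finset (Fin m) => N < s.card), ⋂ i ∈ s, A i := by
    ext x
    simp only [mem_ofPred_eq, Finset.mem_filter, Finset.mem_univ, true_and, mem_iUnion, mem_iInter,
      exists_prop]
    constructor
    · intro h
      refine ⟨(toFinite {i | x ∈ A i}).toFinset, ?_, fun i hi => by simpa using hi⟩
      rwa [← ncard_eq_toFinset_card]
    · rintro ⟨s, hs, hx⟩
      refine hs.trans_le ?_
      rw [← ncard_coe_finset]
      exact ncard_le_ncard (fun i hi => hx i hi) (toFinite _)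
  rw [this]
  exact isClosed_biUnion_finset fun s _ => isClosed_biInter fun i _ => hA i

/-- A refinement good on `E` is extended over the cell and shrunk. The closed set `Z` where its
order is still too large misses `E`, so it lies in the open cell; there the cover is refined in
Euclidean coordinates, and nothing changes off `Z`. -/
theorem CoverDimLE.union_image {K : Type u} [TopologicalSpace K] [T2Space K] [NormalSpace K]
    {E : Set K} {n N : ℕ} {Φ : (Fin n → ℝ) → K} (hE : IsClosed E)
    (hΦ : ContinuousOn Φ (closedBall 0 1)) (hinj : InjOn Φ (ball 0 1))
    (hsph : ∀ v ∈ sphere (0 : Fin n → ℝ) 1, Φ v ∈ E)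
    (hn : n ≤ N) (h : CoverDimLE N E) : CoverDimLE N (E ∪ Φ '' closedBall 0 1) := by
  intro m U hU hEU
  set D : Set (Fin n → ℝ) := closedBall 0 1 with hDdef
  have hD : IsCompact D := isCompact_closedBall 0 1
  have hcases : ∀ v ∈ D, Φ v ∉ E → v ∈ ball (0 : Fin n → ℝ) 1 := fun v hv hvE => by
    rcases lt_or_eq_of_le (show dist v 0 ≤ 1 from hv) with h | h
    · exact h
    · exact absurd (hsph v h) hvE
  have hE' : IsClosed (E ∪ Φ '' D) := hE.union (hD.image_of_continuousOn hΦ).isClosed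
  obtain ⟨V, hV, hVU, hEV, hVN⟩ := h m U hU (subset_union_left.trans hEU)
  obtain ⟨V', hV'c, hV', hV'U⟩ := exists_subset_iUnion_closure_subset (s := E ∪ Φ '' D)
    (u := fun i => V i ∪ (U i ∩ Eᶜ)) hE' (fun i => (hV i).union ((hU i).inter hE.isOpen_compl))
    (fun x _ => toFinite _) fun x hx => by
      by_cases hxE : x ∈ E
      · exact iUnion_mono (fun i => subset_union_left) (hEV hxE)
      · obtain ⟨i, hi⟩ := mem_iUnion.1 (hEU hx)
        exact mem_iUnion.2 ⟨i, Or.inr ⟨hi, hxE⟩⟩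
  have hV'i : ∀ i, V' i ⊆ U i := fun i x hx => by
    rcases hV'U i (subset_closure hx) with h | h
    · exact hVU i h
    · exact h.1
  -- Closures are used so that `Z` is closed; on `E` the closures of the shrunk sets lie in the `V
  -- i`, whose order is under control.
  let Z : Set K := (E ∪ Φ '' D) ∩ {x | N + 1 < {i | x ∈ closure (V' i)}.ncard}
  have hZ : IsClosed Z := hE'.inter (isClosed_setOf_lt_ncard (fun i => isClosed_closure) _)
  have hZE : ∀ x ∈ Z, x ∉ E := fun x hx hxE => by
    refine absurd hx.2 (not_lt.2 (le_trans (ncard_le_ncard ?_ (toFinite _)) (hVN x hxE)))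
    intro i hi
    exact (hV'U i hi).resolve_right fun h => h.2 hxE
  have hZ' : IsCompact (D ∩ Φ ⁻¹' Z) :=
    hD.of_isClosed_subset (hΦ.preimage_isClosed_of_isClosed hD.isClosed hZ) inter_subset_left
  obtain ⟨O, hO, hOW, hZO, hOn⟩ := exists_refinement_of_isCompact hZ'
    (W := fun i => ball 0 1 ∩ Φ ⁻¹' (V' i))
    (fun i => (hΦ.mono ball_subset_closedBall).isOpen_inter_preimage isOpen_ball (hV' i))
    (fun v hv => by
      obtain ⟨i, hi⟩ := mem_iUnion.1 (hV'c hv.2.1)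
      exact mem_iUnion.2 ⟨i, hcases v hv.1 (hZE _ hv.2), hi⟩)
  have hcl : ∀ i, IsClosed (Φ '' (D \ O i)) := fun i =>
    ((hD.diff (hO i)).image_of_continuousOn (hΦ.mono sdiff_subset)).isClosed
  refine ⟨fun i => V' i ∩ (Zᶜ ∪ (E ∪ Φ '' (D \ O i))ᶜ), fun i => (hV' i).inter
    (hZ.isOpen_compl.union (hE.union (hcl i)).isOpen_compl), fun i => inter_subset_left.trans
    (hV'i i), fun y hy => ?_, fun y hy => ?_⟩
  · by_cases hyZ : y ∈ Z
    · obtain ⟨v, hv, rfl⟩ := hy.resolve_left (hZE y hyZ)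
      obtain ⟨i, hi⟩ := mem_iUnion.1 (hZO ⟨hv, hyZ⟩)
      refine mem_iUnion.2 ⟨i, (hOW i hi).2, Or.inr ?_⟩
      rintro (h | ⟨w, ⟨hw, hwO⟩, hwv⟩)
      · exact hZE _ hyZ h
      · have := hinj (hcases w hw (hwv ▸ hZE _ hyZ)) (hOW i hi).1 hwv
        exact hwO (this ▸ hi)
    · obtain ⟨i, hi⟩ := mem_iUnion.1 (hV'c hy)
      exact mem_iUnion.2 ⟨i, hi, Or.inl hyZ⟩
  · by_cases hyZ : y ∈ Z
    · obtain ⟨v, hv, rfl⟩ := hy.resolve_left (hZE y hyZ)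
      refine (ncard_le_ncard ?_ (toFinite _)).trans ((hOn v).trans (by omega))
      rintro i ⟨-, h | h⟩
      · exact absurd hyZ h
      · by_contra hvO
        exact h (Or.inr ⟨v, ⟨hv, hvO⟩, rfl⟩)
    · have : ¬ N + 1 < {i | y ∈ closure (V' i)}.ncard := fun h => hyZ ⟨hy, h⟩
      refine (ncard_le_ncard ?_ (toFinite _)).trans (not_lt.1 this)
      rintro i ⟨h, -⟩
      exact subset_closure h

theorem coverDimLE_univ {K : Type u} [TopologicalSpace K] [T2Space K]
    [CWComplex (univ : Set K)] (hfin : RelCWComplex.Finite (univ : Set K)) {N : ℕ}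
    (hN : ∀ n, N < n → IsEmpty (RelCWComplex.cell (univ : Set K) n)) :
    CoverDimLE N (univ : Set K) := by
  have := compactSpace_of_finite hfin
  refine cell_induction hfin (fun m U _ _ => ⟨fun _ => ∅, fun _ => isOpen_empty, fun _ =>
    empty_subset _, empty_subset _, fun x hx => absurd hx (notMem_empty _)⟩)
    fun n i _ hE hf _ h => ?_
  refine h.union_image hE (RelCWComplex.continuousOn n i) injOn_map_ball
    (map_mem_of_cellFrontier_subset hf) ?_
  by_contra hn
  exact (hN n (not_le.1 hn)).false i

end ControlledAlgebra

/-! ### What controlled domination says about the dominated space -/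

namespace ControlledAlgebra

open Metric Set Topology

/-! ### Consequences of controlled domination -/

theorem exists_subdivision {ω : ℝ} (hω : 0 < ω) : ∃ (M : ℕ) (τ : ℕ → unitInterval), τ 0 = 0 ∧
    τ M = 1 ∧ ∀ j, dist (τ j) (τ (j + 1)) < ω := by
  obtain ⟨M, hM⟩ := exists_nat_gt ω⁻¹
  have hM0 : (0 : ℝ) < M := (inv_pos.2 hω).trans hM
  have hMω : 1 / (M : ℝ) < ω := by
    rw [one_div]
    exact inv_lt_of_inv_lt₀ hω hM
  refine ⟨M, fun j => projIcc 0 1 zero_le_one ((j : ℝ) / M), by simp,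
    by simp [div_self hM0.ne'], fun j => lt_of_le_of_lt ?_ hMω⟩
  refine (abs_projIcc_sub_projIcc zero_le_one).trans (le_of_eq ?_)
  rw [← sub_div, abs_div, abs_of_pos hM0]
  simp

theorem exists_pos_forall_mem_lt {ι : Type*} (t : Finset ι) {f : ι → ℝ} (hf : ∀ i ∈ t, 0 < f i) :
    ∃ δ > 0, ∀ i ∈ t, δ < f i := by
  have : ∀ᶠ δ in 𝓝[>] (0 : ℝ), ∀ i ∈ t, δ < f i :=
    (Filter.eventually_all_finset t).2 fun i hi =>
      nhdsWithin_le_nhds (eventually_lt_nhds (hf i hi))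
  obtain ⟨δ, h, h0⟩ := (this.and self_mem_nhdsWithin).exists
  exact ⟨δ, h0, h⟩

section domination

variable {X : Type u} [MetricSpace X] [CompactSpace X] {N : ℕ}

theorem dist_track_le {K : Type u} [TopologicalSpace K] {i : C(X, K)} {p : C(K, X)}
    {H : ContinuousMap.Homotopy (p.comp i) (ContinuousMap.id X)} {x : X} {ε : ℝ}
    (h : diam (range fun t : unitInterval => H (t, x)) ≤ ε) (t : unitInterval) :
    dist (H (t, x)) x ≤ ε := by
  refine le_trans ?_ h
  have := dist_le_diam_of_mem (s := range fun t : unitInterval => H (t, x))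
    isBounded_of_compactSpace ⟨t, rfl⟩ ⟨1, rfl⟩
  simpa using this

theorem dist_apply_le {K : Type u} [TopologicalSpace K] {i : C(X, K)} {p : C(K, X)}
    {H : ContinuousMap.Homotopy (p.comp i) (ContinuousMap.id X)} {x : X} {ε : ℝ}
    (h : diam (range fun t : unitInterval => H (t, x)) ≤ ε) : dist (p (i x)) x ≤ ε := by
  simpa using dist_track_le h 0

/-- Pull back along `i` a refinement of the cover of `K` by preimages of small balls under `p`. As
`p ∘ i` is close to the identity, its members are small. -/
theorem IsControlledDominated.hasFineCovers (h : IsControlledDominated N X) :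
    HasFineCovers X N := by
  intro μ hμ
  obtain ⟨K, _, _, _, hfin, hN, i, p, H, hH⟩ := h (μ / 4) (by positivity)
  obtain ⟨t, -, ht, hcov⟩ := finite_cover_balls_of_compact (isCompact_univ (X := X))
    (show 0 < μ / 8 by positivity)
  let e := ht.toFinset.equivFin
  obtain ⟨V, hV, hVU, hVc, hVN⟩ := coverDimLE_univ hfin hN _
    (fun j => p ⁻¹' ball (e.symm j : X) (μ / 8)) (fun j => isOpen_ball.preimage p.continuous)
    (fun y _ => by
      obtain ⟨x, hx, hy⟩ := mem_iUnion₂.1 (hcov (mem_univ (p y)))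
      exact mem_iUnion.2 ⟨e ⟨x, ht.mem_toFinset.2 hx⟩, by simpa using hy⟩)
  refine ⟨_, fun j => i ⁻¹' V j, fun j => (hV j).preimage i.continuous, fun x =>
    by simpa using hVc (mem_univ (i x)), fun j x hx y hy => ?_, fun x => hVN (i x) (mem_univ _)⟩
  have h1 := dist_apply_le (hH x)
  have h2 := dist_apply_le (hH y)
  have h3 : dist (p (i x)) _ < μ / 8 := hVU j hx
  have h4 : dist (p (i y)) _ < μ / 8 := hVU j hy
  have h5 := dist_triangle_right (p (i x)) (p (i y)) (e.symm j : X)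
  have h6 := dist_triangle4 x (p (i x)) (p (i y)) y
  rw [dist_comm x (p (i x))] at h6
  linarith

/-- Move along the reversed domination homotopy to `p ∘ i`, then contract in `K` near `i x₀` and
apply `p`. -/
theorem IsControlledDominated.exists_contraction (h : IsControlledDominated N X) {ε : ℝ}
    (hε : 0 < ε) (x₀ : X) : ∃ r > 0, r ≤ ε ∧ ∃ (z : X) (c : ContinuousMap.Homotopy
      (⟨Subtype.val, continuous_subtype_val⟩ : C(closedBall x₀ r, X)) (ContinuousMap.const _ z)),
      ∀ t y, dist (c (t, y)) x₀ < ε := by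
  obtain ⟨K, _, _, _, hfin, -, i, p, H, hH⟩ := h (ε / 4) (by positivity)
  have hx₀ := dist_apply_le (hH x₀)
  obtain ⟨V, hV, hxV, hVW, w, ⟨F⟩⟩ := locallyContractibleOn_univ hfin (i x₀) (mem_univ _)
    (p ⁻¹' ball (p (i x₀)) (ε / 4)) (isOpen_ball.preimage p.continuous)
    (mem_ball_self (by positivity))
  obtain ⟨r, hr, hrV⟩ := nhds_basis_closedBall.mem_iff.1
    (((hV.preimage i.continuous).inter isOpen_ball).mem_nhds
      (show x₀ ∈ i ⁻¹' V ∩ ball x₀ (ε / 4) from ⟨hxV, mem_ball_self (by positivity)⟩))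
  have hrε : min r ε ≤ r := min_le_left _ _
  have hB : closedBall x₀ (min r ε) ⊆ i ⁻¹' V ∩ ball x₀ (ε / 4) :=
    (closedBall_subset_closedBall hrε).trans hrV
  let j : C(closedBall x₀ (min r ε), X) := ⟨Subtype.val, continuous_subtype_val⟩
  let h₁ : ContinuousMap.Homotopy j ((p.comp i).comp j) :=
    { toFun := fun q => H (unitInterval.symm q.1, q.2)
      continuous_toFun := by fun_prop
      map_zero_left := fun y => by simp [j]
      map_one_left := fun y => by simp [j] }
  let i' : C(closedBall x₀ (min r ε), (V ∩ univ : Set K)) :=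
    ⟨fun y => ⟨i y, (hB y.2).1, mem_univ _⟩, by fun_prop⟩
  let h₂ : ContinuousMap.Homotopy ((p.comp i).comp j) (ContinuousMap.const _ (p w)) :=
    { toFun := fun q => p (F (q.1, i' q.2))
      continuous_toFun := by fun_prop
      map_zero_left := fun y => by simp [j, i']
      map_one_left := fun y => by simp }
  refine ⟨min r ε, lt_min hr hε, min_le_right _ _, p w, h₁.trans h₂, fun t y => ?_⟩
  have hy : dist (y : X) x₀ < ε / 4 := (hB y.2).2
  have e₁ : ∀ s, dist (h₁ (s, y)) x₀ < ε := fun s => by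
    have h3 : dist (h₁ (s, y)) (y : X) ≤ ε / 4 := dist_track_le (hH y) _
    have := dist_triangle (h₁ (s, y)) (y : X) x₀
    linarith
  have e₂ : ∀ s, dist (h₂ (s, y)) x₀ < ε := fun s => by
    have h3 : dist (h₂ (s, y)) (p (i x₀)) < ε / 4 := (F (s, i' y)).2.1
    have := dist_triangle (h₂ (s, y)) (p (i x₀)) x₀
    linarith
  rw [ContinuousMap.Homotopy.trans_apply]
  split_ifs
  · exact e₁ _
  · exact e₂ _

/-- Finitely many contractions of balls suffice by compactness; each is uniformly continuous on a
compact set and is sampled along a fine subdivision of the interval. The radius `δ` depends only on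
the cover, so it is independent of `η`. -/
theorem IsControlledDominated.discretelyLocallyContractible (h : IsControlledDominated N X) :
    DiscretelyLocallyContractible X := by
  classical
  intro ε hε
  choose r hr hrε z c hc using h.exists_contraction (half_pos hε)
  obtain ⟨t, -, ht⟩ := (isCompact_univ (X := X)).elim_nhds_subcover
    (fun x => ball x (r x / 2)) (fun x _ => ball_mem_nhds x (half_pos (hr x)))
  obtain ⟨δ, hδ, hδt⟩ := exists_pos_forall_mem_lt t (f := fun x => r x / 2)
    (fun x _ => half_pos (hr x))
  refine ⟨δ, hδ, fun η hη => ?_⟩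
  have hu : ∀ x, ∃ θ > 0, ∀ p q : unitInterval × closedBall x (r x), dist p q < θ →
      dist (c x p) (c x q) < η := fun x =>
    Metric.uniformContinuous_iff.1
      (CompactSpace.uniformContinuous_of_continuous (c x).continuous) η hη
  choose θ hθ hθc using hu
  obtain ⟨η', hη', hη't⟩ := exists_pos_forall_mem_lt t (fun x _ => hθ x)
  refine ⟨η', hη', fun x => ?_⟩
  obtain ⟨x₀, hx₀, hx⟩ := mem_iUnion₂.1 (ht (mem_univ x))
  have hx : dist x x₀ < r x₀ / 2 := hx
  have hsub : ball x δ ⊆ closedBall x₀ (r x₀) := fun y hy => by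
    have h1 : dist y x < δ := hy
    have h2 := hδt x₀ hx₀
    have := dist_triangle y x x₀
    rw [mem_closedBall]
    linarith
  obtain ⟨M, τ, hτ0, hτM, hτ⟩ := exists_subdivision (hθ x₀)
  let C : ℕ → X → X := fun j y =>
    if hy : y ∈ closedBall x₀ (r x₀) then c x₀ (τ j, ⟨y, hy⟩) else y
  have hC : ∀ j y (hy : y ∈ ball x δ), C j y = c x₀ (τ j, ⟨y, hsub hy⟩) :=
    fun j y hy => dif_pos (hsub hy)
  refine ⟨M, C, fun y hy => ?_, fun y hy j _ => ?_, fun y hy j _ => ?_, fun y hy => ?_,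
    fun y hy y' hy' hyy j _ => ?_⟩
  · rw [hC 0 y hy, hτ0]
    simp
  · rw [hC j y hy]
    have h1 := hc x₀ (τ j) ⟨y, hsub hy⟩
    have h2 := hrε x₀
    have := dist_triangle_right (c x₀ (τ j, ⟨y, hsub hy⟩)) x x₀
    linarith
  · rw [hC j y hy, hC _ y hy]
    refine hθc x₀ _ _ ?_
    rw [Prod.dist_eq]
    exact max_lt (hτ j) (by simpa using hθ x₀)
  · rw [hC M y hy, hC M x (mem_ball_self hδ), hτM]
    simp
  · rw [hC j y hy, hC j y' hy']
    refine hθc x₀ _ _ ?_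
    rw [Prod.dist_eq]
    exact max_lt (by simpa using hθ x₀) (hyy.trans (hη't x₀ hx₀))

end domination

end ControlledAlgebra

/-! ### From located complexes to complexes over the idempotent completion -/

namespace ControlledAlgebra

open Finsupp

/-! ### Controlled morphisms described by linear maps -/

/-- A basis of an object of the controlled category, collected over all points. -/
structure Frame {Z : Type u} [MetricSpace Z] (M : CtrlObj Z) (B : Type*) where
  /-- the position of a basis element -/
  loc : B → Z
  /-- the basis elements at a point -/
  e : ∀ z, Fin (M.rank z) ≃ {b // loc b = z}

section Frame

variable {X : Type u} [MetricSpace X]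

/-- The object with a given finite basis. -/
noncomputable def CtrlObj.ofLoc {B : Type*} [Finite B] (loc : B → X) : CtrlObj X where
  rank z := Nat.card {b // loc b = z}
  locallyFinite z := by
    refine ⟨Set.univ, isOpen_univ, Set.mem_univ z, (Set.finite_range loc).subset ?_⟩
    rintro y ⟨-, hy⟩
    obtain ⟨⟨b, hb⟩⟩ := (Nat.card_pos_iff.1 (Nat.pos_of_ne_zero hy)).1
    exact ⟨b, hb⟩

/-- The tautological frame of `CtrlObj.ofLoc`. -/
noncomputable def Frame.ofLoc {B : Type*} [Finite B] (loc : B → X) :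
    Frame (CtrlObj.ofLoc loc) B where
  loc := loc
  e z := (Finite.equivFin {b // loc b = z}).symm

/-- The frame of the trivial object in degree `0`. -/
noncomputable def Frame.trivial (x : X) : Frame (trivialObj x 0) PUnit.{1} where
  loc _ := x
  e z := by
    classical
    by_cases h : x = z
    · subst h
      exact (finCongr (by simp [trivialObj])).trans
        (Equiv.ofUnique (Fin 1) PUnit |>.trans (Equiv.subtypeUnivEquiv fun _ => rfl).symm)
    · have h' : (trivialObj x 0).rank z = 0 := by simp [trivialObj, Ne.symm h]
      have : IsEmpty (Fin ((trivialObj x 0).rank z)) := by rw [h']; infer_instance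
      have : IsEmpty {b : PUnit.{1} // x = z} := ⟨fun q => h q.2⟩
      exact Equiv.equivOfIsEmpty _ _

variable {M M' M'' : CtrlObj X} {B B' B'' : Type*}

namespace Frame

theorem exists_ne_zero_of_matrix_ne_zero {F : Frame M B} {F' : Frame M' B'}
    {f : (B →₀ ℤ) →ₗ[ℤ] (B' →₀ ℤ)} {z' z : X}
    (h : (Matrix.of fun (i : Fin (M'.rank z')) (j : Fin (M.rank z)) =>
      f (single (F.e z j : B) 1) (F'.e z' i)) ≠ 0) :
    ∃ b b', F.loc b = z ∧ F'.loc b' = z' ∧ f (single b 1) b' ≠ 0 := by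
  by_contra! hc
  exact h (by ext i j; exact hc _ _ (F.e z j).2 (F'.e z' i).2)

theorem sum_fibres (F : Frame M B) [Fintype B] (s : Finset X) (hs : ∀ b, F.loc b ∈ s) (w : B → ℤ) :
    ∑ z ∈ s, ∑ j : Fin (M.rank z), w (F.e z j) = ∑ b, w b := by
  classical
  rw [← Finset.sum_fiberwise_of_maps_to (s := Finset.univ) (t := s) (g := F.loc)
    fun b _ => hs b]
  refine Finset.sum_congr rfl fun z _ => ?_
  rw [Equiv.sum_comp (F.e z) (fun q => w q)]
  exact (Finset.sum_subtype _ (by simp) w).symm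

variable [CompactSpace X] [Finite B] [Finite B'] [Finite B'']

/-- The morphism given by a linear map. -/
noncomputable def hom (F : Frame M B) (F' : Frame M' B') (f : (B →₀ ℤ) →ₗ[ℤ] (B' →₀ ℤ)) :
    M ⟶ M' :=
  ({ mat := fun z' z => Matrix.of fun i j => f (single (F.e z j : B) 1) (F'.e z' i)
     -- Bounded control is automatic because `X` is compact; finer estimates are made on supports.
     controlled := ⟨Metric.diam (Set.univ : Set X) + 1,
       add_pos_of_nonneg_of_pos Metric.diam_nonneg one_pos, fun z' z _ =>
        (Metric.dist_le_diam_of_mem Metric.isBounded_of_compactSpace (Set.mem_univ _)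
          (Set.mem_univ _)).trans (by linarith)⟩
     rowFinite := fun z' => (Set.finite_range F.loc).subset fun z h => by
       obtain ⟨b, -, hb, -⟩ := exists_ne_zero_of_matrix_ne_zero h
       exact ⟨b, hb⟩
     colFinite := fun z => (Set.finite_range F'.loc).subset fun z' h => by
       obtain ⟨-, b', -, hb', -⟩ := exists_ne_zero_of_matrix_ne_zero h
       exact ⟨b', hb'⟩ } : CtrlHom M M')

variable (F : Frame M B) (F' : Frame M' B') (F'' : Frame M'' B'')

variable {F F'} in
theorem exists_of_mem_supp {f : (B →₀ ℤ) →ₗ[ℤ] (B' →₀ ℤ)} {z' z : X}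
    (h : (z', z) ∈ supp (F.hom F' f)) :
    ∃ b b', F.loc b = z ∧ F'.loc b' = z' ∧ b' ∈ (f (single b 1)).support := by
  obtain ⟨b, b', hb, hb', h⟩ := exists_ne_zero_of_matrix_ne_zero (F := F) (F' := F') (f := f) h
  exact ⟨b, b', hb, hb', Finsupp.mem_support_iff.2 h⟩

theorem hom_add (f g : (B →₀ ℤ) →ₗ[ℤ] (B' →₀ ℤ)) :
    F.hom F' (f + g) = F.hom F' f + F.hom F' g := by
  refine CtrlHom.ext ?_
  funext z' z
  ext i j
  rfl

theorem hom_zero : F.hom F' (0 : (B →₀ ℤ) →ₗ[ℤ] (B' →₀ ℤ)) = 0 := by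
  have := F.hom_add F' 0 0
  simpa using this

/-- Both sides are the same sum over the basis of the middle object; the matrix product groups it by
positions. -/
theorem hom_comp (f : (B →₀ ℤ) →ₗ[ℤ] (B' →₀ ℤ)) (g : (B' →₀ ℤ) →ₗ[ℤ] (B'' →₀ ℤ)) :
    F.hom F' f ≫ F'.hom F'' g = F.hom F'' (g ∘ₗ f) := by
  classical
  cases nonempty_fintype B'
  refine CtrlHom.ext ?_
  funext z'' z
  refine (CtrlHom.compMat_eq_sum_col _ _ z'' z (Finset.univ.image F'.loc) fun z' h => ?_).trans ?_
  · obtain ⟨-, b', -, hb', -⟩ := exists_ne_zero_of_matrix_ne_zero h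
    exact Finset.mem_image.2 ⟨b', Finset.mem_univ _, hb'⟩
  · ext i j
    rw [Matrix.sum_apply]
    simp only [Matrix.mul_apply]
    refine (F'.sum_fibres _ (fun b => Finset.mem_image_of_mem _ (Finset.mem_univ b))
      fun b' => g (single b' 1) (F''.e z'' i) * f (single (F.e z j : B) 1) b').trans ?_
    change _ = g (f (single (F.e z j : B) 1)) (F''.e z'' i)
    generalize f (single (F.e z j : B) 1) = c
    have hc : c = ∑ b', c b' • single b' (1 : ℤ) := by
      conv_lhs => rw [← c.sum_single, Finsupp.sum_fintype _ _ (by simp)]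
      exact Finset.sum_congr rfl fun b' _ => by simp
    conv_rhs => rw [hc]
    rw [map_sum, Finsupp.finsetSum_apply]
    refine Finset.sum_congr rfl fun b' _ => ?_
    rw [map_smul, Finsupp.smul_apply, smul_eq_mul, mul_comm]

theorem hom_id : F.hom F LinearMap.id = 𝟙 M := by
  classical
  refine CtrlHom.ext ?_
  funext z' z
  ext i j
  change single (F.e z j : B) (1 : ℤ) (F.e z' i) = if z' = z ∧ (i : ℕ) = (j : ℕ) then 1 else 0
  rw [Finsupp.single_apply]
  refine if_congr ⟨fun h => ?_, ?_⟩ rfl rfl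
  · have hz : z' = z := by rw [← (F.e z' i).2, ← (F.e z j).2, h]
    subst hz
    rw [(F.e z').injective (Subtype.ext h)]
    exact ⟨rfl, rfl⟩
  · rintro ⟨rfl, h⟩
    rw [Fin.ext h]

end Frame

end Frame

section karoubi

variable {C : Type*} [Category* C] [Preadditive C] {P Q : Idempotents.Karoubi C}

theorem karoubi_add_f (f g : P ⟶ Q) : (f + g).f = f.f + g.f := rfl

theorem karoubi_zero_f : (0 : P ⟶ Q).f = 0 := rfl

end karoubi

/-! ### The chain complex over the idempotent completion defined by a located complex -/

namespace LocComplex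

variable {X : Type u} (T : LocComplex X)

/-- A linear map which is compatible with the projection and raises degrees by `n - m`. -/
structure IsHomog (m n : ℕ) (f : (T.B →₀ ℤ) →ₗ[ℤ] (T.B →₀ ℤ)) : Prop where
  p_f : T.p ∘ₗ f = f
  f_p : f ∘ₗ T.p = f
  deg : ∀ b, ∀ b' ∈ (f (single b 1)).support, T.deg b' + m = T.deg b + n

theorem isHomog_d : T.IsHomog 1 0 T.d where
  p_f := LinearMap.ext T.p_d
  f_p := LinearMap.ext T.d_p
  deg := T.d_deg

theorem isHomog_p : T.IsHomog 0 0 T.p where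
  p_f := LinearMap.ext T.p_p
  f_p := LinearMap.ext T.p_p
  deg := T.p_deg

/-- An endomorphism of a located complex. -/
structure IsChainMap (f : (T.B →₀ ℤ) →ₗ[ℤ] (T.B →₀ ℤ)) : Prop extends T.IsHomog 0 0 f where
  d_f : T.d ∘ₗ f = f ∘ₗ T.d
  f_pt : f (single T.pt 1) = single T.pt 1

/-- A chain homotopy between two endomorphisms of a located complex. -/
structure IsChainHomotopy (f g h : (T.B →₀ ℤ) →ₗ[ℤ] (T.B →₀ ℤ)) : Prop
    extends T.IsHomog 0 1 h where
  comm : T.d ∘ₗ h + h ∘ₗ T.d + g = f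
  h_pt : h (single T.pt 1) = 0

theorem isChainMap_p : T.IsChainMap T.p where
  toIsHomog := T.isHomog_p
  d_f := LinearMap.ext fun c => (T.d_p c).trans (T.p_d c).symm
  f_pt := T.p_pt

open scoped Classical in
/-- The component of the projection in degree `i`. -/
noncomputable def q (i : ℕ) : (T.B →₀ ℤ) →ₗ[ℤ] (T.B →₀ ℤ) :=
  linearCombination ℤ fun b => if T.deg b = i + 1 then T.p (single b 1) else 0

variable {T}

theorem q_of_deg {i : ℕ} {c : T.B →₀ ℤ} (h : ∀ b ∈ c.support, T.deg b = i + 1) :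
    T.q i c = T.p c :=
  map_eq_of_support fun b hb => by simp [q, h b hb]

theorem q_of_deg_ne {i : ℕ} {c : T.B →₀ ℤ} (h : ∀ b ∈ c.support, T.deg b ≠ i + 1) :
    T.q i c = 0 :=
  map_eq_of_support (g := 0) fun b hb => by simp [q, h b hb]

theorem q_single_of_deg {i : ℕ} {b : T.B} (h : T.deg b = i + 1) :
    T.q i (single b 1) = T.p (single b 1) := by simp [q, h]

theorem q_single_of_deg_ne {i : ℕ} {b : T.B} (h : T.deg b ≠ i + 1) :
    T.q i (single b 1) = 0 := by simp [q, h]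

theorem comp_q_congr {V : Type*} [AddCommGroup V] {i : ℕ} {f g : (T.B →₀ ℤ) →ₗ[ℤ] V}
    (h : ∀ b, T.deg b = i + 1 → f (T.p (single b 1)) = g (T.p (single b 1))) :
    f ∘ₗ T.q i = g ∘ₗ T.q i := by
  refine LinearMap.ext fun c => map_eq_of_support fun b _ => ?_
  by_cases hb : T.deg b = i + 1
  · simp [q_single_of_deg hb, h b hb]
  · simp [q_single_of_deg_ne hb]

theorem q_comp_q (i : ℕ) : T.q i ∘ₗ T.q i = T.q i :=
  comp_q_congr (g := LinearMap.id) fun b hb => by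
    rw [q_of_deg fun b' hb' => (T.p_deg b b' hb').trans hb, T.p_p, LinearMap.id_apply]

/-- A homogeneous map absorbs `p` on both sides, so once the degrees match the outer projection is
redundant. -/
theorem IsHomog.q_comp {m n i j : ℕ} {f : (T.B →₀ ℤ) →ₗ[ℤ] (T.B →₀ ℤ)} (hf : T.IsHomog m n f)
    (hij : j + m = i + n) : T.q j ∘ₗ f ∘ₗ T.q i = f ∘ₗ T.q i := by
  rw [← LinearMap.comp_assoc]
  refine comp_q_congr fun b hb => ?_
  have e : f (T.p (single b 1)) = f (single b 1) := LinearMap.congr_fun hf.f_p _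
  rw [LinearMap.comp_apply, e, q_of_deg fun b' hb' => ?_]
  · exact LinearMap.congr_fun hf.p_f _
  · have := hf.deg b b' hb'
    omega

theorem IsHomog.q_comp_of_ne {m n i j : ℕ} {f : (T.B →₀ ℤ) →ₗ[ℤ] (T.B →₀ ℤ)}
    (hf : T.IsHomog m n f) (hij : j + m ≠ i + n) : T.q j ∘ₗ f ∘ₗ T.q i = 0 := by
  rw [← LinearMap.comp_assoc, ← LinearMap.zero_comp (T.q i)]
  refine comp_q_congr fun b hb => ?_
  have e : f (T.p (single b 1)) = f (single b 1) := LinearMap.congr_fun hf.f_p _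
  rw [LinearMap.comp_apply, e, q_of_deg_ne fun b' hb' => ?_]
  · simp
  · have := hf.deg b b' hb'
    omega

theorem IsHomog.mem_support {m n i : ℕ} {f : (T.B →₀ ℤ) →ₗ[ℤ] (T.B →₀ ℤ)}
    (hf : T.IsHomog m n f) {b b' : T.B} (h : b' ∈ (f (T.q i (single b 1))).support) :
    T.deg b = i + 1 ∧ b' ∈ (f (single b 1)).support := by
  by_cases hb : T.deg b = i + 1
  · rw [q_single_of_deg hb, ← LinearMap.comp_apply, hf.f_p] at h
    exact ⟨hb, h⟩
  · simp [q_single_of_deg_ne hb] at h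

variable [MetricSpace X] [CompactSpace X] (T)

/-- The object in degree `i` of the complex over the idempotent completion. -/
noncomputable abbrev obj (i : ℕ) : IdemCtrl X where
  -- The same object carries every degree; the idempotent `q i` alone selects the generators of
  -- shifted degree `i + 1`, which drops the augmentation.
  X := CtrlObj.ofLoc T.loc
  p := (Frame.ofLoc T.loc).hom (Frame.ofLoc T.loc) (T.q i)
  idem := by rw [Frame.hom_comp, q_comp_q]

/-- The morphism between the objects in two degrees given by a linear map. -/
noncomputable abbrev objHom (i j : ℕ) (f : (T.B →₀ ℤ) →ₗ[ℤ] (T.B →₀ ℤ)) : T.obj i ⟶ T.obj j where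
  f := (Frame.ofLoc T.loc).hom (Frame.ofLoc T.loc) (T.q j ∘ₗ f ∘ₗ T.q i)
  comm := by
    have h₁ := (Frame.ofLoc T.loc).hom_comp (Frame.ofLoc T.loc) (Frame.ofLoc T.loc)
      (T.q j ∘ₗ f ∘ₗ T.q i) (T.q j)
    have h₂ := (Frame.ofLoc T.loc).hom_comp (Frame.ofLoc T.loc) (Frame.ofLoc T.loc)
      (T.q i) (T.q j ∘ₗ f ∘ₗ T.q i)
    rw [← LinearMap.comp_assoc (f ∘ₗ T.q i), q_comp_q] at h₁
    rw [LinearMap.comp_assoc, LinearMap.comp_assoc, q_comp_q] at h₂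
    exact (congrArg ((Frame.ofLoc T.loc).hom (Frame.ofLoc T.loc) (T.q i) ≫ ·) h₁).trans h₂

variable {T}

theorem objHom_add {i j : ℕ} (f g : (T.B →₀ ℤ) →ₗ[ℤ] (T.B →₀ ℤ)) :
    T.objHom i j (f + g) = T.objHom i j f + T.objHom i j g := by
  ext1
  rw [karoubi_add_f]
  refine Eq.trans ?_ (Frame.hom_add _ _ (T.q j ∘ₗ f ∘ₗ T.q i) (T.q j ∘ₗ g ∘ₗ T.q i))
  rw [← LinearMap.comp_add, ← LinearMap.add_comp]

theorem objHom_eq_zero {i j : ℕ} {f : (T.B →₀ ℤ) →ₗ[ℤ] (T.B →₀ ℤ)}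
    (h : T.q j ∘ₗ f ∘ₗ T.q i = 0) : T.objHom i j f = 0 := by
  ext1
  rw [karoubi_zero_f]
  exact (congrArg _ h).trans (Frame.hom_zero _ _)

theorem objHom_comp {m n i j k : ℕ} {f : (T.B →₀ ℤ) →ₗ[ℤ] (T.B →₀ ℤ)} (hf : T.IsHomog m n f)
    (hij : j + m = i + n) (g : (T.B →₀ ℤ) →ₗ[ℤ] (T.B →₀ ℤ)) :
    T.objHom i j f ≫ T.objHom j k g = T.objHom i k (g ∘ₗ f) := by
  ext1
  rw [Idempotents.Karoubi.comp_f]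
  refine (Frame.hom_comp _ _ _ _ _).trans (congrArg _ ?_)
  rw [hf.q_comp hij, LinearMap.comp_assoc, LinearMap.comp_assoc, hf.q_comp hij,
    LinearMap.comp_assoc]

theorem objHom_p (i : ℕ) : T.objHom i i T.p = 𝟙 (T.obj i) := by
  ext1
  rw [Idempotents.Karoubi.id_f]
  refine congrArg ((Frame.ofLoc T.loc).hom (Frame.ofLoc T.loc))
    ((T.isHomog_p.q_comp (i := i) (j := i) rfl).trans ?_)
  refine comp_q_congr (g := LinearMap.id) fun b hb => ?_
  rw [T.p_p, LinearMap.id_apply]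

theorem exists_of_mem_supp_objHom {m n i j : ℕ} {f : (T.B →₀ ℤ) →ₗ[ℤ] (T.B →₀ ℤ)}
    (hf : T.IsHomog m n f) {x y : X} (h : (x, y) ∈ supp (T.objHom i j f).f) :
    ∃ b b', T.loc b = y ∧ T.loc b' = x ∧ T.deg b = i + 1 ∧ b' ∈ (f (single b 1)).support := by
  have hij : j + m = i + n := by
    by_contra hij
    obtain ⟨b, b', -, -, hb⟩ := Frame.exists_of_mem_supp h
    rw [hf.q_comp_of_ne hij] at hb
    simp at hb
  obtain ⟨b, b', hb, hb', h⟩ := Frame.exists_of_mem_supp h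
  rw [hf.q_comp hij] at h
  exact ⟨b, b', hb, hb', (hf.mem_support h).1, (hf.mem_support h).2⟩

variable (T) in
/-- The chain complex over the idempotent completion defined by a located complex. -/
noncomputable def toComplex : IdemCtrlComplex X where
  X := T.obj
  d i j := T.objHom i j T.d
  shape i j h := objHom_eq_zero (T.isHomog_d.q_comp_of_ne (by simpa using h))
  d_comp_d' i j k h _ := by
    rw [objHom_comp T.isHomog_d (by simpa using h)]
    exact objHom_eq_zero (by
      have : T.d ∘ₗ T.d = 0 := LinearMap.ext T.d_d
      simp [this])

theorem isConcentrated_toComplex {N : ℕ} (h : ∀ b, N + 1 < T.deg b → T.p (single b 1) = 0) :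
    IsConcentrated N T.toComplex := by
  intro n hn
  rw [Limits.IsZero.iff_id_eq_zero]
  refine (objHom_p n).symm.trans (objHom_eq_zero ?_)
  rw [← LinearMap.comp_assoc, ← LinearMap.zero_comp (T.q n)]
  exact comp_q_congr fun b hb => by simp [h b (by omega)]

theorem isControlledComplex_toComplex {ε : ℝ}
    (hd : ∀ b, ∀ b' ∈ (T.d (single b 1)).support, T.deg b' ≠ 0 → dist (T.loc b') (T.loc b) ≤ ε)
    (hp : ∀ b, ∀ b' ∈ (T.p (single b 1)).support, T.deg b ≠ 0 → dist (T.loc b') (T.loc b) ≤ ε) :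
    IsControlledComplex ε T.toComplex := by
  constructor
  · rintro n ⟨x, y⟩ h
    obtain ⟨b, b', rfl, rfl, hb⟩ := Frame.exists_of_mem_supp h
    by_cases hn : T.deg b = n + 1
    · rw [q_single_of_deg hn] at hb
      exact hp b b' hb (by omega)
    · simp [q_single_of_deg_ne hn] at hb
  · rintro n ⟨x, y⟩ h
    obtain ⟨b, b', rfl, rfl, hn, hb⟩ := exists_of_mem_supp_objHom T.isHomog_d h
    have := T.d_deg b b' hb
    exact hd b b' hb (by omega)

/-- The chain map defined by an endomorphism of a located complex. -/
noncomputable def IsChainMap.toHom {f : (T.B →₀ ℤ) →ₗ[ℤ] (T.B →₀ ℤ)} (hf : T.IsChainMap f) :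
    T.toComplex ⟶ T.toComplex where
  f i := T.objHom i i f
  comm' i j h := by
    change T.objHom _ _ _ ≫ T.objHom _ _ _ = T.objHom _ _ _ ≫ T.objHom _ _ _
    rw [objHom_comp hf.toIsHomog rfl, objHom_comp T.isHomog_d (by simpa using h), hf.d_f]

theorem IsChainMap.toHom_comp {f g : (T.B →₀ ℤ) →ₗ[ℤ] (T.B →₀ ℤ)} (hf : T.IsChainMap f)
    (hg : T.IsChainMap g) (hgf : T.IsChainMap (g ∘ₗ f)) :
    hf.toHom ≫ hg.toHom = hgf.toHom := by
  ext1 i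
  exact objHom_comp hf.toIsHomog rfl g

theorem toHom_isChainMap_p : T.isChainMap_p.toHom = 𝟙 T.toComplex := by
  ext1 i
  exact objHom_p i

/-- The chain homotopy defined by a homotopy between endomorphisms of a located complex. -/
noncomputable def IsChainHomotopy.toHomotopy {f g h : (T.B →₀ ℤ) →ₗ[ℤ] (T.B →₀ ℤ)}
    (hf : T.IsChainMap f) (hg : T.IsChainMap g) (hh : T.IsChainHomotopy f g h) :
    Homotopy hf.toHom hg.toHom where
  hom i j := T.objHom i j h
  zero i j hij := objHom_eq_zero (hh.toIsHomog.q_comp_of_ne fun e => hij (by simpa using e.symm))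
  comm i := by
    have e : T.objHom i i f =
        T.objHom i i (h ∘ₗ T.d) + T.objHom i i (T.d ∘ₗ h) + T.objHom i i g := by
      rw [← objHom_add, ← objHom_add, add_comm (h ∘ₗ T.d), hh.comm]
    refine e.trans (congrArg₂ (· + ·) (congrArg₂ (· + ·) ?_ ?_) rfl)
    · cases i with
      | zero =>
        refine (objHom_eq_zero ?_).trans (Homotopy.dNext_zero_chainComplex (P := T.toComplex)
          (Q := T.toComplex) _).symm
        rw [← LinearMap.comp_assoc, ← LinearMap.zero_comp (T.q 0)]
        refine comp_q_congr fun b hb => ?_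
        -- The term `h d` has no counterpart in degree `0` of the unaugmented complex; it vanishes
        -- there because `h` kills the augmentation generator.
        have : h (T.d (single b 1)) = 0 := map_eq_of_support (g := 0) fun b' hb' => by
          have := T.d_deg b b' hb'
          rw [(T.deg_eq_zero b').1 (by omega), hh.h_pt, LinearMap.zero_apply]
        simp [T.d_p, this]
      | succ i =>
        exact (objHom_comp T.isHomog_d rfl h).symm.trans
          (Homotopy.dNext_succ_chainComplex (P := T.toComplex) (Q := T.toComplex)
            (fun i j => T.objHom i j h) i).symm
    · exact (objHom_comp hh.toIsHomog rfl T.d).symm.trans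
        (Homotopy.prevD_chainComplex (P := T.toComplex) (Q := T.toComplex)
          (fun i j => T.objHom i j h) i).symm

end LocComplex

end ControlledAlgebra

/-! ### The augmentation as an equivalence with the trivial complex -/

namespace ControlledAlgebra

open Finsupp

namespace LocComplex

/-! ### Comparison with the trivial complex -/

variable {X : Type u} (T : LocComplex X)

/-- The augmentation, as a functional on chains of all degrees. -/
noncomputable def aug : (T.B →₀ ℤ) →ₗ[ℤ] ℤ := lapply T.pt ∘ₗ T.d

/-- The composite of the augmentation with the inclusion of a point chain. -/
noncomputable def collapse (w : T.B →₀ ℤ) : (T.B →₀ ℤ) →ₗ[ℤ] (T.B →₀ ℤ) :=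
  (lapply T.pt).smulRight (single T.pt 1) + T.aug.smulRight w

variable {T}

theorem collapse_apply (w c : T.B →₀ ℤ) :
    T.collapse w c = c T.pt • single T.pt 1 + T.aug c • w := rfl

theorem aug_apply (c : T.B →₀ ℤ) : T.aug c = T.d c T.pt := rfl

theorem apply_pt_eq_zero {c : T.B →₀ ℤ} (h : ∀ b ∈ c.support, T.deg b ≠ 0) : c T.pt = 0 := by
  by_contra hc
  exact h _ (mem_support_iff.2 hc) T.deg_pt

theorem aug_single_eq_zero {b : T.B} (h : T.deg b ≠ 1) : T.aug (single b 1) = 0 :=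
  apply_pt_eq_zero fun b' hb' h0 => h (by rw [← T.d_deg b b' hb', h0])

theorem IsChainMap.apply_pt {f : (T.B →₀ ℤ) →ₗ[ℤ] (T.B →₀ ℤ)} (hf : T.IsChainMap f)
    (c : T.B →₀ ℤ) : f c T.pt = c T.pt := by
  refine map_eq_of_support (f := lapply T.pt ∘ₗ f) (g := lapply T.pt) fun b _ => ?_
  by_cases hb : b = T.pt
  · rw [hb, LinearMap.comp_apply, hf.f_pt]
  · have h0 : T.deg b ≠ 0 := fun h => hb ((T.deg_eq_zero b).1 h)
    rw [LinearMap.comp_apply, lapply_apply, lapply_apply, single_eq_of_ne (Ne.symm hb)]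
    exact apply_pt_eq_zero fun b' hb' h => h0 (by simpa [h] using (hf.deg b b' hb').symm)

theorem IsChainMap.aug_comp {f : (T.B →₀ ℤ) →ₗ[ℤ] (T.B →₀ ℤ)} (hf : T.IsChainMap f) :
    T.aug ∘ₗ f = T.aug := by
  refine LinearMap.ext fun c => ?_
  rw [LinearMap.comp_apply, aug_apply, ← LinearMap.comp_apply, hf.d_f, LinearMap.comp_apply,
    hf.apply_pt, aug_apply]

/-- In degree `1` the map sends a chain to its augmentation times `w`; since `w` has augmentation
`1`, this agrees with the identity on the augmentation generator. -/
theorem isChainMap_collapse {w : T.B →₀ ℤ} (hw : ∀ b ∈ w.support, T.deg b = 1) (hpw : T.p w = w)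
    (hdw : T.d w = single T.pt 1) : T.IsChainMap (T.collapse w) where
  p_f := LinearMap.ext fun c => by
    rw [LinearMap.comp_apply, collapse_apply, map_add, map_smul, map_smul, T.p_pt, hpw]
  f_p := LinearMap.ext fun c => by
    rw [LinearMap.comp_apply, collapse_apply, collapse_apply, T.isChainMap_p.apply_pt,
      aug_apply, T.d_p, aug_apply]
  deg b b' hb' := by
    rw [collapse_apply] at hb'
    by_cases h0 : T.deg b = 0
    · obtain rfl := (T.deg_eq_zero b).1 h0
      rw [aug_apply, T.d_pt] at hb'
      have : b' = T.pt := by simpa [single_apply] using hb'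
      rw [this]
    rw [single_eq_of_ne fun h => h0 ((T.deg_eq_zero b).2 h.symm), zero_smul, zero_add] at hb'
    by_cases h1 : T.deg b = 1
    · rw [h1, hw b' (support_smul hb')]
    · rw [aug_single_eq_zero h1] at hb'
      simp at hb'
  d_f := LinearMap.ext fun c => by
    rw [LinearMap.comp_apply, LinearMap.comp_apply, collapse_apply, collapse_apply, map_add,
      map_smul, map_smul, T.d_pt, hdw, smul_zero, zero_add, ← aug_apply, aug_apply (T.d c), T.d_d]
    simp
  f_pt := by
    rw [collapse_apply, aug_apply, T.d_pt]
    simp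

section trivial

theorem isZero_trivialComplex {X : Type u} [MetricSpace X] (x : X) (n : ℕ) :
    Limits.IsZero ((trivialComplex x).X (n + 1)) := by
  rw [Limits.IsZero.iff_id_eq_zero]
  ext1
  refine CtrlHom.ext ?_
  funext z' z
  have h : (trivialObj x (n + 1)).rank z = 0 := by simp [trivialObj]
  have : IsEmpty (Fin ((trivialObj x (n + 1)).rank z)) := by rw [h]; infer_instance
  ext i j
  exact isEmptyElim (α := Fin ((trivialObj x (n + 1)).rank z)) j

variable [MetricSpace X] [CompactSpace X] (T) (x : X)

/-- The augmentation in degree `0`, as a morphism to the trivial object. -/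
noncomputable def toTrivialZero :
    T.obj 0 ⟶ (⟨trivialObj x 0, 𝟙 _, Category.comp_id _⟩ : IdemCtrl X) where
  f := (Frame.ofLoc T.loc).hom (Frame.trivial x) (lsingle PUnit.unit ∘ₗ T.aug ∘ₗ T.q 0)
  comm := by
    have h := (Frame.ofLoc T.loc).hom_comp (Frame.ofLoc T.loc) (Frame.trivial x)
      (T.q 0) (lsingle PUnit.unit ∘ₗ T.aug ∘ₗ T.q 0)
    rw [LinearMap.comp_assoc, LinearMap.comp_assoc, q_comp_q] at h
    exact (congrArg ((Frame.ofLoc T.loc).hom (Frame.ofLoc T.loc) (T.q 0) ≫ ·)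
      (Category.comp_id _)).trans h

/-- The inclusion of a point chain, as a morphism from the trivial object. -/
noncomputable def ofTrivialZero (w : T.B →₀ ℤ) :
    (⟨trivialObj x 0, 𝟙 _, Category.comp_id _⟩ : IdemCtrl X) ⟶ T.obj 0 where
  f := (Frame.trivial x).hom (Frame.ofLoc T.loc)
    (T.q 0 ∘ₗ linearCombination ℤ fun _ : PUnit.{1} => w)
  comm := by
    have h := (Frame.trivial x).hom_comp (Frame.ofLoc T.loc) (Frame.ofLoc T.loc)
      (T.q 0 ∘ₗ linearCombination ℤ fun _ : PUnit.{1} => w) (T.q 0)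
    rw [← LinearMap.comp_assoc, q_comp_q] at h
    exact (Category.id_comp _).trans h

variable {T x}

theorem toTrivialZero_comp_ofTrivialZero (w : T.B →₀ ℤ) :
    T.toTrivialZero x ≫ T.ofTrivialZero x w = T.objHom 0 0 (T.collapse w) := by
  ext1
  rw [Idempotents.Karoubi.comp_f]
  refine (Frame.hom_comp _ _ _ _ _).trans
    (congrArg ((Frame.ofLoc T.loc).hom (Frame.ofLoc T.loc)) ?_)
  rw [LinearMap.comp_assoc]
  congr 1
  rw [← LinearMap.comp_assoc, ← LinearMap.comp_assoc]
  refine comp_q_congr fun b hb => ?_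
  rw [collapse_apply, apply_pt_eq_zero fun b' hb' => by rw [T.p_deg b b' hb', hb]; omega]
  simp

theorem ofTrivialZero_comp_toTrivialZero {w : T.B →₀ ℤ} (hw : ∀ b ∈ w.support, T.deg b = 1)
    (hpw : T.p w = w) (hdw : T.d w = single T.pt 1) :
    T.ofTrivialZero x w ≫ T.toTrivialZero x = 𝟙 _ := by
  ext1
  rw [Idempotents.Karoubi.comp_f]
  refine ((Frame.hom_comp _ _ _ _ _).trans (congrArg ((Frame.trivial x).hom (Frame.trivial x))
    (?_ : _ = LinearMap.id))).trans (Frame.hom_id _)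
  have hq : T.q 0 w = w := (q_of_deg hw).trans hpw
  refine Finsupp.lhom_ext' fun b => LinearMap.ext_ring ?_
  simp [hq, aug_apply, hdw]

theorem isChainMap_toTrivialZero {f : (T.B →₀ ℤ) →ₗ[ℤ] (T.B →₀ ℤ)} (hf : T.IsChainMap f) :
    T.objHom 0 0 f ≫ T.toTrivialZero x = T.toTrivialZero x := by
  ext1
  rw [Idempotents.Karoubi.comp_f]
  refine (Frame.hom_comp _ _ _ _ _).trans (congrArg ((Frame.ofLoc T.loc).hom (Frame.trivial x)) ?_)
  rw [hf.q_comp rfl, LinearMap.comp_assoc, LinearMap.comp_assoc, hf.q_comp rfl,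
    ← LinearMap.comp_assoc (T.q 0) f T.aug, hf.aug_comp]

theorem objHom_d_comp_toTrivialZero : T.objHom 1 0 T.d ≫ T.toTrivialZero x = 0 := by
  ext1
  rw [Idempotents.Karoubi.comp_f, karoubi_zero_f]
  have h : T.aug ∘ₗ T.d = 0 := LinearMap.ext fun c => by simp [aug_apply, T.d_d]
  have e : (lsingle PUnit.unit ∘ₗ T.aug ∘ₗ T.q 0) ∘ₗ T.q 0 ∘ₗ T.d ∘ₗ T.q 1 = 0 := by
    rw [T.isHomog_d.q_comp rfl, LinearMap.comp_assoc, LinearMap.comp_assoc,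
      T.isHomog_d.q_comp rfl, ← LinearMap.comp_assoc (T.q 1) T.d T.aug, h]
    simp
  exact (Frame.hom_comp _ _ _ _ _).trans ((congrArg ((Frame.ofLoc T.loc).hom (Frame.trivial x))
    e).trans (Frame.hom_zero _ _))

variable (T x) in
/-- The augmentation as a chain map. -/
noncomputable def toTrivial : T.toComplex ⟶ trivialComplex x where
  f
    | 0 => T.toTrivialZero x
    | _ + 1 => 0
  comm' i j h := by
    obtain rfl : j + 1 = i := by simpa using h
    refine (Limits.zero_comp).trans ?_
    cases j with
    | zero => exact objHom_d_comp_toTrivialZero.symm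
    | succ j => exact Limits.comp_zero.symm

variable (T x) in
/-- The inclusion of a point chain as a chain map. -/
noncomputable def ofTrivial (w : T.B →₀ ℤ) : trivialComplex x ⟶ T.toComplex where
  f
    | 0 => T.ofTrivialZero x w
    | _ + 1 => 0
  comm' i j h := by
    obtain rfl : j + 1 = i := by simpa using h
    exact Limits.zero_comp.trans Limits.zero_comp.symm

theorem toTrivial_comp_ofTrivial {w : T.B →₀ ℤ} (hw : T.IsChainMap (T.collapse w)) :
    T.toTrivial x ≫ T.ofTrivial x w = hw.toHom := by
  ext1 i
  cases i with
  | zero => exact toTrivialZero_comp_ofTrivialZero w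
  | succ i =>
    refine Limits.zero_comp.trans (objHom_eq_zero ?_).symm
    have : T.collapse w ∘ₗ T.q (i + 1) = 0 ∘ₗ T.q (i + 1) := comp_q_congr fun b hb => by
      rw [collapse_apply, apply_pt_eq_zero fun b' hb' => by rw [T.p_deg b b' hb', hb]; omega,
        aug_apply, T.d_p, ← aug_apply, aug_single_eq_zero (by omega)]
      simp
    rw [this]
    simp

theorem ofTrivial_comp_toTrivial {w : T.B →₀ ℤ} (hw : ∀ b ∈ w.support, T.deg b = 1)
    (hpw : T.p w = w) (hdw : T.d w = single T.pt 1) :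
    T.ofTrivial x w ≫ T.toTrivial x = 𝟙 _ := by
  ext1 i
  cases i with
  | zero => exact ofTrivialZero_comp_toTrivialZero hw hpw hdw
  | succ i => exact (isZero_trivialComplex x i).eq_of_src _ _

/-- Chain maps fix the augmentation generator, so the augmentation is strictly invariant and no
homotopy is needed for compatibility with the action. -/
theorem IsChainMap.toHom_comp_toTrivial {f : (T.B →₀ ℤ) →ₗ[ℤ] (T.B →₀ ℤ)} (hf : T.IsChainMap f) :
    hf.toHom ≫ T.toTrivial x = T.toTrivial x := by
  ext1 i
  cases i with
  | zero => exact isChainMap_toTrivialZero hf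
  | succ i => exact Limits.comp_zero

/-- A contraction of a located complex yields a homotopy equivalence to the trivial complex. -/
theorem exists_homotopyEquiv_trivial {w : T.B →₀ ℤ} (hw : ∀ b ∈ w.support, T.deg b = 1)
    (hpw : T.p w = w) (hdw : T.d w = single T.pt 1) {K : (T.B →₀ ℤ) →ₗ[ℤ] (T.B →₀ ℤ)}
    (hK : T.IsChainHomotopy (T.collapse w) T.p K) :
    ∃ e : HomotopyEquiv T.toComplex (trivialComplex x), e.hom = T.toTrivial x := by
  have hc := isChainMap_collapse hw hpw hdw
  exact ⟨{
    hom := T.toTrivial x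
    inv := T.ofTrivial x w
    homotopyHomInvId := (Homotopy.ofEq (toTrivial_comp_ofTrivial hc)).trans
      ((hK.toHomotopy hc T.isChainMap_p).trans (Homotopy.ofEq toHom_isChainMap_p))
    homotopyInvHomId := Homotopy.ofEq (ofTrivial_comp_toTrivial hw hpw hdw) }, rfl⟩

end trivial

end LocComplex

end ControlledAlgebra

/-! ### Realizing maps and homotopies of the space by chains -/

namespace ControlledAlgebra

open Finsupp Metric

namespace LocComplex

/-! ### Controlled chain maps and chain homotopies over maps of the space -/

section realization

variable {X : Type u} {T : LocComplex X}

theorem IsHomog.exists_of_mem_support_comp {m n : ℕ} {f g : (T.B →₀ ℤ) →ₗ[ℤ] (T.B →₀ ℤ)}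
    (hg : T.IsHomog m n g) {b b'' : T.B} (h : b'' ∈ ((f ∘ₗ g) (single b 1)).support) :
    ∃ b', T.deg b' + m = T.deg b + n ∧ b' ∈ (g (single b 1)).support ∧
      b'' ∈ (f (single b' 1)).support := by
  by_contra! hc
  rw [LinearMap.comp_apply] at h
  have := map_mem_of_support (f := f) (c := g (single b 1))
    (W := supported ℤ ℤ {b''}ᶜ) fun b' hb' x hx => by
      rintro rfl
      exact hc b' (hg.deg b b' hb') hb' hx
  exact this h rfl

theorem IsChainMap.comp {f g : (T.B →₀ ℤ) →ₗ[ℤ] (T.B →₀ ℤ)} (hf : T.IsChainMap f)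
    (hg : T.IsChainMap g) : T.IsChainMap (f ∘ₗ g) where
  p_f := by rw [← LinearMap.comp_assoc, hf.p_f]
  f_p := by rw [LinearMap.comp_assoc, hg.f_p]
  deg b b'' hb'' := by
    obtain ⟨b', h1, -, h2⟩ := hg.exists_of_mem_support_comp hb''
    have := hf.deg b' b'' h2
    omega
  d_f := by rw [← LinearMap.comp_assoc, hf.d_f, LinearMap.comp_assoc, hg.d_f, LinearMap.comp_assoc]
  f_pt := by rw [LinearMap.comp_apply, hg.f_pt, hf.f_pt]

theorem IsChainMap.isChainHomotopy_zero {f : (T.B →₀ ℤ) →ₗ[ℤ] (T.B →₀ ℤ)} :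
    T.IsChainHomotopy f f 0 where
  p_f := LinearMap.comp_zero _
  f_p := LinearMap.zero_comp _
  deg b b' hb' := by simp at hb'
  comm := by simp
  h_pt := rfl

variable [PseudoMetricSpace X] {R : ℕ → ℝ} {k : ℕ}

/-- The radius in degree `m` is `R (a + k - m)`, so as the degree rises to `k` it climbs the scales
only up to `R a`. Composing with `p` makes the map compatible with the idempotents and costs a
further `ρ`. -/
theorem exists_isChainMap (hR : ∀ j, 0 < R j) (hRa : Antitone R) (hk : ∀ b, T.deg b ≤ k) {a : ℕ}
    (hfill : ∀ m, ∀ j < a + k, T.Fill m (4 * R (j + 1)) (R j)) {ρ : ℝ} (hρ : ρ ≤ R (a + k))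
    (ϑ : X → X) (hface : ∀ b, ∀ b' ∈ (T.d (single b 1)).support, T.deg b' ≠ 0 →
      dist (ϑ (T.loc b')) (ϑ (T.loc b)) ≤ ρ)
    (hface' : ∀ b, ∀ b' ∈ (T.p (single b 1)).support, T.deg b ≠ 0 →
      dist (ϑ (T.loc b')) (ϑ (T.loc b)) ≤ ρ) :
    ∃ f, T.IsChainMap f ∧ ∀ b, ∀ b' ∈ (f (single b 1)).support, T.deg b ≠ 0 →
      dist (T.loc b') (ϑ (T.loc b)) < R a + ρ := by
  obtain ⟨f, hf⟩ := exists_chainMap (T := T) T.toBasedComplex (fun _ => True)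
    (fun _ _ _ _ => trivial) (fun b _ => hk b) (fun b => ϑ (T.loc b)) (α := fun m => R (a + k - m))
    (r := fun m => 4 * R (a + k - m)) (fun b _ => hface b) (fun m hm => by
      have h1 := hRa (show a + k - m ≤ a + k by omega)
      have h2 := hR (a + k - m)
      linarith) (fun m hm => by
      have e : a + k - m = a + k - (m + 1) + 1 := by omega
      rw [e]
      exact hfill m _ (by omega))
  have hfb := fun b => hf b trivial
  have hd : T.d ∘ₗ f = f ∘ₗ T.d := LinearMap.ext fun c => map_eq_of_support fun b _ => (hfb b).1
  have hp : T.p ∘ₗ f = f := LinearMap.ext fun c => map_eq_of_support fun b _ => (hfb b).2.2.1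
  have hm : ∀ {b b'}, b' ∈ ((f ∘ₗ T.p) (single b 1)).support → ∃ b₁,
      T.deg b₁ = T.deg b ∧ b₁ ∈ (T.p (single b 1)).support ∧ b' ∈ (f (single b₁ 1)).support :=
    fun h => T.isHomog_p.exists_of_mem_support_comp h
  refine ⟨f ∘ₗ T.p, ⟨⟨?_, ?_, fun b b' hb' => ?_⟩, ?_, ?_⟩, fun b b' hb' h0 => ?_⟩
  · rw [← LinearMap.comp_assoc, hp]
  · rw [LinearMap.comp_assoc, T.isHomog_p.p_f]
  · obtain ⟨b₁, h1, -, h2⟩ := hm hb'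
    rw [((hfb b₁).2.1 h2).1, h1]
  · rw [← LinearMap.comp_assoc, hd, LinearMap.comp_assoc, LinearMap.comp_assoc,
      T.isHomog_d.p_f, T.isHomog_d.f_p]
  · rw [LinearMap.comp_apply, T.p_pt, (hfb _).2.2.2 T.deg_pt]
  · obtain ⟨b₁, h1, h2, h3⟩ := hm hb'
    have h4 := ((hfb b₁).2.1 h3).2.resolve_left (by omega)
    have h5 := hface' b b₁ h2 h0
    have h6 := hRa (show a ≤ a + k - T.deg b₁ by have := hk b₁; omega)
    have h7 := dist_triangle (T.loc b') (ϑ (T.loc b₁)) (ϑ (T.loc b))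
    rw [mem_ball] at h4
    linarith

/-- Chain maps occupy the finer scales and the homotopies between them the `k + 1` coarsest from `R
a` on. The homotopy runs from `g`, over `c 0`, to `f`, over `c M`. -/
theorem exists_isChainHomotopy (hR : ∀ j, 0 < R j) (hRa : Antitone R) (hk : ∀ b, T.deg b ≤ k)
    {a : ℕ} (hfill : ∀ m, ∀ j ≤ a + 2 * k, T.Fill m (4 * R (j + 1)) (R j)) {ρ : ℝ} (hρ0 : 0 ≤ ρ)
    (hρ : ρ ≤ R (a + 2 * k + 1)) (c : ℕ → X → X) (M : ℕ)
    (hface : ∀ b, ∀ b' ∈ (T.d (single b 1)).support, T.deg b' ≠ 0 → ∀ j,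
      dist (c j (T.loc b')) (c j (T.loc b)) ≤ ρ)
    (hface' : ∀ b, ∀ b' ∈ (T.p (single b 1)).support, T.deg b ≠ 0 → ∀ j,
      dist (c j (T.loc b')) (c j (T.loc b)) ≤ ρ)
    (hstep : ∀ x j, dist (c j x) (c (j + 1) x) ≤ ρ) {f g : (T.B →₀ ℤ) →ₗ[ℤ] (T.B →₀ ℤ)}
    (hf : T.IsChainMap f) (hg : T.IsChainMap g)
    (hfc : ∀ b, ∀ b' ∈ (f (single b 1)).support, T.deg b ≠ 0 →
      dist (T.loc b') (c M (T.loc b)) < R (a + 2 * k + 1))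
    (hgc : ∀ b, ∀ b' ∈ (g (single b 1)).support, T.deg b ≠ 0 →
      dist (T.loc b') (c 0 (T.loc b)) < R (a + 2 * k + 1)) :
    ∃ h, T.IsChainHomotopy f g h ∧ ∀ b, ∀ b' ∈ (h (single b 1)).support, T.deg b ≠ 0 →
      ∃ j ≤ M, dist (T.loc b') (c j (T.loc b)) < R a + ρ := by
  have hsub : ∀ {f : (T.B →₀ ℤ) →ₗ[ℤ] (T.B →₀ ℤ)}, T.IsChainMap f → ∀ i,
      (∀ b, ∀ b' ∈ (f (single b 1)).support, T.deg b ≠ 0 →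
        dist (T.loc b') (c i (T.loc b)) < R (a + 2 * k + 1)) → ∀ b,
      f (single b 1) ∈ T.Sub (T.deg b) (ball (c i (T.loc b)) (R (a + 2 * k + 1 - T.deg b))) := by
    intro f hf i hfc b b' hb'
    refine ⟨by simpa using hf.deg b b' hb', or_iff_not_imp_left.2 fun h0 => ?_⟩
    exact (hfc b b' hb' h0).trans_le (hRa (by omega))
  obtain ⟨h, hh⟩ := exists_homotopy_path (T := T) T.toBasedComplex (fun _ => True)
    (fun _ _ _ _ => trivial) (fun b _ => hk b) (α := fun m => R (a + 2 * k + 1 - m))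
    (β := fun m => R (a + k - m)) (r := fun m => 4 * R (a + k - m + 1))
    (r' := fun m => 4 * R (a + 2 * k + 1 - m)) hρ0 (fun m hm => by
      have h1 := hRa (show a + 2 * k + 1 - m ≤ a + 2 * k + 1 by omega)
      have h2 := hR (a + 2 * k + 1 - m)
      linarith) (fun m hm => by
      have e : a + 2 * k + 1 - m = a + 2 * k + 1 - (m + 1) + 1 := by omega
      rw [e]
      exact hfill m _ (by omega)) (fun m hm => by
      have h1 := hRa (show a + k - m + 1 ≤ a + 2 * k + 1 - m by omega)
      have h2 := hRa (show a + k - m + 1 ≤ a + 2 * k + 1 by omega)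
      have h3 := hR (a + k - m + 1)
      linarith) (fun m hm => by
      have e : a + k - m = a + k - (m + 1) + 1 := by omega
      rw [← e]
      have h1 := hRa (show a + k - m ≤ a + 2 * k + 1 by omega)
      have h3 := hR (a + k - m)
      linarith) (fun m hm => hfill m _ (by omega)) (fun j b => c j (T.loc b)) M
    (fun b _ b' hb' h0 j _ => hface b b' hb' h0 j) (fun b _ j _ => hstep _ j) g f
    (fun b _ => LinearMap.congr_fun hg.d_f _) (fun b _ => LinearMap.congr_fun hf.d_f _)
    (fun b _ => hsub hg 0 hgc b) (fun b _ => hsub hf M hfc b)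
    (fun b _ => LinearMap.congr_fun hg.p_f _) (fun b _ => LinearMap.congr_fun hf.p_f _)
    (fun b _ h0 => by rw [(T.deg_eq_zero b).1 h0, hg.f_pt])
    (fun b _ h0 => by rw [(T.deg_eq_zero b).1 h0, hf.f_pt])
  have hhb := fun b => hh b trivial
  have hd : T.d ∘ₗ h + h ∘ₗ T.d + g = f := LinearMap.ext fun c => map_eq_of_support fun b _ => by
    have := (hhb b).1
    rw [LinearMap.add_apply, LinearMap.add_apply, LinearMap.comp_apply, LinearMap.comp_apply, this,
      sub_add_cancel]
  have hp : T.p ∘ₗ h = h := LinearMap.ext fun c => map_eq_of_support fun b _ => (hhb b).2.2.1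
  have hm : ∀ {b b'}, b' ∈ ((h ∘ₗ T.p) (single b 1)).support → ∃ b₁,
      T.deg b₁ = T.deg b ∧ b₁ ∈ (T.p (single b 1)).support ∧ b' ∈ (h (single b₁ 1)).support :=
    fun h => T.isHomog_p.exists_of_mem_support_comp h
  refine ⟨h ∘ₗ T.p, ⟨⟨?_, ?_, fun b b' hb' => ?_⟩, ?_, ?_⟩, fun b b' hb' h0 => ?_⟩
  · rw [← LinearMap.comp_assoc, hp]
  · rw [LinearMap.comp_assoc, T.isHomog_p.p_f]
  · obtain ⟨b₁, h1, -, h2⟩ := hm hb'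
    rw [((hhb b₁).2.1 h2).1, h1, add_zero]
  · refine LinearMap.ext fun c => ?_
    have e := LinearMap.congr_fun hd (T.p c)
    have e₁ : f (T.p c) = f c := LinearMap.congr_fun hf.f_p c
    have e₂ : g (T.p c) = g c := LinearMap.congr_fun hg.f_p c
    simpa [e₁, e₂, T.d_p, T.p_d] using e
  · rw [LinearMap.comp_apply, T.p_pt, (hhb _).2.2.2 T.deg_pt]
  · obtain ⟨b₁, h1, h2, h3⟩ := hm hb'
    obtain ⟨j, hj, h4⟩ := ((hhb b₁).2.1 h3).2.resolve_left (by omega)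
    refine ⟨j, hj, ?_⟩
    have h5 := hface' b b₁ h2 h0 j
    have h6 := hRa (show a ≤ a + k - T.deg b₁ by have := hk b₁; omega)
    have h7 := dist_triangle (T.loc b') (c j (T.loc b₁)) (c j (T.loc b))
    linarith

end realization

end LocComplex

theorem exists_common_modulus {ι Y Z : Type*} [Finite ι] [PseudoMetricSpace Y] [CompactSpace Y]
    [PseudoMetricSpace Z] (F : ι → C(Y, Z)) {e : ℝ} (he : 0 < e) :
    ∃ ω > 0, ∀ i p q, dist p q < ω → dist (F i p) (F i q) < e := by
  cases nonempty_fintype ι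
  choose ω hω h using fun i => Metric.uniformContinuous_iff.1
    (CompactSpace.uniformContinuous_of_continuous (F i).continuous) e he
  obtain ⟨δ, hδ, hδω⟩ := exists_pos_forall_mem_lt Finset.univ fun i _ => hω i
  exact ⟨δ, hδ, fun i p q hpq => h i (hpq.trans (hδω i (Finset.mem_univ i)))⟩

end ControlledAlgebra

namespace ControlledAlgebra

open Finsupp Metric

/-! ### Assembly: the homotopy action on chains -/

section action

variable {X : Type u} [MetricSpace X] [CompactSpace X]

/-- A modulus of continuity of the homotopy action and of a homotopy. -/
theorem HomotopyAction.exists_modulus {G : Type v} [Group G] {S : Finset G} {hS : (1 : G) ∈ S}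
    (A : HomotopyAction S hS X) (C : C(unitInterval × X, X)) {e : ℝ} (he : 0 < e) :
    ∃ ω > 0, (∀ g x y, dist x y < ω → dist (A.φ g x) (A.φ g y) < e) ∧
      (∀ g h hgh p q, dist p q < ω → dist (A.H g h hgh p) (A.H g h hgh q) < e) ∧
      ∀ p q, dist p q < ω → dist (C p) (C q) < e := by
  obtain ⟨ω₁, hω₁, h₁⟩ := exists_common_modulus A.φ he
  obtain ⟨ω₂, hω₂, h₂⟩ := exists_common_modulus
    (fun q : {q : S × S // (q.1 : G) * q.2 ∈ S} => (A.H q.1.1 q.1.2 q.2).toContinuousMap) he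
  obtain ⟨ω₃, hω₃, h₃⟩ := exists_common_modulus (fun _ : Unit => C) he
  exact ⟨min ω₁ (min ω₂ ω₃), lt_min hω₁ (lt_min hω₂ hω₃),
    fun g x y hxy => h₁ g x y (hxy.trans_le (min_le_left _ _)),
    fun g h hgh p q hpq => h₂ ⟨(g, h), hgh⟩ p q
      (hpq.trans_le ((min_le_right _ _).trans (min_le_left _ _))),
    fun p q hpq => h₃ () p q (hpq.trans_le ((min_le_right _ _).trans (min_le_right _ _)))⟩

/-- A homotopy action is realized up to `ε` by chain maps and chain homotopies of a located
complex. -/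
theorem exists_chain_action {G : Type v} [Group G] {N : ℕ} [ContractibleSpace X]
    (hX : IsControlledDominated N X) {S : Finset G} {hS : (1 : G) ∈ S} (A : HomotopyAction S hS X)
    {ε : ℝ} (hε : 0 < ε) :
    ∃ T : LocComplex X, (∀ b, N + 1 < T.deg b → T.p (single b 1) = 0) ∧
      (∀ b, ∀ b' ∈ (T.d (single b 1)).support, T.deg b' ≠ 0 → dist (T.loc b') (T.loc b) ≤ ε) ∧
      (∀ b, ∀ b' ∈ (T.p (single b 1)).support, T.deg b ≠ 0 → dist (T.loc b') (T.loc b) ≤ ε) ∧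
      (∃ w K, (∀ b ∈ w.support, T.deg b = 1) ∧ T.p w = w ∧ T.d w = single T.pt 1 ∧
        T.IsChainHomotopy (T.collapse w) T.p K) ∧
      ∃ φ : S → ((T.B →₀ ℤ) →ₗ[ℤ] (T.B →₀ ℤ)), φ ⟨1, hS⟩ = T.p ∧ (∀ g, T.IsChainMap (φ g)) ∧
        (∀ g b, ∀ b' ∈ (φ g (single b 1)).support, T.deg b ≠ 0 →
          dist (T.loc b') (A.φ g (T.loc b)) ≤ ε) ∧
        ∀ (g h : S) (hgh : (g : G) * h ∈ S), ∃ H, (g = ⟨1, hS⟩ → h = ⟨1, hS⟩ → H = 0) ∧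
          T.IsChainHomotopy (φ g ∘ₗ φ h) (φ ⟨g * h, hgh⟩) H ∧
          ∀ b, ∀ b' ∈ (H (single b 1)).support, T.deg b ≠ 0 →
            ∃ t : unitInterval, dist (T.loc b') (A.H g h hgh (t, T.loc b)) ≤ ε := by
  have : Nonempty X := inferInstance
  obtain ⟨z, ⟨C⟩⟩ := id_nullhomotopic X
  obtain ⟨Δ, hΔ, hT⟩ := LocComplex.exists_locComplex hX.discretelyLocallyContractible
    hX.hasFineCovers
  choose! ω hω hωφ hωH hωC using fun (e : ℝ) (he : 0 < e) =>
    A.exists_modulus C.toContinuousMap he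
  set k := N + 2 with hk
  -- Each step down the scales allows both one filling and one application of a map of the action or
  -- of a homotopy.
  set Δ' : ℝ → ℝ := fun e => min (Δ e) (ω e) with hΔ'
  have hΔ'0 : ∀ e > 0, 0 < Δ' e := fun e he => lt_min (hΔ e he) (hω e he)
  set R := scaleSeq Δ' (ε / 2) with hRdef
  have hR : ∀ j, 0 < R j := scaleSeq_pos hΔ'0 (half_pos hε)
  have hRa : Antitone R := scaleSeq_antitone hΔ'0 (half_pos hε)
  have hR4 : ∀ j, 4 * R (j + 1) ≤ R j := four_mul_scaleSeq_le'
  have hRΔ : ∀ j, 4 * R (j + 1) ≤ Δ (R j) := fun j =>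
    (four_mul_scaleSeq_le j).trans (min_le_left _ _)
  have hRω : ∀ j, 4 * R (j + 1) ≤ ω (R j) := fun j =>
    (four_mul_scaleSeq_le j).trans (min_le_right _ _)
  have hRε : R 0 = ε / 2 := rfl
  -- Homotopies fill with indices up to `2 * k`, starting from chain maps controlled by `R (2 * k +
  -- 1)`. The chain maps use `2 * k + 3, …, 3 * k + 3`, since composing two of them costs two steps.
  -- Then `R J` bounds the errors of position, and `R (J + 1)` is the control of the complex itself.
  set J := 3 * k + 4 with hJ
  obtain ⟨T, hfill, hdeg, hp0, hdc, hpc⟩ := hT ((Finset.range (J + 1)).image R)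
    (fun e he => by
      obtain ⟨j, -, rfl⟩ := Finset.mem_image.1 he
      exact hR j) (R (J + 1)) (hR _)
  have hfill' : ∀ m, ∀ j ≤ J, T.Fill m (4 * R (j + 1)) (R j) := fun m j hj =>
    (hfill m (R j) (Finset.mem_image_of_mem _ (Finset.mem_range.2 (by omega)))).mono (hRΔ j) le_rfl
  have hκω : R (J + 1) ≤ ω (R J) := by linarith [hRω J, hR (J + 1)]
  have hκε : R (J + 1) ≤ ε := (hRa (Nat.zero_le _)).trans (by rw [hRε]; linarith)
  -- subdivision of the unit interval
  obtain ⟨M, τ, hτ0, hτM, hτ⟩ := exists_subdivision (hω _ (hR J))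
  have hsnd : ∀ (t : unitInterval) (x y : X), dist (t, x) (t, y) = dist x y := fun t x y => by
    simp [Prod.dist_eq]
  have hfst : ∀ (s t : unitInterval) (x : X), dist (s, x) (t, x) = dist s t := fun s t x => by
    simp [Prod.dist_eq]
  -- the chain maps
  have hφ : ∀ g : S, ∃ f, (g = ⟨1, hS⟩ → f = T.p) ∧ T.IsChainMap f ∧
      ∀ b, ∀ b' ∈ (f (single b 1)).support, T.deg b ≠ 0 →
        dist (T.loc b') (A.φ g (T.loc b)) < 2 * R (2 * k + 3) := by
    intro g
    -- For the trivial element the projection is taken, since it represents the identity strictly.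
    by_cases hg : g = ⟨1, hS⟩
    · refine ⟨T.p, fun _ => rfl, T.isChainMap_p, fun b b' hb' h0 => ?_⟩
      rw [hg, A.φ_one]
      have h1 := hpc b b' hb' h0
      have h2 := hRa (show 2 * k + 3 ≤ J + 1 by omega)
      have h3 := hR (2 * k + 3)
      rw [ContinuousMap.id_apply]
      linarith
    · obtain ⟨f, hf, hfc⟩ := LocComplex.exists_isChainMap hR hRa hdeg (a := 2 * k + 3)
        (fun m j hj => hfill' m j (by omega)) (hRa (show 2 * k + 3 + k ≤ J by omega)) (A.φ g)
        (fun b b' hb' h0 => (hωφ _ (hR J) g _ _ ((hdc b b' hb' h0).trans_le hκω)).le)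
        (fun b b' hb' h0 => (hωφ _ (hR J) g _ _ ((hpc b b' hb' h0).trans_le hκω)).le)
      refine ⟨f, fun h => absurd h hg, hf, fun b b' hb' h0 => ?_⟩
      have h1 := hfc b b' hb' h0
      have h2 := hRa (show 2 * k + 3 ≤ J by omega)
      linarith
  choose φ hφ1 hφm hφc using hφ
  have hRs : 2 * R (2 * k + 3) < R (2 * k + 1) := by
    have h1 := hR4 (2 * k + 2)
    have h2 := hR4 (2 * k + 1)
    have h3 := hR (2 * k + 3)
    have h4 := hR (2 * k + 1)
    linarith
  have hRε' : R (2 * k + 1) ≤ ε := (hRa (Nat.zero_le _)).trans (by rw [hRε]; linarith)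
  have hcomp : ∀ g h : S, ∀ b, ∀ b' ∈ ((φ g ∘ₗ φ h) (single b 1)).support, T.deg b ≠ 0 →
      dist (T.loc b') (A.φ g (A.φ h (T.loc b))) < R (2 * k + 1) := by
    intro g h b b'' hb'' h0
    obtain ⟨b', h1, h2, h3⟩ := (hφm h).exists_of_mem_support_comp hb''
    have h4 := hφc h b b' h2 h0
    have h5 := hφc g b' b'' h3 (by omega)
    have h6 : dist (A.φ g (T.loc b')) (A.φ g (A.φ h (T.loc b))) < R (2 * k + 2) :=
      hωφ _ (hR _) g _ _ (by linarith [hRω (2 * k + 2), hR (2 * k + 3)])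
    have h7 := dist_triangle (T.loc b'') (A.φ g (T.loc b')) (A.φ g (A.φ h (T.loc b)))
    linarith [hR4 (2 * k + 2), hR4 (2 * k + 1), hR (2 * k + 1), hR (2 * k + 2)]
  refine ⟨T, hp0, fun b b' hb' h0 => ((hdc b b' hb' h0).trans_le hκε).le,
    fun b b' hb' h0 => ((hpc b b' hb' h0).trans_le hκε).le, ?_, φ, hφ1 _ rfl, hφm,
    fun g b b' hb' h0 => ((hφc g b b' hb' h0).trans (hRs.trans_le hRε')).le, fun g h hgh => ?_⟩
  -- Filling the augmentation generator near `z` gives a point chain `w`, and the contraction of `X`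
  -- to `z` gives the homotopy from the projection to `collapse w`.
  · obtain ⟨w, hw, hpw, hdw⟩ := hfill' 0 J le_rfl z _ (T.pt_mem_Sub _) T.p_pt T.d_pt
    have hw1 : ∀ b ∈ w.support, T.deg b = 1 := fun b hb => (hw hb).1
    have hc := LocComplex.isChainMap_collapse hw1 hpw hdw
    obtain ⟨K, hK, -⟩ := LocComplex.exists_isChainHomotopy hR hRa hdeg (a := 0)
      (fun m j hj => hfill' m j (by omega)) (hR J).le (hRa (by omega))
      (fun j x => C (τ j, x)) M
      (fun b b' hb' h0 j => (hωC _ (hR J) _ _ (by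
        rw [hsnd]; exact (hdc b b' hb' h0).trans_le hκω)).le)
      (fun b b' hb' h0 j => (hωC _ (hR J) _ _ (by
        rw [hsnd]; exact (hpc b b' hb' h0).trans_le hκω)).le)
      (fun x j => (hωC _ (hR J) _ _ (by rw [hfst]; exact hτ j)).le) hc T.isChainMap_p
      (fun b b' hb' h0 => by
        rw [LocComplex.collapse_apply, single_eq_of_ne
          (fun h => h0 ((T.deg_eq_zero b).2 h.symm)), zero_smul, zero_add] at hb'
        have h1 : dist (T.loc b') z < R J := (hw (support_smul hb')).2.resolve_left (by omega)
        have h2 := hRa (show 0 + 2 * k + 1 ≤ J by omega)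
        rw [hτM, C.apply_one]
        exact h1.trans_le h2)
      (fun b b' hb' h0 => by
        rw [hτ0, C.apply_zero]
        exact (hpc b b' hb' h0).trans_le (hRa (by omega)))
    exact ⟨w, K, hw1, hpw, hdw, hK⟩
  · by_cases hone : g = ⟨1, hS⟩ ∧ h = ⟨1, hS⟩
    · obtain ⟨rfl, rfl⟩ := hone
      have e : (⟨(1 : G) * 1, hgh⟩ : S) = ⟨1, hS⟩ := Subtype.ext (one_mul 1)
      refine ⟨0, fun _ _ => rfl, ?_, fun b b' hb' => by simp at hb'⟩
      have e' : φ ⟨1, hS⟩ ∘ₗ φ ⟨1, hS⟩ = φ ⟨(1 : G) * 1, hgh⟩ := by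
        rw [e, hφ1 _ rfl, T.isHomog_p.p_f]
      rw [e']
      exact LocComplex.IsChainMap.isChainHomotopy_zero
    -- Time is reversed, because the composite must lie over the last stage of the path while
    -- `H_{g,h}` begins at the composite.
    · obtain ⟨H, hH, hHc⟩ := LocComplex.exists_isChainHomotopy hR hRa hdeg (a := 0)
        (fun m j hj => hfill' m j (by omega)) (hR J).le (hRa (by omega))
        (fun j x => A.H g h hgh (unitInterval.symm (τ j), x)) M
        (fun b b' hb' h0 j => (hωH _ (hR J) _ _ _ _ _ (by
          rw [hsnd]; exact (hdc b b' hb' h0).trans_le hκω)).le)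
        (fun b b' hb' h0 j => (hωH _ (hR J) _ _ _ _ _ (by
          rw [hsnd]; exact (hpc b b' hb' h0).trans_le hκω)).le)
        (fun x j => (hωH _ (hR J) _ _ _ _ _ (by
          rw [hfst]
          refine lt_of_eq_of_lt ?_ (hτ j)
          rw [dist_comm (τ j)]
          rw [Subtype.dist_eq, Subtype.dist_eq, Real.dist_eq, Real.dist_eq,
            unitInterval.coe_symm_eq, unitInterval.coe_symm_eq]
          congr 1
          ring)).le)
        ((hφm g).comp (hφm h)) (hφm ⟨g * h, hgh⟩)
        (fun b b' hb' h0 => by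
          rw [hτM, unitInterval.symm_one, (A.H g h hgh).apply_zero, zero_add]
          exact hcomp g h b b' hb' h0)
        (fun b b' hb' h0 => by
          rw [hτ0, unitInterval.symm_zero, (A.H g h hgh).apply_one, zero_add]
          exact (hφc _ b b' hb' h0).trans hRs)
      refine ⟨H, fun h1 h2 => absurd ⟨h1, h2⟩ hone, hH, fun b b' hb' h0 => ?_⟩
      obtain ⟨j, -, hj⟩ := hHc b b' hb' h0
      refine ⟨unitInterval.symm (τ j), hj.le.trans ?_⟩
      have := hRa (Nat.zero_le J)
      rw [hRε] at this ⊢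
      linarith

end action

end ControlledAlgebra

theorem mainTheorem11 {G : Type v} [Group G] (N : ℕ) {X : Type u} [MetricSpace X]
    [CompactSpace X] [ContractibleSpace X] (hX : ControlledAlgebra.IsControlledDominated N X)
    (S : Finset G) (hS : (1 : G) ∈ S) (A : ControlledAlgebra.HomotopyAction S hS X)
    (ε : ℝ) (hε : 0 < ε) :
    ∃ P : ControlledAlgebra.HomotopyChainComplex S hS X,
      ControlledAlgebra.IsConcentrated N P.P ∧
      ControlledAlgebra.IsControlledComplex ε P.P ∧
      (∀ x₀ : X, ∃ f : P.P ⟶ (ControlledAlgebra.trivialHomotopyChainComplex S hS x₀).P,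
        ControlledAlgebra.IsHomotopyChainEquiv P
          (ControlledAlgebra.trivialHomotopyChainComplex S hS x₀) f) ∧
      (∀ (g : S) (x y : X), (x, y) ∈ ControlledAlgebra.chainMapSupp (P.φ g) →
        dist x (A.φ g y) ≤ ε) ∧
      (∀ (g h : S) (hgh : (g : G) * (h : G) ∈ S) (x y : X),
        (x, y) ∈ ControlledAlgebra.homotopySupp (P.H g h hgh) →
        ∃ t : unitInterval, dist x (A.H g h hgh (t, y)) ≤ ε) := by
  obtain ⟨T, hp0, hd, hp, ⟨w, K, hw, hpw, hdw, hK⟩, φ, hφ1, hφ, hφc, hH⟩ :=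
    ControlledAlgebra.exists_chain_action hX (hS := hS) A hε
  choose H hH1 hH hHc using hH
  refine ⟨{
    P := T.toComplex
    φ := fun g => (hφ g).toHom
    H := fun g h hgh => (Homotopy.ofEq ((hφ h).toHom_comp (hφ g) ((hφ g).comp (hφ h)))).trans
      ((hH g h hgh).toHomotopy ((hφ g).comp (hφ h)) (hφ _))
    φ_one := ?_
    H_one := fun h m n => ?_ }, T.isConcentrated_toComplex hp0,
    T.isControlledComplex_toComplex hd hp, fun x₀ => ⟨T.toTrivial x₀, fun g => ⟨Homotopy.ofEq ?_⟩,
      ControlledAlgebra.LocComplex.exists_homotopyEquiv_trivial hw hpw hdw hK⟩,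
    fun g x y hxy => ?_, fun g h hgh x y hxy => ?_⟩
  · have h : (hφ ⟨1, hS⟩).toHom = T.isChainMap_p.toHom :=
      HomologicalComplex.hom_ext _ _ fun i => congrArg (T.objHom i i) hφ1
    exact h.trans ControlledAlgebra.LocComplex.toHom_isChainMap_p
  -- The homotopy coming from the equality of chain maps contributes zero, so only the component of
  -- `H` remains.
  · refine (zero_add (T.objHom m n (H _ _ h))).trans ?_
    rw [hH1 _ _ h rfl rfl]
    exact ControlledAlgebra.LocComplex.objHom_eq_zero (by simp)
  · exact ((hφ g).toHom_comp_toTrivial).trans (Category.comp_id _).symm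
  · obtain ⟨n, hn⟩ := Set.mem_iUnion.1 hxy
    obtain ⟨b, b', rfl, rfl, hb, hb'⟩ :=
      ControlledAlgebra.LocComplex.exists_of_mem_supp_objHom (hφ g).toIsHomog hn
    exact hφc g b b' hb' (by omega)
  · obtain ⟨n, hn⟩ := Set.mem_iUnion.1 hxy
    have hn' : (x, y) ∈ ControlledAlgebra.supp (T.objHom n (n + 1) (H g h hgh)).f :=
      (zero_add (T.objHom n (n + 1) (H g h hgh))) ▸ hn
    obtain ⟨b, b', rfl, rfl, hb, hb'⟩ :=
      ControlledAlgebra.LocComplex.exists_of_mem_supp_objHom (hH g h hgh).toIsHomog hn'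
    exact hHc g h hgh b b' hb' (by omega)
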